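/- Let $\mathbb K$ be an algebraically closed field of characteristic $0$, and let $\mathfrak g$ be a root-reductive Lie algebra over $\mathbb K$: $\mathfrak g$ is the union of finite-dimensional reductive subalgebras $\mathfrak g_1\subseteq\mathfrak g_2\subseteq\cdots$ having Cartan subalgebras $\mathfrak k_1\subseteq\mathfrak k_2\subseteq\cdots$, $\mathfrak k_n\subseteq\mathfrak g_n$, such that for each $n$ the subalgebra $\mathfrak g_n\cap\mathfrak k_{n+1}$ is a Cartan subalgebra of $\mathfrak g_n$ and each root space of $\mathfrak g_n$ with respect to it is a root space of $\mathfrak g_{n+1}$ with respect to $\mathfrak k_{n+1}$. Let $\mathfrak h$ be a splitting maximal toral subalgebra of $\mathfrak g$: $\mathfrak h$ meets each term of some nested exhaustion of $\mathfrak g$ by finite-dimensional reductive subalgebras in a maximal toral subalgebra, and $\mathfrak g=\mathfrak h\oplus\bigoplus_{\alpha\in\Delta}\mathfrak g^\alpha$ with $\mathfrak g^0=\mathfrak h$, where $\mathfrak g^\alpha=\{x:[h,x]=\alpha(h)x\ \forall h\in\mathfrak h\}$ and $\Delta=\{\alpha\in\mathfrak h^*\smallsetminus\{0\}:\mathfrak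 g^\alpha\ne0\}$. Let $\mathfrak b\supseteq\mathfrak h$ be a splitting Borel subalgebra (a maximal locally solvable subalgebra containing a splitting maximal toral subalgebra) which is Dynkin: with $\Delta^+=\{\alpha\in\Delta:\mathfrak g^\alpha\subseteq\mathfrak b\}$, $\mathfrak b$ is generated by $\mathfrak h$ and those $\mathfrak g^\alpha$, $\alpha\in\Delta^+$, for which $\alpha$ is not a sum of two or more elements of $\Delta^+$. Put $\mathfrak n=[\mathfrak b,\mathfrak b]$, and write $\lambda\preceq\mu$ if $\mu-\lambda\in\mathbb Z_{\ge0}\Delta^+$. For $\mu\in\mathfrak h^*$ let $L(\mu)$ be the quotient of the Verma module $M(\mu)=U(\mathfrak g)/\big(U(\mathfrak g)\mathfrak n+\sum_{h\in\mathfrak h}U(\mathfrak g)(h-\mu(h))\big)$ by the sum of its proper submodules. Let $\bar{\mathcal O}$ be the category of $\mathfrak g$-modules $M$ that are the direct sum of their $\mathfrak h$-weight spaces $M^\mu$, with every $M^\mu$ finite dimensional and with $U(\mathfrak n)v$ finite dimensional for every $v\in M$. A *generalized composition series* of $M$ is a family of submodules $(M_j)_{j\in\mathcal J}$, indexed by a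 totally ordered set $\mathcal J$, such that, with $M_{<j}:=\bigcup_{k<j}M_k$ (and $M_{<j}:=0$ if $j$ is the least element): (i) $M_j\subsetneq M_k$ whenever $j<k$; (ii) every nonzero $v\in M$ lies in $M_j\smallsetminus M_{<j}$ for some $j\in\mathcal J$; (iii) $M_j/M_{<j}$ is simple for every $j\in\mathcal J$. For $\lambda\preceq\nu$, a *composition series of $M$ with bounds $\lambda,\nu$* is a filtration by submodules $0=M_0\subseteq M_1\subseteq\cdots\subseteq M_k=M$ together with a subset $J\subseteq\{1,\dots,k\}$ such that: if $j\in J$, then $M_j/M_{j-1}\cong L(\xi)$ for some $\xi$ with $\lambda\preceq\xi\preceq\nu$; if $j\notin J$, then either $(M_j/M_{j-1})^\mu=0$ for all $\mu$ with $\lambda\preceq\mu\preceq\nu$, or $M_j/M_{j-1}\cong L(\xi)$ for some $\xi$ with $\lambda\prec\xi$ and $\xi\not\preceq\nu$. **Theorem.** Let $M\in\bar{\mathcal O}$. 1. Any two generalized composition series $(M_j)_{j\in\mathcal J}$, $(M'_{j'})_{j'\in\mathcal J'}$ of $M$ are equivalent: there is a bijection $f:\mathcal J\to\mathcal J'$ with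 $M_j/M_{<j}\cong M'_{f(j)}/M'_{<f(j)}$ for all $j\in\mathcal J$. 2. If $\lambda\preceq\nu$, then any two composition series of $M$ with bounds $\lambda,\nu$, with index sets $J$ and $J'$, are equivalent: there is a bijection $f:J\to J'$ with $M_j/M_{j-1}\cong M'_{f(j)}/M'_{f(j)-1}$ for all $j\in J$. 3. For every $\mu\in\mathfrak h^*$ there is a unique number $[M:L(\mu)]\in\mathbb Z_{\ge0}$ such that for all $\lambda,\nu$ with $\lambda\preceq\mu\preceq\nu$, composition series of $M$ with bounds $\lambda,\nu$ exist and in each of them exactly $[M:L(\mu)]$ of the factors $M_j/M_{j-1}$, $1\le j\le k$, are isomorphic to $L(\mu)$. -/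

import Mathlib

namespace ExtO

/-! ### Weight spaces, reductive subalgebras and root-reductive Lie algebras -/

section RootReductive

variable {K : Type*} [Field K] {g : Type*} [LieRing g] [LieAlgebra K g]

/-- The weight space `{v ∈ M | x • v = χ(x) v for all x ∈ h}` of the `g`-module `M`. For `M = g`
(adjoint action) this is the root space `g^χ`. -/
def weightSpace (h : LieSubalgebra K g) (M : Type*) [AddCommGroup M] [Module K M]
    [LieRingModule g M] [LieModule K g M] (χ : Module.Dual K h) : Submodule K M where
  carrier := {v | ∀ x : h, ⁅(x : g), v⁆ = χ x • v}
  add_mem' := by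
    intro a b ha hb x
    rw [lie_add, ha x, hb x, smul_add]
  zero_mem' := by
    intro x
    rw [lie_zero, smul_zero]
  smul_mem' := by
    intro c a ha x
    rw [lie_smul, ha x, smul_comm]

/-- `l` is a finite-dimensional reductive subalgebra (its radical is its center). -/
def IsFinDimReductive (l : LieSubalgebra K g) : Prop :=
  FiniteDimensional K l ∧ LieAlgebra.HasCentralRadical K l

/-- `c` is a Cartan subalgebra of the subalgebra `l`. -/
def IsCartanOf (c l : LieSubalgebra K g) : Prop :=
  c ≤ l ∧ (c.comap l.incl).IsCartanSubalgebra

/-- `R` is a root space of the subalgebra `l` with respect to its subalgebra `c`. -/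
def IsRootSpaceOf (l c : LieSubalgebra K g) (R : Submodule K g) : Prop :=
  ∃ α : Module.Dual K c, α ≠ 0 ∧ R ≠ ⊥ ∧ R = l.toSubmodule ⊓ weightSpace c g α

/-- `l ⊆ m` is a root inclusion with respect to the Cartan subalgebra `c` of `m`. -/
def IsRootInclusion (l m c : LieSubalgebra K g) : Prop :=
  l ≤ m ∧ IsCartanOf c m ∧ IsCartanOf (l ⊓ c) l ∧
    ∀ R : Submodule K g, IsRootSpaceOf l (l ⊓ c) R → IsRootSpaceOf m c R

variable (K g) in
/-- `g` is the union of a nested sequence of finite-dimensional reductive subalgebras `G n`, with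
nested Cartan subalgebras `C n` of `G n`, such that `G n ⊆ G (n + 1)` is a root inclusion with
respect to `C (n + 1)`. (Such a `g` is automatically locally finite.) -/
def IsRootReductive : Prop :=
  ∃ G C : ℕ → LieSubalgebra K g,
    Monotone G ∧ Monotone C ∧ (∀ n, IsFinDimReductive (G n)) ∧ (∀ n, IsCartanOf (C n) (G n)) ∧
    (∀ n, IsRootInclusion (G n) (G (n + 1)) (C (n + 1))) ∧ ∀ x : g, ∃ n, x ∈ G n

/-- A subalgebra `t` of `L` is toral if all its elements are semisimple, i.e. act semisimply in
the adjoint representation of `L`. -/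
def IsToral {L : Type*} [LieRing L] [LieAlgebra K L] (t : LieSubalgebra K L) : Prop :=
  ∀ x ∈ t, (LieAlgebra.ad K L x).IsSemisimple

/-- `h` is a splitting maximal toral subalgebra: it meets each term of some exhaustion of `g` by
finite-dimensional reductive subalgebras in a maximal toral subalgebra, and
`g = h ⊕ ⨁_{α ≠ 0} g^α` with `h = g^0`. (Weight spaces are always linearly independent.) -/
def IsSplittingMaximalToral (h : LieSubalgebra K g) : Prop :=
  (∃ G : ℕ → LieSubalgebra K g,
    Monotone G ∧ (∀ n, IsFinDimReductive (G n)) ∧ (∀ x : g, ∃ n, x ∈ G n) ∧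
    ∀ n, Maximal IsToral (h.comap (G n).incl)) ∧
  (⨆ α : Module.Dual K h, weightSpace h g α) = ⊤ ∧
  weightSpace h g 0 = h.toSubmodule

/-- Every finite-dimensional subalgebra of `b` is solvable. -/
def IsLocallySolvable (b : LieSubalgebra K g) : Prop :=
  ∀ s : LieSubalgebra K g, s ≤ b → FiniteDimensional K s → LieAlgebra.IsSolvable s

/-- `b` is a splitting Borel subalgebra: a maximal locally solvable subalgebra that contains some
splitting maximal toral subalgebra. -/
def IsSplittingBorel (b : LieSubalgebra K g) : Prop :=
  Maximal IsLocallySolvable b ∧ ∃ h : LieSubalgebra K g, IsSplittingMaximalToral h ∧ h ≤ b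

/-- The set `Δ⁺` of `b`-positive roots: the roots whose root space lies in `b`. -/
def posRoots (h b : LieSubalgebra K g) : Set (Module.Dual K h) :=
  {α | α ≠ 0 ∧ weightSpace h g α ≠ ⊥ ∧ weightSpace h g α ≤ b.toSubmodule}

/-- The set of simple `b`-positive roots: the positive roots that are not a finite sum of two or
more positive roots. -/
def simpleRoots (h b : LieSubalgebra K g) : Set (Module.Dual K h) :=
  {α | α ∈ posRoots h b ∧
    ¬ ∃ s : Multiset (Module.Dual K h), 2 ≤ s.card ∧ (∀ β ∈ s, β ∈ posRoots h b) ∧ s.sum = α}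

/-- `b` is generated by `h` and the simple root spaces. -/
def IsDynkin (h b : LieSubalgebra K g) : Prop :=
  LieSubalgebra.lieSpan K g
    ((h : Set g) ∪ ⋃ α ∈ simpleRoots h b, (weightSpace h g α : Set g)) = b

/-- The relation `χ ⪯ ψ` on `h*`: the difference `ψ - χ` lies in the `ℤ_{≥ 0}`-span of `Δ⁺`. -/
def Prec (h b : LieSubalgebra K g) (χ ψ : Module.Dual K h) : Prop :=
  ψ - χ ∈ AddSubmonoid.closure (posRoots h b)

/-- The subspace `n = [b, b]` of `g`. -/
def nilrad (b : LieSubalgebra K g) : Submodule K g :=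
  Submodule.span K {z | ∃ x ∈ b, ∃ y ∈ b, ⁅x, y⁆ = z}

end RootReductive

/-! ### The extended category O -/

section Modules

variable {K : Type*} [Field K] {g : Type*} [LieRing g] [LieAlgebra K g]

/-- `M` is an object of the extended category O: an `h`-weight module with finite-dimensional
weight spaces, in which every vector lies in a finite-dimensional `n`-stable subspace (that is,
`U(n) v` is finite dimensional for each `v`). -/
structure IsExtO (h b : LieSubalgebra K g) (M : Type*) [AddCommGroup M] [Module K M]
    [LieRingModule g M] [LieModule K g M] : Prop where
  weight : (⨆ χ : Module.Dual K h, weightSpace h M χ) = ⊤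
  finDim : ∀ χ : Module.Dual K h, FiniteDimensional K (weightSpace h M χ)
  locFin : ∀ v : M, ∃ W : Submodule K M,
    v ∈ W ∧ FiniteDimensional K W ∧ ∀ x ∈ nilrad b, ∀ w ∈ W, ⁅x, w⁆ ∈ W

/-! ### Verma modules and their simple quotients -/

/-- The left ideal of `U(g)` generated by `n` and by `x - χ(x)` for `x ∈ h`. -/
def vermaIdeal (h b : LieSubalgebra K g) (χ : Module.Dual K h) :
    Ideal (UniversalEnvelopingAlgebra K g) :=
  Ideal.span
    ({u | ∃ x ∈ nilrad b, u = UniversalEnvelopingAlgebra.ι K x} ∪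
      {u | ∃ x : h, u = UniversalEnvelopingAlgebra.ι K (x : g) -
        algebraMap K (UniversalEnvelopingAlgebra K g) (χ x)})

/-- The Verma module `M(χ) = U(g) / I`. -/
def Verma (h b : LieSubalgebra K g) (χ : Module.Dual K h) : Type _ :=
  UniversalEnvelopingAlgebra K g ⧸ vermaIdeal h b χ

noncomputable instance (h b : LieSubalgebra K g) (χ : Module.Dual K h) :
    AddCommGroup (Verma h b χ) :=
  inferInstanceAs (AddCommGroup (UniversalEnvelopingAlgebra K g ⧸ vermaIdeal h b χ))

noncomputable instance (h b : LieSubalgebra K g) (χ : Module.Dual K h) :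
    Module (UniversalEnvelopingAlgebra K g) (Verma h b χ) :=
  inferInstanceAs (Module (UniversalEnvelopingAlgebra K g)
    (UniversalEnvelopingAlgebra K g ⧸ vermaIdeal h b χ))

noncomputable instance (h b : LieSubalgebra K g) (χ : Module.Dual K h) :
    Module K (Verma h b χ) :=
  inferInstanceAs (Module K (UniversalEnvelopingAlgebra K g ⧸ vermaIdeal h b χ))

instance (h b : LieSubalgebra K g) (χ : Module.Dual K h) :
    IsScalarTower K (UniversalEnvelopingAlgebra K g) (Verma h b χ) :=
  inferInstanceAs (IsScalarTower K (UniversalEnvelopingAlgebra K g)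
    (UniversalEnvelopingAlgebra K g ⧸ vermaIdeal h b χ))

/-- `x ∈ g` acts on `M(χ)` as its image in `U(g)` does. -/
noncomputable instance (h b : LieSubalgebra K g) (χ : Module.Dual K h) :
    LieRingModule g (Verma h b χ) where
  bracket x v := UniversalEnvelopingAlgebra.ι K x • v
  add_lie x y v := by
    change UniversalEnvelopingAlgebra.ι K (x + y) • v = _
    rw [map_add, add_smul]
  lie_add x v w := smul_add _ v w
  leibniz_lie x y v := by
    let : LieRing (UniversalEnvelopingAlgebra K g) := LieRing.ofAssociativeRing
    change UniversalEnvelopingAlgebra.ι K x • UniversalEnvelopingAlgebra.ι K y • v =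
      UniversalEnvelopingAlgebra.ι K ⁅x, y⁆ • v +
        UniversalEnvelopingAlgebra.ι K y • UniversalEnvelopingAlgebra.ι K x • v
    rw [LieHom.map_lie, LieRing.of_associative_ring_bracket, sub_smul, mul_smul, mul_smul]
    abel

noncomputable instance (h b : LieSubalgebra K g) (χ : Module.Dual K h) :
    LieModule K g (Verma h b χ) where
  smul_lie c x v := by
    change UniversalEnvelopingAlgebra.ι K (c • x) • v = c • UniversalEnvelopingAlgebra.ι K x • v
    rw [map_smul, smul_assoc]
  lie_smul c x v := by
    change UniversalEnvelopingAlgebra.ι K x • c • v = c • UniversalEnvelopingAlgebra.ι K x • v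
    rw [← algebraMap_smul (UniversalEnvelopingAlgebra K g) c v,
      ← algebraMap_smul (UniversalEnvelopingAlgebra K g) c
        (UniversalEnvelopingAlgebra.ι K x • v), smul_smul, smul_smul, Algebra.commutes]

/-- The quotient `L(χ)` of `M(χ)` by the sum of all its proper submodules. -/
abbrev SimpleHW (h b : LieSubalgebra K g) (χ : Module.Dual K h) : Type _ :=
  Verma h b χ ⧸ (sSup {N : LieSubmodule K g (Verma h b χ) | N ≠ ⊤})

/-! ### Composition series -/

variable {M : Type*} [AddCommGroup M] [Module K M] [LieRingModule g M] [LieModule K g M]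

/-- The quotient module `A / (A ∩ B)`; it is `A / B` when `B ⊆ A`. -/
abbrev Subquot (A B : LieSubmodule K g M) : Type _ := A ⧸ B.comap A.incl

/-- `M_{<j}`, the union of the chain of submodules `M_k` with `k < j` (zero if there are none). -/
def below {J : Type*} [LinearOrder J] (S : J → LieSubmodule K g M) (j : J) :
    LieSubmodule K g M :=
  ⨆ k : J, ⨆ _ : k < j, S k

variable (K g M) in
/-- Generalized composition series of `M` indexed by the totally ordered set `J`: a strictly
increasing family of submodules with simple quotients `M_j / M_{<j}` in which no part of `M` is
lost: every nonzero vector lies in some layer `M_j ∖ M_{<j}`. In particular the `M_j` have union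
`M`, and (if `J` is nonempty) the `M_{<j}` have intersection `0`. -/
structure GenCompSeries (J : Type*) [LinearOrder J] where
  sub : J → LieSubmodule K g M
  strictMono : StrictMono sub
  exhaust : ∀ v : M, v ≠ 0 → ∃ j, v ∈ sub j ∧ v ∉ below sub j
  simple : ∀ j, LieModule.IsIrreducible K g (Subquot (sub j) (below sub j))

/-- Equivalence of generalized composition series: a bijection of the index sets (not necessarily
monotone) that matches the simple quotients up to isomorphism. -/
def GenCompSeries.Equivalent {J J' : Type*} [LinearOrder J] [LinearOrder J']
    (S : GenCompSeries K g M J) (S' : GenCompSeries K g M J') : Prop :=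
  ∃ f : J ≃ J', ∀ j, Nonempty
    (Subquot (S.sub j) (below S.sub j) ≃ₗ⁅K,g⁆ Subquot (S'.sub (f j)) (below S'.sub (f j)))

variable (M) in
/-- Composition series `0 = M_0 ⊆ ⋯ ⊆ M_k = M` of `M` with bounds `χ` and `ψ`. The index `j : Fin k`
stands for the factor `M_{j+1} / M_j`; `rel` is the relevant index set. -/
structure BddCompSeries (h b : LieSubalgebra K g) (χ ψ : Module.Dual K h) where
  length : ℕ
  sub : Fin (length + 1) → LieSubmodule K g M
  mono : Monotone sub
  bot : sub 0 = ⊥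
  top : sub (Fin.last length) = ⊤
  rel : Set (Fin length)
  of_rel : ∀ j ∈ rel, ∃ ξ : Module.Dual K h, Prec h b χ ξ ∧ Prec h b ξ ψ ∧
    Nonempty (Subquot (sub j.succ) (sub j.castSucc) ≃ₗ⁅K,g⁆ SimpleHW h b ξ)
  of_not_rel : ∀ j ∉ rel,
    (∀ μ : Module.Dual K h, Prec h b χ μ → Prec h b μ ψ →
      weightSpace h (Subquot (sub j.succ) (sub j.castSucc)) μ = ⊥) ∨
    ∃ ξ : Module.Dual K h, Prec h b χ ξ ∧ ξ ≠ χ ∧ ¬ Prec h b ξ ψ ∧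
      Nonempty (Subquot (sub j.succ) (sub j.castSucc) ≃ₗ⁅K,g⁆ SimpleHW h b ξ)

namespace BddCompSeries

variable {h b : LieSubalgebra K g} {χ ψ : Module.Dual K h}

/-- The factor `M_{j+1} / M_j`. -/
abbrev Factor (S : BddCompSeries M h b χ ψ) (j : Fin S.length) : Type _ :=
  Subquot (S.sub j.succ) (S.sub j.castSucc)

/-- Equivalence of composition series with bounds: a bijection of the relevant index sets that
matches the factors up to isomorphism. -/
def Equivalent (S S' : BddCompSeries M h b χ ψ) : Prop :=
  ∃ f : S.rel ≃ S'.rel, ∀ j : S.rel,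
    Nonempty (S.Factor (j : Fin S.length) ≃ₗ⁅K,g⁆ S'.Factor (f j : Fin S'.length))

/-- The number of times `L(μ)` occurs as a factor. -/
noncomputable def mult (S : BddCompSeries M h b χ ψ) (μ : Module.Dual K h) : ℕ :=
  Nat.card {j : Fin S.length // Nonempty (S.Factor j ≃ₗ⁅K,g⁆ SimpleHW h b μ)}

end BddCompSeries

end Modules

end ExtO

/-! Uniqueness is one Jordan–Hölder argument for two totally ordered families of layers `[lo i, hi
i]`, each catching every nonzero vector (`IsLayering`). An irreducible layer `A / B` is sent to the
layer `[B', A']` of the other family at which the trace of that family on `A / B` jumps from zero to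
everything (`Meets`). If `A' / B'` is irreducible too, the relation is symmetric and both factors
are quotients of `A ⊓ A'` with the same kernel, as in Zassenhaus' lemma; so the two assignments are
mutually inverse and preserve factors (`IsLayering.exists_equiv`). For infinite index sets the point
is that a jump exists: since the weight space `M^μ` is finite dimensional, some layer is lowest
among those catching a vector of weight `μ` from `A ∖ B` (`IsLayering.exists_meets`). For bounded
series, a layer met by a copy of `L(μ)` has `μ` as a weight and, if it is `L(ξ)`, satisfies `ξ = μ`;
hence relevant factors meet only relevant ones (`BddCompSeries.mem_rel_of_meets`).

Existence rests on the finiteness of the intervals for `⪯`: some finite-dimensional `n`-stable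
subspace `F` contains every `M^μ` with `μ` between the bounds. If `A ≤ B` and `B / A` still has such
a weight, a weight vector in `F ⊓ B`, outside `A`, of maximal weight `ξ ⪰ χ` is killed by `n` modulo
`A` and produces a factor `L(ξ)` between `A` and `B`. Each such factor uses up part of `F`, so the
process stops.

Three facts on roots and Verma modules support this. Trace forms on the reductive terms of an
exhaustion give opposite root vectors, hence `sl₂`-triples; with local solvability and maximality of
`b`, the positive cone is pointed and every root is positive or negative, so that `g = n⁻ ⊕ b`. The
Dynkin condition makes the cone generated by simple roots, and positivity of Killing forms on
coroots makes decompositions into simple roots unique, so intervals are finite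
(`finite_setOf_prec`). Finally `M(χ) ≠ 0`, because `g` acts on `U(n⁻)` with `b` acting on `1` by a
character (`exists_induced_module`); this yields simple modules `L(χ)` that determine `χ`. -/

namespace ExtO

open Module

/-! ### Weight vectors and sums of weight spaces. -/

section Weights

/-- A subspace stable under operators `T i` contains the components of its elements in pairwise
distinct simultaneous eigenspaces. -/
theorem mem_of_sum_eigenvectors_mem {K M ι σ : Type*} [Field K] [AddCommGroup M] [Module K M]
    (T : ι → Module.End K M) (N : Submodule K M) (hN : ∀ i, ∀ v ∈ N, T i v ∈ N) (c : σ → ι → K)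
    (S : Finset σ) (hc : Set.InjOn c S) (v : σ → M) (hv : ∀ s ∈ S, ∀ i, T i (v s) = c s i • v s)
    (hsum : ∑ s ∈ S, v s ∈ N) : ∀ s ∈ S, v s ∈ N := by
  classical
  induction S using Finset.strongInduction generalizing v with
  | H S ih =>
    intro s hs
    by_cases hall : ∀ s' ∈ S, s' ≠ s → v s' ∈ N
    · rw [← Finset.add_sum_erase S v hs] at hsum
      refine (Submodule.add_mem_iff_left N (Submodule.sum_mem _ fun s' hs' => ?_)).mp hsum
      exact hall s' (Finset.mem_of_mem_erase hs') (Finset.ne_of_mem_erase hs')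
    · push Not at hall
      obtain ⟨s', hs', hne, hnot⟩ := hall
      exfalso
      apply hnot
      have hcne : c s' ≠ c s := fun hh => hne (hc hs' hs hh)
      obtain ⟨i, hi⟩ := Function.ne_iff.mp hcne
      have hsub : S.erase s ⊂ S := Finset.erase_ssubset hs
      -- `T i - c s i` preserves `N`, kills `v s`, and multiplies `v s'` by the nonzero scalar `c s'
      -- i - c s i`.
      have key := ih (S.erase s) hsub (hc.mono (by simp)) (fun t => (c t i - c s i) • v t)
        (fun t ht j => by
          rw [map_smul, hv t (Finset.mem_of_mem_erase ht) j, smul_comm]) (by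
          have h1 : T i (∑ t ∈ S, v t) - c s i • ∑ t ∈ S, v t ∈ N :=
            N.sub_mem (hN i _ hsum) (N.smul_mem _ hsum)
          rw [map_sum, Finset.smul_sum, ← Finset.sum_sub_distrib,
            ← Finset.add_sum_erase S _ hs, hv s hs i, sub_self, zero_add] at h1
          convert h1 using 1
          refine Finset.sum_congr rfl fun t ht => ?_
          rw [hv t (Finset.mem_of_mem_erase ht) i, sub_smul])
        s' (Finset.mem_erase.mpr ⟨hne, hs'⟩)
      exact (N.smul_mem_iff (sub_ne_zero.mpr hi)).mp key

variable {K : Type*} [Field K] {g : Type*} [LieRing g] [LieAlgebra K g]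
  {h : LieSubalgebra K g} {M : Type*} [AddCommGroup M] [Module K M]
  [LieRingModule g M] [LieModule K g M]

/-- The sum of the weight spaces whose weight lies in `A`. -/
def weightSum (h : LieSubalgebra K g) (M : Type*) [AddCommGroup M] [Module K M]
    [LieRingModule g M] [LieModule K g M] (A : Set (Dual K h)) : Submodule K M :=
  ⨆ χ ∈ A, weightSpace h M χ

theorem weightSpace_le_weightSum {A : Set (Dual K h)} {χ : Dual K h} (hχ : χ ∈ A) :
    weightSpace h M χ ≤ weightSum h M A :=
  le_iSup₂_of_le χ hχ le_rfl

theorem weightSum_le {A : Set (Dual K h)} {N : Submodule K M} :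
    weightSum h M A ≤ N ↔ ∀ χ ∈ A, weightSpace h M χ ≤ N := iSup₂_le_iff

theorem weightSum_mono {A B : Set (Dual K h)} (hAB : A ⊆ B) :
    weightSum h M A ≤ weightSum h M B :=
  weightSum_le.mpr fun _ hχ => weightSpace_le_weightSum (hAB hχ)

theorem weightSum_univ : weightSum h M Set.univ = ⨆ χ : Dual K h, weightSpace h M χ := by
  simp [weightSum]

/-- Elements of a sum of weight spaces are finite sums of weight vectors. -/
theorem exists_sum_of_mem_weightSum {A : Set (Dual K h)} {v : M} (hv : v ∈ weightSum h M A) :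
    ∃ (S : Finset (Dual K h)) (w : Dual K h → M), (∀ χ ∈ S, χ ∈ A) ∧
      (∀ χ, w χ ∈ weightSpace h M χ) ∧ (∀ χ ∉ S, w χ = 0) ∧ ∑ χ ∈ S, w χ = v := by
  classical
  have : weightSum h M A = ⨆ χ : Dual K h, ⨆ _ : χ ∈ A, weightSpace h M χ := rfl
  rw [this, Submodule.mem_iSup_iff_exists_finsupp] at hv
  obtain ⟨f, hf, hsum⟩ := hv
  refine ⟨f.support, f, fun χ hχ => ?_, fun χ => ?_, fun χ hχ => by simpa using hχ, hsum⟩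
  · by_contra hA
    have := hf χ
    simp [hA] at this
    simp [this] at hχ
  · exact (iSup_le fun _ => le_rfl : ⨆ _ : χ ∈ A, weightSpace h M χ ≤ weightSpace h M χ) (hf χ)

theorem mem_of_sum_mem (N : Submodule K M) (hN : ∀ x ∈ h, ∀ v ∈ N, ⁅x, v⁆ ∈ N)
    (S : Finset (Dual K h)) (v : Dual K h → M) (hv : ∀ χ ∈ S, v χ ∈ weightSpace h M χ)
    (hsum : ∑ χ ∈ S, v χ ∈ N) : ∀ χ ∈ S, v χ ∈ N :=
  mem_of_sum_eigenvectors_mem (fun x : h => LieModule.toEnd K g M x) N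
    (fun x v hv => hN x x.2 v hv) (fun χ x => χ x) S
    (fun χ _ ψ _ hh => LinearMap.ext fun x => congrFun hh x) v
    (fun χ hχ x => by rw [LieModule.toEnd_apply_apply]; exact hv χ hχ x) hsum

theorem eq_zero_of_sum_eq_zero (S : Finset (Dual K h)) (v : Dual K h → M)
    (hv : ∀ χ ∈ S, v χ ∈ weightSpace h M χ) (hsum : ∑ χ ∈ S, v χ = 0) : ∀ χ ∈ S, v χ = 0 :=
  fun χ hχ => by
    simpa using mem_of_sum_mem (h := h) (⊥ : Submodule K M) (by simp) S v hv (by simpa using hsum)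
      χ hχ

theorem lie_mem_weightSum {A : Set (Dual K h)} {x : g} (hx : x ∈ h) {v : M}
    (hv : v ∈ weightSum h M A) : ⁅x, v⁆ ∈ weightSum h M A := by
  have : weightSum h M A ≤ (weightSum h M A).comap (LieModule.toEnd K g M x) :=
    weightSum_le.mpr fun χ hχ v hv => by
      have := hv ⟨x, hx⟩
      simp only [Submodule.mem_comap, LieModule.toEnd_apply_apply]
      rw [show ⁅x, v⁆ = _ from this]
      exact Submodule.smul_mem _ _ (weightSpace_le_weightSum hχ hv)
  exact this hv

/-- A weight vector lying in a sum of weight spaces is zero, unless its weight occurs. -/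
theorem eq_zero_of_mem_weightSum {A : Set (Dual K h)} {χ : Dual K h} (hχ : χ ∉ A) {v : M}
    (hv : v ∈ weightSpace h M χ) (hvA : v ∈ weightSum h M A) : v = 0 := by
  classical
  obtain ⟨S, w, hS, hw, hw0, hsum⟩ := exists_sum_of_mem_weightSum hvA
  have hχS : χ ∉ S := fun hh => hχ (hS χ hh)
  have := eq_zero_of_sum_eq_zero (insert χ S) (fun ψ => if ψ = χ then -v else w ψ)
    (fun ψ _ => by
      by_cases hψ : ψ = χ
      · subst hψ; simpa using hv
      · simpa [hψ] using hw ψ) (by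
      rw [Finset.sum_insert hχS, if_pos rfl]
      have : ∑ ψ ∈ S, (if ψ = χ then -v else w ψ) = ∑ ψ ∈ S, w ψ :=
        Finset.sum_congr rfl fun ψ hψ => if_neg (by rintro rfl; exact hχS hψ)
      rw [this, hsum, neg_add_cancel]) χ (Finset.mem_insert_self _ _)
  simpa using this

/-- The second sum is `h`-stable, so it contains every weight component of the vector; components
with weight outside `B` therefore vanish. -/
theorem mem_weightSum_inter {A B : Set (Dual K h)} {v : M} (hA : v ∈ weightSum h M A)
    (hB : v ∈ weightSum h M B) : v ∈ weightSum h M (A ∩ B) := by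
  obtain ⟨S, w, hS, hw, hw0, rfl⟩ := exists_sum_of_mem_weightSum hA
  have key := mem_of_sum_mem (h := h) (weightSum h M B) (fun x hx v hv => lie_mem_weightSum hx hv)
    S w (fun χ _ => hw χ) hB
  refine Submodule.sum_mem _ fun χ hχ => ?_
  by_cases hχB : χ ∈ B
  · exact weightSpace_le_weightSum (show χ ∈ A ∩ B from ⟨hS χ hχ, hχB⟩) (hw χ)
  · rw [eq_zero_of_mem_weightSum hχB (hw χ) (key χ hχ)]
    exact Submodule.zero_mem _

/-- Stable subspaces of a weight module are spanned by weight vectors. -/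
theorem exists_sum_of_mem (hM : ⨆ χ : Dual K h, weightSpace h M χ = ⊤) (N : Submodule K M)
    (hN : ∀ x ∈ h, ∀ v ∈ N, ⁅x, v⁆ ∈ N) {v : M} (hv : v ∈ N) :
    ∃ (S : Finset (Dual K h)) (w : Dual K h → M), (∀ χ, w χ ∈ weightSpace h M χ) ∧
      (∀ χ, w χ ∈ N) ∧ (∀ χ ∉ S, w χ = 0) ∧ ∑ χ ∈ S, w χ = v := by
  have hv' : v ∈ weightSum h M Set.univ := by rw [weightSum_univ, hM]; trivial
  obtain ⟨S, w, hS, hw, hw0, rfl⟩ := exists_sum_of_mem_weightSum hv'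
  have key := mem_of_sum_mem (h := h) N hN S w (fun χ _ => hw χ) hv
  refine ⟨S, w, hw, fun χ => ?_, hw0, rfl⟩
  by_cases hχ : χ ∈ S
  · exact key χ hχ
  · rw [hw0 χ hχ]; exact N.zero_mem

theorem lie_mem_weightSpace_add {χ ψ : Dual K h} {x : g} {v : M}
    (hx : x ∈ weightSpace h g χ) (hv : v ∈ weightSpace h M ψ) :
    ⁅x, v⁆ ∈ weightSpace h M (χ + ψ) := by
  intro y
  rw [leibniz_lie, hx y, hv y, smul_lie, lie_smul, LinearMap.add_apply, add_smul]

theorem lie_mem_weightSum_of_forall {A B C : Set (Dual K h)}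
    (hABC : ∀ χ ∈ A, ∀ ψ ∈ B, ∀ x ∈ weightSpace h g χ, ∀ v ∈ weightSpace h M ψ,
      ⁅x, v⁆ ∈ weightSum h M C) {x : g} {v : M}
    (hx : x ∈ weightSum h g A) (hv : v ∈ weightSum h M B) : ⁅x, v⁆ ∈ weightSum h M C := by
  obtain ⟨S, w, hS, hw, -, rfl⟩ := exists_sum_of_mem_weightSum hx
  obtain ⟨S', w', hS', hw', -, rfl⟩ := exists_sum_of_mem_weightSum hv
  rw [sum_lie]
  refine Submodule.sum_mem _ fun χ hχ => ?_
  rw [lie_sum]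
  exact Submodule.sum_mem _ fun ψ hψ => hABC χ (hS χ hχ) ψ (hS' ψ hψ) _ (hw χ) _ (hw' ψ)

/-- A finite-dimensional subspace meets only finitely many weight spaces. -/
theorem finite_setOf_inf_weightSpace_ne_bot (F : Submodule K M) [FiniteDimensional K F] :
    {χ : Dual K h | F ⊓ weightSpace h M χ ≠ ⊥}.Finite := by
  classical
  set A := {χ : Dual K h | F ⊓ weightSpace h M χ ≠ ⊥} with hA
  have hex : ∀ χ : A, ∃ v : F, v ≠ 0 ∧ (v : M) ∈ weightSpace h M χ := by
    rintro ⟨χ, hχ⟩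
    obtain ⟨v, hv, hv0⟩ := (Submodule.ne_bot_iff _).mp hχ
    exact ⟨⟨v, hv.1⟩, by simpa [Subtype.ext_iff] using hv0, hv.2⟩
  choose v hv0 hv using hex
  have hli : LinearIndependent K v := by
    rw [linearIndependent_iff']
    intro S c hsum χ hχ
    have h1 : ∑ χ ∈ S, c χ • (v χ : M) = 0 := by
      have := congrArg (Submodule.subtype F) hsum
      simpa using this
    have h2 := eq_zero_of_sum_eq_zero (h := h) (S.image Subtype.val)
      (fun χ => if hχ : χ ∈ A then c ⟨χ, hχ⟩ • (v ⟨χ, hχ⟩ : M) else 0) (by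
        intro χ hχ
        obtain ⟨⟨χ', hχ'⟩, -, rfl⟩ := Finset.mem_image.mp hχ
        simp only [hχ', dite_true]
        exact Submodule.smul_mem _ _ (hv ⟨χ', hχ'⟩)) (by
        rw [Finset.sum_image (by intro a _ b _ hab; exact Subtype.ext hab), ← h1]
        exact Finset.sum_congr rfl fun χ _ => by simp) χ (Finset.mem_image_of_mem _ hχ)
    have h3 : c χ • (v χ : M) = 0 := by simpa using h2
    rcases smul_eq_zero.mp h3 with h4 | h4
    · exact h4
    · exact absurd (Subtype.ext h4) (hv0 χ)
  have := hli.finite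
  exact Set.toFinite A

/-- Weight vectors of a quotient of a weight module lift. -/
theorem exists_lift_weight {N : Type*} [AddCommGroup N] [Module K N] [LieRingModule g N]
    [LieModule K g N] (hM : ⨆ χ : Dual K h, weightSpace h M χ = ⊤) (f : M →ₗ⁅K,g⁆ N)
    {χ : Dual K h} {u : N} (hu : u ∈ weightSpace h N χ) {v : M} (hv : f v = u) :
    ∃ w ∈ weightSpace h M χ, f w = u := by
  classical
  obtain ⟨S, w, hw, -, hw0, hsum⟩ := exists_sum_of_mem hM ⊤ (by simp) (Submodule.mem_top (x := v))
  refine ⟨w χ, hw χ, ?_⟩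
  have hfw : ∀ ψ, f (w ψ) ∈ weightSpace h N ψ := fun ψ x => by
    rw [← LieModuleHom.map_lie, hw ψ x, map_smul]
  -- The images of the components of the lift, with `u` subtracted at `χ`, are weight vectors with
  -- sum zero; so each of them vanishes.
  have h1 := eq_zero_of_sum_eq_zero (h := h) (insert χ S)
    (fun ψ => if ψ = χ then f (w ψ) - u else f (w ψ))
    (fun ψ _ => by
      by_cases hψ : ψ = χ
      · subst hψ; simpa using Submodule.sub_mem _ (hfw ψ) hu
      · simpa [hψ] using hfw ψ) (by
      have h2 : ∑ ψ ∈ insert χ S, f (w ψ) = u := by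
        rw [← hv, ← hsum, map_sum]
        refine (Finset.sum_subset (Finset.subset_insert _ _) fun ψ _ hψ => ?_).symm
        rw [hw0 ψ hψ, map_zero]
      have h3 : ∀ ψ ∈ insert χ S, (if ψ = χ then f (w ψ) - u else f (w ψ)) =
          f (w ψ) - if ψ = χ then u else 0 := fun ψ _ => by split_ifs <;> simp
      rw [Finset.sum_congr rfl h3, Finset.sum_sub_distrib, h2]
      simp) χ (Finset.mem_insert_self _ _)
  simpa [sub_eq_zero] using h1

theorem iSup_weightSpace_lieSubmodule (hM : ⨆ χ : Dual K h, weightSpace h M χ = ⊤)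
    (N : LieSubmodule K g M) : ⨆ χ : Dual K h, weightSpace h N χ = ⊤ := by
  rw [eq_top_iff]
  rintro ⟨v, hv⟩ -
  obtain ⟨S, w, hw, hwN, -, hsum⟩ := exists_sum_of_mem hM N.toSubmodule
    (fun x _ v hv => N.lie_mem hv) hv
  have : (⟨v, hv⟩ : N) = ∑ χ ∈ S, ⟨w χ, hwN χ⟩ := by
    apply Subtype.ext
    simp [← hsum]
  rw [this]
  exact Submodule.sum_mem _ fun χ _ => Submodule.mem_iSup_of_mem χ fun x =>
    Subtype.ext (hw χ x)

end Weights

/-! ### Trace forms and reductive Lie algebras. -/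

section TraceForms

variable {K : Type*} [Field K]

/-- `E` and `F` preserve the `c`-eigenspace of `T`, where their commutator is the scalar `c`. A
commutator has trace zero, so `c` times the dimension vanishes. -/
theorem eq_zero_of_trace_restrict {V : Type*} [AddCommGroup V] [Module K V] [CharZero K]
    [FiniteDimensional K V] {T E F : Module.End K V} (hT : E * F - F * E = T) (hE : Commute T E)
    (hF : Commute T F) {c : K} (hc : T.HasEigenvalue c) : c = 0 := by
  set W := T.eigenspace c with hW
  have hEW : ∀ x ∈ W, E x ∈ W := Module.End.mapsTo_genEigenspace_of_comm hE c 1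
  have hFW : ∀ x ∈ W, F x ∈ W := Module.End.mapsTo_genEigenspace_of_comm hF c 1
  have key : (E.restrict hEW) * (F.restrict hFW) - (F.restrict hFW) * (E.restrict hEW) =
      c • (1 : Module.End K W) := by
    ext ⟨w, hw⟩
    have h1 : T w = c • w := Module.End.mem_eigenspace_iff.mp hw
    rw [← hT] at h1
    simpa using! h1
  have h2 := congrArg (LinearMap.trace K W) key
  rw [map_sub, LinearMap.trace_mul_comm, sub_self, map_smul, LinearMap.trace_one, smul_eq_mul,
    eq_comm, mul_eq_zero] at h2
  refine h2.resolve_right ?_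
  have : Nontrivial W := Submodule.nontrivial_iff_ne_bot.mpr hc
  exact Nat.cast_ne_zero.mpr Module.finrank_pos.ne'

theorem isNilpotent_of_forall_eigenvalue {V : Type*} [AddCommGroup V] [Module K V] [IsAlgClosed K]
    [FiniteDimensional K V] {T : Module.End K V} (hT : ∀ c, T.HasEigenvalue c → c = 0) :
    IsNilpotent T := by
  have htop := Module.End.iSup_maxGenEigenspace_eq_top T
  have h0 : T.maxGenEigenspace 0 = ⊤ := by
    rw [eq_top_iff, ← htop]
    refine iSup_le fun c => ?_
    by_cases hc : c = 0
    · rw [hc]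
    · have : ¬ T.HasEigenvalue c := fun hh => hc (hT c hh)
      have h1 : T.maxGenEigenspace c = ⊥ := by
        by_contra hne
        apply this
        rw [Module.End.maxGenEigenspace_eq] at hne
        exact Module.End.hasEigenvalue_of_hasGenEigenvalue hne
      rw [h1]; exact bot_le
  rw [Module.End.maxGenEigenspace_eq] at h0
  refine ⟨T.maxGenEigenspaceIndex 0, ?_⟩
  ext v
  have : v ∈ T.genEigenspace 0 (T.maxGenEigenspaceIndex 0) := by rw [h0]; trivial
  rw [Module.End.mem_genEigenspace_nat] at this
  simpa using this

variable {A : Type*} [LieRing A] [LieAlgebra K A]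

attribute [local instance 100] LieRing.ofAssociativeRing

/-- Invariance of the form under `y` gives `(a + b) κ(e, u) = 0`. -/
theorem killingForm_eq_zero_of_lie_eq_smul {y e u : A} {a b : K} (he : ⁅y, e⁆ = a • e)
    (hu : ⁅y, u⁆ = b • u) (hab : a + b ≠ 0) : killingForm K A e u = 0 := by
  have h1 : killingForm K A ⁅e, y⁆ u = killingForm K A e ⁅y, u⁆ :=
    LieModule.traceForm_apply_lie_apply K A A e y u
  rw [← lie_skew, he, hu, map_neg, map_smul, map_smul, LinearMap.neg_apply,
    LinearMap.smul_apply, smul_eq_mul, smul_eq_mul] at h1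
  have : (a + b) * killingForm K A e u = 0 := by linear_combination -h1
  exact (mul_eq_zero.mp this).resolve_left hab

/-- A commutator `[e, f]` that commutes with `e` and `f` acts nilpotently, and so does its product
with the commuting operator `ad x`. Hence `c κ(e, f) = κ([x, e], f) = κ(x, [e, f]) = 0`. -/
theorem killingForm_eq_zero_of_lie_lie_eq_zero [FiniteDimensional K A] [CharZero K]
    [IsAlgClosed K] {x e f : A} {c : K}
    (hx : ⁅x, e⁆ = c • e) (hc : c ≠ 0) (hxt : ⁅x, ⁅e, f⁆⁆ = 0) (hte : ⁅⁅e, f⁆, e⁆ = 0)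
    (htf : ⁅⁅e, f⁆, f⁆ = 0) : killingForm K A e f = 0 := by
  have comm_of : ∀ u v : A, ⁅u, v⁆ = 0 → Commute (LieAlgebra.ad K A u) (LieAlgebra.ad K A v) := by
    intro u v huv
    have : ⁅LieAlgebra.ad K A u, LieAlgebra.ad K A v⁆ = 0 := by
      rw [← LieHom.map_lie, huv, map_zero]
    rw [LieRing.of_associative_ring_bracket, sub_eq_zero] at this
    exact this
  have hnil : IsNilpotent (LieAlgebra.ad K A ⁅e, f⁆) := by
    refine isNilpotent_of_forall_eigenvalue fun d hd => ?_
    refine eq_zero_of_trace_restrict (E := LieAlgebra.ad K A e) (F := LieAlgebra.ad K A f)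
      ?_ (comm_of _ _ hte) (comm_of _ _ htf) hd
    rw [LieHom.map_lie, LieRing.of_associative_ring_bracket]
  have h1 : killingForm K A x ⁅e, f⁆ = 0 := by
    rw [killingForm_apply_apply]
    exact (LinearMap.isNilpotent_trace_of_isNilpotent
      ((comm_of x _ hxt).isNilpotent_mul_left hnil)).eq_zero
  have h2 : killingForm K A ⁅x, e⁆ f = killingForm K A x ⁅e, f⁆ :=
    LieModule.traceForm_apply_lie_apply K A A x e f
  rw [h1, hx, map_smul, LinearMap.smul_apply, smul_eq_mul] at h2
  exact (mul_eq_zero.mp h2).resolve_left hc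

/-- In a reductive Lie algebra the radical of the trace form of a module containing the adjoint
module is central. -/
theorem mem_center_of_traceForm_eq_zero [FiniteDimensional K A] [CharZero K] [LieAlgebra.HasCentralRadical K A]
    {V : Type*} [AddCommGroup V] [Module K V] [LieRingModule A V] [LieModule K A V]
    [FiniteDimensional K V] (j : A →ₗ⁅K,A⁆ V) (hj : Function.Injective j) {e : A}
    (he : ∀ u, LieModule.traceForm K A V e u = 0) : e ∈ LieAlgebra.center K A := by
  let I : LieIdeal K A :=
    { carrier := {y | ∀ u, LieModule.traceForm K A V y u = 0}
      add_mem' := fun {a b} ha hb u => by rw [map_add, LinearMap.add_apply, ha, hb, add_zero]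
      zero_mem' := fun u => by simp
      smul_mem' := fun c a ha u => by rw [map_smul, LinearMap.smul_apply, ha, smul_zero]
      lie_mem := fun {x a} ha u => by
        rw [← lie_skew, map_neg, LinearMap.neg_apply, LieModule.traceForm_apply_lie_apply, ha,
          neg_zero] }
  have htf : LieModule.traceForm K I V = 0 := by
    ext ⟨x, hx⟩ ⟨y, hy⟩
    exact hx y
  -- The derived algebra of `I` acts nilpotently on `V`, hence through `j` on itself. By Engel it is
  -- nilpotent, so `I` is solvable and lies in the radical, which is the center.
  have hnil : LieModule.IsNilpotent (LieAlgebra.derivedSeries K I 1) V :=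
    LieModule.isNilpotent_derivedSeries_of_traceForm_eq_zero htf
  have hnil' : LieRing.IsNilpotent (LieAlgebra.derivedSeries K I 1) := by
    rw [LieAlgebra.isNilpotent_iff_forall (R := K)]
    intro x
    obtain ⟨k, hk⟩ := (LieModule.isNilpotent_iff_forall' (R := K)).mp hnil x
    refine ⟨k, ?_⟩
    have aux : ∀ (n : ℕ) (y : LieAlgebra.derivedSeries K I 1),
        j (((LieAlgebra.ad K _ x ^ n) y : LieAlgebra.derivedSeries K I 1) : I) =
        ((LieModule.toEnd K (LieAlgebra.derivedSeries K I 1) V x) ^ n) (j ((y : I) : A)) := by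
      intro n
      induction n with
      | zero => intro y; simp
      | succ n ih =>
        intro y
        rw [pow_succ, pow_succ, Module.End.mul_apply, Module.End.mul_apply, ih]
        congr 1
        exact LieModuleHom.map_lie j ((x : I) : A) ((y : I) : A)
    ext y
    apply hj
    rw [aux k y, hk]
    simp
  have hsol : LieAlgebra.IsSolvable I := by
    obtain ⟨k, hk⟩ := LieAlgebra.IsSolvable.solvable K (LieAlgebra.derivedSeries K I 1)
    rw [LieIdeal.derivedSeries_eq_bot_iff] at hk
    refine LieAlgebra.IsSolvable.mk (R := K) (k := k + 1) ?_
    rw [LieAlgebra.derivedSeries_def, LieAlgebra.derivedSeriesOfIdeal_add]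
    exact hk
  have hle : I ≤ LieAlgebra.radical K A := (LieAlgebra.LieIdeal.solvable_iff_le_radical K A I).mp hsol
  rw [LieAlgebra.HasCentralRadical.radical_eq_center] at hle
  exact hle he

end TraceForms

/-! ### Root vectors and `sl₂`-triples. -/

section Roots

variable {K : Type*} [Field K] {g : Type*} [LieRing g] [LieAlgebra K g] {h : LieSubalgebra K g}

theorem IsSplittingMaximalToral.mem_iff (hh : IsSplittingMaximalToral h) {x : g} :
    x ∈ weightSpace h g 0 ↔ x ∈ h := by
  rw [hh.2.2]; exact Iff.rfl

theorem IsSplittingMaximalToral.lie_eq_zero (hh : IsSplittingMaximalToral h) {x y : g}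
    (hx : x ∈ h) (hy : y ∈ h) : ⁅x, y⁆ = 0 := by
  have := (hh.mem_iff.mpr hy) ⟨x, hx⟩
  simpa using this

/-- An exhaustion of `g` by finite-dimensional reductive subalgebras. -/
theorem IsSplittingMaximalToral.exists_exhaustion (hh : IsSplittingMaximalToral h) :
    ∃ G : ℕ → LieSubalgebra K g, Monotone G ∧ (∀ n, FiniteDimensional K (G n)) ∧
      (∀ n, LieAlgebra.HasCentralRadical K (G n)) ∧ ∀ S : Set g, S.Finite → ∃ n, S ⊆ G n := by
  obtain ⟨G, hmono, hred, hex, -⟩ := hh.1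
  refine ⟨G, hmono, fun n => (hred n).1, fun n => (hred n).2, fun S hS => ?_⟩
  induction S, hS using Set.Finite.induction_on with
  | empty => exact ⟨0, Set.empty_subset _⟩
  | @insert a s _ _ ih =>
    obtain ⟨n, hn⟩ := ih
    obtain ⟨m, hm⟩ := hex a
    refine ⟨max n m, Set.insert_subset ?_ ?_⟩
    · exact hmono (le_max_right n m) hm
    · exact hn.trans fun x hx => hmono (le_max_left n m) hx

theorem IsSplittingMaximalToral.exists_finiteDimensional (hh : IsSplittingMaximalToral h)
    (S : Set g) (hS : S.Finite) : ∃ A : LieSubalgebra K g, FiniteDimensional K A ∧ S ⊆ A := by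
  obtain ⟨G, -, hfd, -, hex⟩ := hh.exists_exhaustion
  obtain ⟨n, hn⟩ := hex S hS
  exact ⟨G n, hfd n, hn⟩

theorem lie_lie_eq_smul (hh : IsSplittingMaximalToral h) {α : Dual K h} {e f : g}
    (he : e ∈ weightSpace h g α) (hf : f ∈ weightSpace h g (-α)) : ⁅e, f⁆ ∈ h := by
  rw [← hh.mem_iff, ← add_neg_cancel α]
  exact lie_mem_weightSpace_add he hf

/-- `(e, f, t)` is an `sl₂`-triple in `g` with `e` a root vector for `α` and `t ∈ h`. -/
structure IsRootTriple (h : LieSubalgebra K g) (α : Dual K h) (e f : g) (t : h) : Prop where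
  e_mem : e ∈ weightSpace h g α
  f_mem : f ∈ weightSpace h g (-α)
  lie_e_f : ⁅e, f⁆ = t
  apply_eq : α t = 2

theorem pow_ad_mem_weightSpace {α β : Dual K h} {e v : g} (he : e ∈ weightSpace h g α)
    (hv : v ∈ weightSpace h g β) (n : ℕ) :
    (LieAlgebra.ad K g e ^ n) v ∈ weightSpace h g (n • α + β) := by
  induction n with
  | zero => simpa using hv
  | succ n ih =>
    rw [pow_succ', Module.End.mul_apply, LieAlgebra.ad_apply, succ_nsmul', add_assoc]
    exact lie_mem_weightSpace_add he ih

section CharZero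

variable [CharZero K]

/-- Root vectors have opposite root vectors. -/
theorem exists_lie_lie_ne_zero [IsAlgClosed K] (hh : IsSplittingMaximalToral h) {α : Dual K h}
    (hα : α ≠ 0) {e : g} (he : e ∈ weightSpace h g α) (he0 : e ≠ 0) :
    ∃ f, ∃ hf : f ∈ weightSpace h g (-α), α ⟨⁅e, f⁆, lie_lie_eq_smul hh he hf⟩ ≠ 0 := by
  by_contra! hcon
  obtain ⟨G, hmono, hfd, hred, hex⟩ := hh.exists_exhaustion
  obtain ⟨x, hx⟩ : ∃ x, α x ≠ 0 := by
    by_contra! hz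
    exact hα (LinearMap.ext hz)
  -- `G m` need not be `h`-stable, so the weight components of `u` are only available for large `m`.
  -- The component of weight `-α` is orthogonal to `e` by the nilpotency argument, since `[e, f]`
  -- would commute with `e` and `f`; the others are orthogonal to `e` by invariance.
  have step : ∀ u : g, ∃ k, ∀ m ≥ k, ∀ (hem : e ∈ G m) (hum : u ∈ G m),
      killingForm K (G m) ⟨e, hem⟩ ⟨u, hum⟩ = 0 := by
    intro u
    obtain ⟨S, w, hw, -, -, rfl⟩ := exists_sum_of_mem hh.2.1 ⊤ (by simp)
      (Submodule.mem_top (x := u))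
    have hweight : ∀ γ, ∃ k, w γ ∈ G k ∧ ∀ m ≥ k, ∀ (hem : e ∈ G m) (hum : w γ ∈ G m),
        killingForm K (G m) ⟨e, hem⟩ ⟨w γ, hum⟩ = 0 := by
      intro γ
      by_cases hγ : γ = -α
      · subst hγ
        obtain ⟨k, hk⟩ := hex {w (-α), (x : g)} (by simp)
        rw [Set.insert_subset_iff, Set.singleton_subset_iff] at hk
        refine ⟨k, hk.1, fun m hm hem hum => ?_⟩
        have hxm : (x : g) ∈ G m := hmono hm hk.2
        have ht := hcon (w (-α)) (hw _)
        have hth := lie_lie_eq_smul hh he (hw (-α))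
        refine killingForm_eq_zero_of_lie_lie_eq_zero (x := ⟨x, hxm⟩) (c := α x) ?_ hx ?_ ?_ ?_
        · exact Subtype.ext (he x)
        · exact Subtype.ext (hh.lie_eq_zero x.2 hth)
        · refine Subtype.ext ((he ⟨_, hth⟩).trans ?_)
          rw [ht, zero_smul]; rfl
        · refine Subtype.ext ((hw (-α) ⟨_, hth⟩).trans ?_)
          rw [LinearMap.neg_apply, ht, neg_zero, zero_smul]; rfl
      · obtain ⟨y, hy⟩ : ∃ y, (α + γ) y ≠ 0 := by
          by_contra! hz
          have : α + γ = 0 := LinearMap.ext hz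
          exact hγ (eq_neg_of_add_eq_zero_right this)
        obtain ⟨k, hk⟩ := hex {w γ, (y : g)} (by simp)
        rw [Set.insert_subset_iff, Set.singleton_subset_iff] at hk
        refine ⟨k, hk.1, fun m hm hem hum => ?_⟩
        refine killingForm_eq_zero_of_lie_eq_smul (y := ⟨y, hmono hm hk.2⟩) (a := α y) (b := γ y)
          ?_ ?_ hy
        · exact Subtype.ext (he y)
        · exact Subtype.ext (hw γ y)
    choose k hkmem hk using hweight
    refine ⟨S.sup k, fun m hm hem hum => ?_⟩
    have hmem : ∀ γ ∈ S, w γ ∈ G m := fun γ hγ =>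
      hmono ((Finset.le_sup hγ).trans hm) (hkmem γ)
    have hsum : (⟨∑ γ ∈ S, w γ, hum⟩ : G m) =
        ∑ γ ∈ S.attach, ⟨w γ, hmem γ γ.2⟩ := by
      apply Subtype.ext
      rw [AddSubmonoidClass.coe_finsetSum]
      exact (Finset.sum_attach S w).symm
    rw [hsum, map_sum]
    exact Finset.sum_eq_zero fun γ _ => hk γ m ((Finset.le_sup γ.2).trans hm) hem _
  obtain ⟨n, hn⟩ := hex {e, (x : g)} (by simp)
  rw [Set.insert_subset_iff, Set.singleton_subset_iff] at hn
  choose k hk using step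
  -- One `m` serves a whole basis of `G n`. The trace form of the `G n`-module `G m` is the
  -- restricted Killing form of `G m`, so `e` lies in its radical and is central in `G n`, against
  -- `[x, e] = α(x) e ≠ 0`.
  let B := Module.finBasis K (G n)
  let m := max n (Finset.univ.sup fun i => k (B i))
  have hnm : G n ≤ G m := hmono (le_max_left _ _)
  let _ : LieRingModule (G n) (G m) :=
    LieRingModule.compLieHom (G m) (LieSubalgebra.inclusion hnm)
  have : LieModule K (G n) (G m) := LieModule.compLieHom (G m) (LieSubalgebra.inclusion hnm)
  let j : G n →ₗ⁅K, G n⁆ G m :=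
    { (LieSubalgebra.inclusion hnm : G n →ₗ[K] G m) with map_lie' := fun {x y} => rfl }
  have hj : Function.Injective j := fun a b hab => Subtype.ext (congrArg (fun z : G m => (z : g)) hab)
  have hzero : ∀ u, LieModule.traceForm K (G n) (G m) ⟨e, hn.1⟩ u = 0 := by
    have : LieModule.traceForm K (G n) (G m) ⟨e, hn.1⟩ = 0 := by
      refine B.ext fun i => ?_
      exact hk (B i) m ((Finset.le_sup (f := fun i => k (B i)) (Finset.mem_univ i)).trans
        (le_max_right _ _)) (hnm hn.1) (hnm (B i).2)
    intro u
    rw [this]; rfl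
  have hcen := mem_center_of_traceForm_eq_zero j hj hzero
  have h1 : ⁅(⟨x, hn.2⟩ : G n), (⟨e, hn.1⟩ : G n)⁆ = 0 := hcen _
  have h2 : ⁅(x : g), e⁆ = 0 := congrArg (fun z : G n => (z : g)) h1
  rw [he x] at h2
  exact (smul_eq_zero.mp h2).elim hx he0

theorem exists_isRootTriple [IsAlgClosed K] (hh : IsSplittingMaximalToral h) {α : Dual K h}
    (hα : α ≠ 0) {e : g} (he : e ∈ weightSpace h g α) (he0 : e ≠ 0) :
    ∃ f t, IsRootTriple h α e f t := by
  obtain ⟨f, hf, hne⟩ := exists_lie_lie_ne_zero hh hα he he0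
  set t : h := ⟨⁅e, f⁆, lie_lie_eq_smul hh he hf⟩ with ht
  refine ⟨(2 / α t) • f, (2 / α t) • t, he, Submodule.smul_mem _ _ hf, ?_, ?_⟩
  · rw [lie_smul]; rfl
  · rw [map_smul, smul_eq_mul, div_mul_cancel₀ _ hne]

theorem IsRootTriple.isSl2Triple {α : Dual K h} {e f : g} {t : h} (T : IsRootTriple h α e f t) :
    IsSl2Triple (t : g) e f where
  h_ne_zero := fun h0 => by
    have : t = 0 := Subtype.ext h0
    have h2 := T.apply_eq
    rw [this, map_zero] at h2
    exact two_ne_zero h2.symm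
  lie_e_f := T.lie_e_f
  lie_h_e_nsmul := by rw [T.e_mem t, T.apply_eq, ofNat_smul_eq_nsmul]
  lie_h_f_nsmul := by rw [T.f_mem t, LinearMap.neg_apply, T.apply_eq, neg_smul, ofNat_smul_eq_nsmul]

/-- Primitive vectors have natural weights. -/
theorem IsRootTriple.exists_nat (hh : IsSplittingMaximalToral h) {α : Dual K h} {e f : g} {t : h}
    (T : IsRootTriple h α e f t) {β : Dual K h} {v : g} (hv : v ∈ weightSpace h g β) (hv0 : v ≠ 0)
    (hev : ⁅e, v⁆ = 0) : ∃ n : ℕ, β t = n := by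
  obtain ⟨A, hfd, hA⟩ := hh.exists_finiteDimensional {(t : g), e, f, v} (by simp)
  simp only [Set.insert_subset_iff, Set.singleton_subset_iff, SetLike.mem_coe] at hA
  obtain ⟨htA, heA, hfA, hvA⟩ := hA
  have T' := T.isSl2Triple
  have T'' : IsSl2Triple (⟨t, htA⟩ : A) ⟨e, heA⟩ ⟨f, hfA⟩ :=
    { h_ne_zero := fun h0 => T'.h_ne_zero (congrArg (fun z : A => (z : g)) h0)
      lie_e_f := Subtype.ext T'.lie_e_f
      lie_h_e_nsmul := Subtype.ext T'.lie_h_e_nsmul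
      lie_h_f_nsmul := Subtype.ext T'.lie_h_f_nsmul }
  have P : T''.HasPrimitiveVectorWith (⟨v, hvA⟩ : A) (β t) :=
    { ne_zero := fun h0 => hv0 (congrArg (fun z : A => (z : g)) h0)
      lie_h := Subtype.ext (hv t)
      lie_e := Subtype.ext hev }
  exact P.exists_nat

/-- Root vectors act nilpotently on weight vectors. -/
theorem exists_pow_ad_eq_zero (hh : IsSplittingMaximalToral h) {α β : Dual K h} (hα : α ≠ 0)
    {e v : g} (he : e ∈ weightSpace h g α) (hv : v ∈ weightSpace h g β) :
    ∃ n, (LieAlgebra.ad K g e ^ n) v = 0 := by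
  obtain ⟨A, hfd, hA⟩ := hh.exists_finiteDimensional {e, v} (by simp)
  simp only [Set.insert_subset_iff, Set.singleton_subset_iff, SetLike.mem_coe] at hA
  by_contra! hne
  have hmem : ∀ n, (LieAlgebra.ad K g e ^ n) v ∈ A := by
    intro n
    induction n with
    | zero => exact hA.2
    | succ n ih => rw [pow_succ', Module.End.mul_apply]; exact A.lie_mem hA.1 ih
  have : FiniteDimensional K A.toSubmodule := hfd
  have hfin := finite_setOf_inf_weightSpace_ne_bot (h := h) A.toSubmodule
  have hinj : Function.Injective fun n : ℕ => n • α + β := by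
    intro a b hab
    obtain ⟨x, hx⟩ := DFunLike.ne_iff.mp hα
    have h1 := LinearMap.congr_fun hab x
    simp only [LinearMap.add_apply, LinearMap.smul_apply, nsmul_eq_mul, add_left_inj] at h1
    exact Nat.cast_injective (mul_right_cancel₀ hx h1)
  refine Set.infinite_range_of_injective hinj (hfin.subset ?_)
  rintro _ ⟨n, rfl⟩
  exact (Submodule.ne_bot_iff _).mpr ⟨_, ⟨hmem n, pow_ad_mem_weightSpace he hv n⟩, hne n⟩

/-- Weights are integral on coroots. -/
theorem IsRootTriple.exists_int (hh : IsSplittingMaximalToral h) {α : Dual K h} {e f : g} {t : h}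
    (T : IsRootTriple h α e f t) {β : Dual K h} {v : g} (hv : v ∈ weightSpace h g β)
    (hv0 : v ≠ 0) : ∃ n : ℤ, β t = n := by
  have hα : α ≠ 0 := by
    rintro rfl
    have := T.apply_eq
    simp at this
  -- The last nonzero vector in the sequence `(ad e)^n v` is primitive of weight `n α + β`, so `2 n
  -- + β(t)` is a natural number.
  obtain ⟨n, hn, hn'⟩ := Nat.exists_not_and_succ_of_not_zero_of_exists (by simpa using hv0)
    (exists_pow_ad_eq_zero hh hα T.e_mem hv)
  obtain ⟨k, hk⟩ := T.exists_nat hh (pow_ad_mem_weightSpace T.e_mem hv n) hn (by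
    rwa [pow_succ', Module.End.mul_apply] at hn')
  refine ⟨k - 2 * n, ?_⟩
  rw [LinearMap.add_apply, LinearMap.smul_apply, T.apply_eq, nsmul_eq_mul] at hk
  push_cast
  linear_combination hk

/-- Root spaces are one-dimensional. -/
theorem exists_smul_eq_of_mem_rootSpace [IsAlgClosed K] (hh : IsSplittingMaximalToral h)
    {α : Dual K h} (hα : α ≠ 0) {e e' : g} (he : e ∈ weightSpace h g α) (he0 : e ≠ 0)
    (he' : e' ∈ weightSpace h g α) : ∃ c : K, e' = c • e := by
  obtain ⟨f, t, T⟩ := exists_isRootTriple hh hα he he0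
  have hs := lie_lie_eq_smul hh he' T.f_mem
  set s : h := ⟨⁅e', f⁆, hs⟩ with hsdef
  -- The scalar is chosen so that `w = e' - (α s / 2) e` satisfies `[w, f] = r` with `α(r) = 0`.
  refine ⟨α s / 2, ?_⟩
  set w := e' - (α s / 2) • e with hw
  suffices w = 0 from sub_eq_zero.mp this
  by_contra hw0
  have hwmem : w ∈ weightSpace h g α := Submodule.sub_mem _ he' (Submodule.smul_mem _ _ he)
  set r : h := s - (α s / 2) • t with hr
  have hwf : ⁅w, f⁆ = r := by
    rw [hw, sub_lie, smul_lie, T.lie_e_f]; rfl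
  have hαr : α r = 0 := by
    rw [hr, map_sub, map_smul, T.apply_eq, smul_eq_mul]; ring
  have hfw : ⁅f, w⁆ = -(r : g) := by rw [← lie_skew, hwf]
  -- In characteristic zero the coefficient never vanishes, so `(ad e)^(n + 1) w = 0` forces `(ad
  -- e)^n w = 0`. If `w ≠ 0`, this contradicts the local nilpotency of `ad e`.
  have key : ∀ n : ℕ, ⁅f, (LieAlgebra.ad K g e ^ (n + 1)) w⁆ =
      (-((n + 1 : K) * (n + 2))) • (LieAlgebra.ad K g e ^ n) w := by
    intro n
    induction n with
    | zero =>
      have h1 : ⁅e, (r : g)⁆ = 0 := by rw [← lie_skew, he r, hαr, zero_smul, neg_zero]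
      have h2 : ⁅f, e⁆ = -(t : g) := by rw [← lie_skew, T.lie_e_f]
      simp only [zero_add, pow_one, LieAlgebra.ad_apply, pow_zero, Module.End.one_apply,
        Nat.cast_zero, one_mul]
      rw [leibniz_lie, h2, hfw, lie_neg, h1, neg_lie, hwmem t, T.apply_eq]
      simp
    | succ n ih =>
      rw [pow_succ', Module.End.mul_apply, LieAlgebra.ad_apply, leibniz_lie, ih,
        ← lie_skew f e, T.lie_e_f, neg_lie, pow_ad_mem_weightSpace he hwmem (n + 1) t, lie_smul,
        ← LieAlgebra.ad_apply K g e, ← Module.End.mul_apply, ← pow_succ', ← neg_smul,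
        ← add_smul, LinearMap.add_apply, LinearMap.smul_apply, T.apply_eq, nsmul_eq_mul]
      congr 1
      push_cast
      ring
  obtain ⟨n, hn, hn'⟩ := Nat.exists_not_and_succ_of_not_zero_of_exists (by simpa using hw0)
    (exists_pow_ad_eq_zero hh hα he hwmem)
  have h1 := key n
  rw [hn', lie_zero, eq_comm, smul_eq_zero, neg_eq_zero, mul_eq_zero] at h1
  have h2 : ((n : K) + 1) ≠ 0 := Nat.cast_add_one_ne_zero n
  have h3 : ((n : K) + 2) ≠ 0 := by exact_mod_cast (Nat.succ_ne_zero (n + 1))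
  tauto

end CharZero

end Roots

/-! ### Pointed submonoids. -/

section Pointed

variable {V : Type*} [AddCommGroup V]

/-- A submonoid without nonzero invertible elements. -/
def IsPointed (P : AddSubmonoid V) : Prop := ∀ p ∈ P, -p ∈ P → p = 0

theorem IsPointed.eq_zero_of_add_eq_zero {P : AddSubmonoid V} (hP : IsPointed P) {p q : V}
    (hp : p ∈ P) (hq : q ∈ P) (hpq : p + q = 0) : p = 0 :=
  hP p hp (by rw [neg_eq_of_add_eq_zero_right hpq]; exact hq)

/-- The partial order defined by a pointed submonoid. -/
abbrev IsPointed.partialOrder {P : AddSubmonoid V} (hP : IsPointed P) : PartialOrder V where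
  le a b := b - a ∈ P
  le_refl a := by rw [sub_self]; exact P.zero_mem
  le_trans a b c hab hbc := by rw [← sub_add_sub_cancel c b a]; exact P.add_mem hbc hab
  le_antisymm a b hab hba := by
    have := hP _ hab (by rwa [neg_sub])
    exact (sub_eq_zero.mp this).symm

/-- If `p + i β` and `p' + i' β` are opposite, then `-(i + i') β = p + p'` lies in `P`. This forces
`i = i' = 0` and reduces to pointedness of `P`. -/
theorem IsPointed.sup_closure_singleton {P : AddSubmonoid V} (hP : IsPointed P) {β : V}
    (hβ : ∀ n : ℕ, n ≠ 0 → -(n • β) ∉ P) : IsPointed (P ⊔ AddSubmonoid.closure {β}) := by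
  intro q hq hq'
  obtain ⟨p, hp, _, hi, rfl⟩ := AddSubmonoid.mem_sup.mp hq
  obtain ⟨i, rfl⟩ := AddSubmonoid.mem_closure_singleton.mp hi
  obtain ⟨p', hp', _, hi', hsum⟩ := AddSubmonoid.mem_sup.mp hq'
  obtain ⟨i', rfl⟩ := AddSubmonoid.mem_closure_singleton.mp hi'
  have h1 : -((i + i') • β) = p + p' := by
    rw [add_nsmul, neg_eq_iff_add_eq_zero]
    have : p' + i' • β + (p + i • β) = 0 := by rw [hsum, neg_add_cancel]
    rw [← this]; abel
  have h2 : i + i' = 0 := by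
    by_contra hne
    exact hβ _ hne (h1 ▸ P.add_mem hp hp')
  have hi0 : i = 0 := by omega
  have hi0' : i' = 0 := by omega
  subst hi0; subst hi0'
  simp only [zero_nsmul, add_zero] at h1 ⊢
  exact hP.eq_zero_of_add_eq_zero hp hp' (by simpa using h1.symm)

end Pointed

/-! ### Splitting Borel subalgebras and positive roots. -/

section Borel

variable {K : Type*} [Field K] {g : Type*} [LieRing g] [LieAlgebra K g] {h b : LieSubalgebra K g}

/-- The monoid generated by the positive roots. -/
abbrev posCone (h b : LieSubalgebra K g) : AddSubmonoid (Dual K h) :=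
  AddSubmonoid.closure (posRoots h b)

/-- The subalgebra spanned by the weight spaces for an additively closed set of weights. -/
def weightSubalgebra (h : LieSubalgebra K g) (A : Set (Dual K h))
    (hA : ∀ χ ∈ A, ∀ ψ ∈ A, χ + ψ ∈ A) : LieSubalgebra K g where
  __ := weightSum h g A
  lie_mem' hx hy := lie_mem_weightSum_of_forall (fun χ hχ ψ hψ _ hx _ hy =>
    weightSpace_le_weightSum (hA χ hχ ψ hψ) (lie_mem_weightSpace_add hx hy)) hx hy

theorem exists_finset_le_weightSum {M : Type*} [AddCommGroup M] [Module K M]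
    [LieRingModule g M] [LieModule K g M] {A : Set (Dual K h)} (F : Submodule K M)
    [FiniteDimensional K F] (hF : F ≤ weightSum h M A) :
    ∃ S : Finset (Dual K h), (S : Set (Dual K h)) ⊆ A ∧ F ≤ weightSum h M S := by
  classical
  obtain ⟨t, ht⟩ := (Submodule.fg_iff_finiteDimensional F).mpr inferInstance
  have : ∀ v : M, ∃ S : Finset (Dual K h), v ∈ t → (S : Set (Dual K h)) ⊆ A ∧
      v ∈ weightSum h M S := by
    intro v
    by_cases hv : v ∈ t
    · obtain ⟨S, w, hS, hw, -, hsum⟩ := exists_sum_of_mem_weightSum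
        (hF (ht ▸ Submodule.subset_span hv))
      exact ⟨S, fun _ => ⟨hS, hsum ▸ Submodule.sum_mem _ fun χ hχ =>
        weightSpace_le_weightSum (Finset.mem_coe.mpr hχ) (hw χ)⟩⟩
    · exact ⟨∅, fun hh => absurd hh hv⟩
  choose S hS using this
  refine ⟨t.biUnion S, ?_, ?_⟩
  · intro χ hχ
    obtain ⟨v, hv, hχv⟩ := Finset.mem_biUnion.mp (Finset.mem_coe.mp hχ)
    exact (hS v hv).1 hχv
  · rw [← ht, Submodule.span_le]
    intro v hv
    exact weightSum_mono (Finset.coe_subset.mpr (Finset.subset_biUnion_of_mem S hv)) (hS v hv).2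

/-- In a pointed monoid the weight `0` arises only as `0 + 0`, and `g^0 = h` is abelian. -/
theorem lie_mem_weightSum_ne_zero (hh : IsSplittingMaximalToral h) {P : AddSubmonoid (Dual K h)}
    (hP : IsPointed P) {x y : g} (hx : x ∈ weightSum h g (P : Set (Dual K h)))
    (hy : y ∈ weightSum h g (P : Set (Dual K h))) :
    ⁅x, y⁆ ∈ weightSum h g {χ | χ ∈ P ∧ χ ≠ 0} := by
  refine lie_mem_weightSum_of_forall (fun χ hχ ψ hψ x hx y hy => ?_) hx hy
  by_cases h0 : χ + ψ = 0
  · have hχ0 : χ = 0 := hP.eq_zero_of_add_eq_zero hχ hψ h0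
    subst hχ0
    rw [zero_add] at h0
    subst h0
    rw [hh.lie_eq_zero (hh.mem_iff.mp hx) (hh.mem_iff.mp hy)]
    exact Submodule.zero_mem _
  · exact weightSpace_le_weightSum (show χ + ψ ∈ {χ | χ ∈ P ∧ χ ≠ 0} from ⟨P.add_mem hχ hψ, h0⟩)
      (lie_mem_weightSpace_add hx hy)

theorem derivedSeries_succ_mem {L : Type*} [LieRing L] [LieAlgebra K L] {k : ℕ} {N : Submodule K L}
    (hN : ∀ x ∈ LieAlgebra.derivedSeries K L k, ∀ y ∈ LieAlgebra.derivedSeries K L k, ⁅x, y⁆ ∈ N) :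
    ∀ x ∈ LieAlgebra.derivedSeries K L (k + 1), x ∈ N := by
  intro x hx
  rw [LieAlgebra.derivedSeries_def, LieAlgebra.derivedSeriesOfIdeal_succ,
    ← LieSubmodule.mem_toSubmodule, LieSubmodule.lieIdeal_oper_eq_linear_span'] at hx
  refine Submodule.span_le.mpr ?_ hx
  rintro _ ⟨a, ha, c, hc, rfl⟩
  exact hN a ha c hc

/-- A finite-dimensional subalgebra involves finitely many weights. Once `0` is gone, a minimal
weight of the set is not a sum of two of its members, so each further derived term loses a weight.
-/
theorem isLocallySolvable_weightSubalgebra (hh : IsSplittingMaximalToral h)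
    {P : AddSubmonoid (Dual K h)} (hP : IsPointed P) :
    IsLocallySolvable (weightSubalgebra h (P : Set (Dual K h)) fun _ h1 _ h2 => P.add_mem h1 h2) := by
  classical
  intro s hs hfd
  have : FiniteDimensional K s.toSubmodule := hfd
  obtain ⟨Γ₀, hΓ₀, hsΓ₀⟩ := exists_finset_le_weightSum s.toSubmodule (A := (P : Set (Dual K h))) hs
  let _ := hP.partialOrder
  have main : ∀ (n : ℕ) (Γ : Finset (Dual K h)), Γ.card = n → (∀ χ ∈ Γ, χ ∈ P ∧ χ ≠ 0) →
      ∀ k, (∀ x ∈ LieAlgebra.derivedSeries K s k, (x : g) ∈ weightSum h g (Γ : Set (Dual K h))) →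
      ∃ k, LieAlgebra.derivedSeries K s k = ⊥ := by
    intro n
    induction n using Nat.strong_induction_on with
    | _ n ih =>
      intro Γ hcard hΓ k hk
      rcases Γ.eq_empty_or_nonempty with rfl | hne
      · refine ⟨k, (LieSubmodule.eq_bot_iff _).mpr fun x hx => Subtype.ext ?_⟩
        simpa [weightSum] using hk x hx
      · obtain ⟨γ, hγ⟩ := Γ.exists_minimal hne
        set Γ' := Γ.filter fun χ => ∃ a ∈ Γ, ∃ c ∈ Γ, a + c = χ with hΓ'
        have hlt : Γ' ⊂ Γ := by
          refine Finset.filter_ssubset.mpr ⟨γ, hγ.1, ?_⟩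
          rintro ⟨a, ha, c, hc, hac⟩
          have hle : a ≤ γ := by
            change γ - a ∈ P
            rw [← hac, add_sub_cancel_left]
            exact (hΓ c hc).1
          have := le_antisymm hle (hγ.2 ha hle)
          rw [this] at hac
          exact (hΓ c hc).2 (by simpa using hac)
        refine ih Γ'.card (hcard ▸ Finset.card_lt_card hlt) Γ' rfl
          (fun χ hχ => hΓ χ (hlt.1 hχ)) (k + 1) fun x hx => ?_
        have h1 : (x : g) ∈ weightSum h g (Γ : Set (Dual K h)) :=
          hk x (LieAlgebra.derivedSeriesOfIdeal_antitone _ (Nat.le_succ k) hx)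
        have h2 : (x : g) ∈ weightSum h g {χ | ∃ a ∈ Γ, ∃ c ∈ Γ, a + c = χ} := by
          refine derivedSeries_succ_mem
            (N := (weightSum h g {χ | ∃ a ∈ Γ, ∃ c ∈ Γ, a + c = χ}).comap s.toSubmodule.subtype)
            (fun x hx y hy => ?_) x hx
          exact lie_mem_weightSum_of_forall (fun χ hχ ψ hψ x hx y hy =>
            weightSpace_le_weightSum (show χ + ψ ∈ {χ | ∃ a ∈ Γ, ∃ c ∈ Γ, a + c = χ} from
              ⟨χ, hχ, ψ, hψ, rfl⟩) (lie_mem_weightSpace_add hx hy)) (hk x hx) (hk y hy)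
        have h3 := mem_weightSum_inter h1 h2
        rwa [hΓ', Finset.coe_filter]
  -- The induction starts at the first derived term, where the weight `0` no longer occurs.
  obtain ⟨k, hk⟩ := main _ (Γ₀.filter (· ≠ 0)) rfl
    (fun χ hχ => ⟨hΓ₀ (Finset.mem_of_mem_filter χ hχ), (Finset.mem_filter.mp hχ).2⟩) 1
    fun x hx => by
      have h1 : (x : g) ∈ weightSum h g (Γ₀ : Set (Dual K h)) := hsΓ₀ x.2
      have h2 : (x : g) ∈ weightSum h g {χ | χ ∈ P ∧ χ ≠ 0} := by
        refine derivedSeries_succ_mem (k := 0)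
          (N := (weightSum h g {χ | χ ∈ P ∧ χ ≠ 0}).comap s.toSubmodule.subtype)
          (fun x _ y _ => ?_) x hx
        exact lie_mem_weightSum_ne_zero hh hP (hs x.2) (hs y.2)
      refine weightSum_mono ?_ (mem_weightSum_inter h1 h2)
      rintro χ ⟨h3, h4⟩
      exact Finset.mem_coe.mpr (Finset.mem_filter.mpr ⟨h3, h4.2⟩)
  exact LieAlgebra.IsSolvable.mk hk

/-- Each of `e`, `f`, `t` is a multiple of a bracket of members of the triple, so all three survive
in every derived term. -/
theorem IsSl2Triple.not_isSolvable [CharZero K] {L : Type*} [LieRing L] [LieAlgebra K L] {t e f : L}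
    (T : IsSl2Triple t e f) {s : LieSubalgebra K L} (he : e ∈ s) (hf : f ∈ s) :
    ¬ LieAlgebra.IsSolvable s := by
  intro hsol
  obtain ⟨k, hk⟩ := LieAlgebra.IsSolvable.solvable K s
  have ht : t ∈ s := T.lie_e_f ▸ s.lie_mem he hf
  have key : ∀ k, (⟨e, he⟩ : s) ∈ LieAlgebra.derivedSeries K s k ∧
      (⟨f, hf⟩ : s) ∈ LieAlgebra.derivedSeries K s k ∧
      (⟨t, ht⟩ : s) ∈ LieAlgebra.derivedSeries K s k := by
    intro k
    induction k with
    | zero => simp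
    | succ k ih =>
      obtain ⟨h1, h2, h3⟩ := ih
      simp only [LieAlgebra.derivedSeries_def, LieAlgebra.derivedSeriesOfIdeal_succ] at h1 h2 h3 ⊢
      refine ⟨?_, ?_, ?_⟩
      · have : (⟨e, he⟩ : s) = (2 : K)⁻¹ • ⁅(⟨t, ht⟩ : s), (⟨e, he⟩ : s)⁆ := by
          apply Subtype.ext
          change e = (2 : K)⁻¹ • ⁅t, e⁆
          rw [T.lie_h_e_smul K, smul_smul, inv_mul_cancel₀ two_ne_zero, one_smul]
        rw [this]
        exact SMulMemClass.smul_mem _ (LieSubmodule.lie_mem_lie h3 h1)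
      · have : (⟨f, hf⟩ : s) = -(2 : K)⁻¹ • ⁅(⟨t, ht⟩ : s), (⟨f, hf⟩ : s)⁆ := by
          apply Subtype.ext
          change f = -(2 : K)⁻¹ • ⁅t, f⁆
          rw [T.lie_lie_smul_f K, smul_neg, neg_smul, neg_neg, smul_smul,
            inv_mul_cancel₀ two_ne_zero, one_smul]
        rw [this]
        exact SMulMemClass.smul_mem _ (LieSubmodule.lie_mem_lie h3 h2)
      · have : (⟨t, ht⟩ : s) = ⁅(⟨e, he⟩ : s), (⟨f, hf⟩ : s)⁆ := Subtype.ext T.lie_e_f.symm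
        rw [this]
        exact LieSubmodule.lie_mem_lie h1 h2
  have := (key k).2.2
  rw [hk, LieSubmodule.mem_bot] at this
  exact T.h_ne_zero (congrArg Subtype.val this)

/-- The set of nonzero elements of the negative cone. -/
def negCone (h b : LieSubalgebra K g) : Set (Dual K h) := {χ | -χ ∈ posCone h b ∧ χ ≠ 0}

theorem add_mem_negCone (hP : IsPointed (posCone h b)) {χ ψ : Dual K h} (hχ : χ ∈ negCone h b)
    (hψ : ψ ∈ negCone h b) : χ + ψ ∈ negCone h b := by
  refine ⟨by rw [neg_add]; exact add_mem hχ.1 hψ.1, fun h0 => hχ.2 ?_⟩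
  have := hP.eq_zero_of_add_eq_zero hχ.1 hψ.1 (by rw [← neg_add, h0, neg_zero])
  exact neg_eq_zero.mp this

/-- Positive root spaces lie in `[b, b]`. -/
theorem weightSpace_le_nilrad (hhb : h ≤ b) {χ : Dual K h} (hχ : χ ≠ 0)
    (hle : weightSpace h g χ ≤ b.toSubmodule) : weightSpace h g χ ≤ nilrad b := by
  intro x hx
  obtain ⟨y, hy⟩ := DFunLike.ne_iff.mp hχ
  have : x = (χ y)⁻¹ • ⁅(y : g), x⁆ := by
    rw [hx y, smul_smul, inv_mul_cancel₀ hy, one_smul]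
  rw [this]
  exact Submodule.smul_mem _ _ (Submodule.subset_span ⟨y, hhb y.2, x, hle hx, rfl⟩)

/-- Extension of a weight to a linear form on `g` that vanishes on all root spaces. -/
theorem exists_extension (hh : IsSplittingMaximalToral h) (ξ : Dual K h) :
    ∃ Ξ : Dual K g, (∀ x : h, Ξ x = ξ x) ∧ ∀ x ∈ weightSum h g {χ | χ ≠ 0}, Ξ x = 0 := by
  have hc : IsCompl h.toSubmodule (weightSum h g {χ | χ ≠ 0}) := by
    rw [← hh.2.2]
    constructor
    · rw [Submodule.disjoint_def]
      intro x hx hx'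
      exact eq_zero_of_mem_weightSum (by simp) hx hx'
    · rw [codisjoint_iff, eq_top_iff, ← hh.2.1]
      refine iSup_le fun χ => ?_
      by_cases hχ : χ = 0
      · rw [hχ]; exact le_sup_left
      · exact le_trans (weightSpace_le_weightSum (show χ ∈ {χ | χ ≠ 0} from hχ)) le_sup_right
  refine ⟨ξ ∘ₗ h.toSubmodule.projectionOnto _ hc, fun x => ?_, fun x hx => ?_⟩
  · rw [LinearMap.comp_apply]
    congr 1
    exact Submodule.projectionOnto_apply_left hc x
  · rw [LinearMap.comp_apply, (Submodule.projectionOnto_apply_eq_zero_iff hc).mpr hx, map_zero]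

variable [CharZero K] [IsAlgClosed K]

/-- Root spaces are lines, so a single nonzero vector in `b` brings the whole root space into `b`.
-/
theorem mem_posRoots_of_mem (hh : IsSplittingMaximalToral h) {α : Dual K h} (hα : α ≠ 0) {x : g}
    (hx : x ∈ weightSpace h g α) (hx0 : x ≠ 0) (hxb : x ∈ b) : α ∈ posRoots h b := by
  refine ⟨hα, (Submodule.ne_bot_iff _).mpr ⟨x, hx, hx0⟩, fun y hy => ?_⟩
  obtain ⟨c, rfl⟩ := exists_smul_eq_of_mem_rootSpace hh hα hx hx0 hy
  exact b.smul_mem c hxb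

theorem le_weightSum_posCone (hh : IsSplittingMaximalToral h) (hhb : h ≤ b) :
    b.toSubmodule ≤ weightSum h g (posCone h b : Set (Dual K h)) := by
  intro x hx
  obtain ⟨S, w, hw, hwb, -, rfl⟩ := exists_sum_of_mem hh.2.1 b.toSubmodule
    (fun x hx v hv => b.lie_mem (hhb hx) hv) hx
  refine Submodule.sum_mem _ fun χ _ => ?_
  by_cases hw0 : w χ = 0
  · rw [hw0]; exact Submodule.zero_mem _
  by_cases hχ : χ = 0
  · exact weightSpace_le_weightSum (by rw [hχ]; exact (posCone h b).zero_mem) (hw χ)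
  · exact weightSpace_le_weightSum
      (AddSubmonoid.subset_closure (mem_posRoots_of_mem hh hχ (hw χ) hw0 (hwb χ))) (hw χ)

/-- Otherwise `b` would contain the span of an `sl₂`-triple, which is not solvable. -/
theorem neg_notMem_posRoots (hh : IsSplittingMaximalToral h) (hb : IsLocallySolvable b)
    {α : Dual K h} (hα : α ∈ posRoots h b) : -α ∉ posRoots h b := by
  intro hα'
  obtain ⟨e, he, he0⟩ := (Submodule.ne_bot_iff _).mp hα.2.1
  obtain ⟨f, t, T⟩ := exists_isRootTriple hh hα.1 he he0
  have T' := T.isSl2Triple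
  have heb : e ∈ b := hα.2.2 he
  have hfb : f ∈ b := hα'.2.2 T.f_mem
  have hle : T'.toLieSubalgebra K ≤ b := by
    intro x hx
    obtain ⟨c₁, c₂, c₃, rfl⟩ := IsSl2Triple.mem_toLieSubalgebra_iff.mp hx
    exact b.add_mem (b.add_mem (b.smul_mem _ heb) (b.smul_mem _ hfb))
      (b.smul_mem _ (b.lie_mem heb hfb))
  have hfd : FiniteDimensional K (T'.toLieSubalgebra K) :=
    FiniteDimensional.span_of_finite K (by simp)
  refine IsSl2Triple.not_isSolvable T' (s := T'.toLieSubalgebra K) ?_ ?_ (hb _ hle hfd)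
  · exact Submodule.subset_span (by simp)
  · exact Submodule.subset_span (by simp)

/-- By induction on the number of roots. If a root vector `e` for `α` does not annihilate the root
space of some other member `β`, then `α + β` is again positive and replaces the pair. If it
annihilates all of them, those vectors are primitive, so the coroot of `α` takes a value `2 + n`
with `n ≥ 0` on the sum. -/
theorem sum_posRoots_ne_zero (hh : IsSplittingMaximalToral h) (hb : IsLocallySolvable b)
    (s : Multiset (Dual K h)) (hs : ∀ β ∈ s, β ∈ posRoots h b) (hs0 : s ≠ 0) : s.sum ≠ 0 := by
  classical
  induction hn : s.card using Nat.strong_induction_on generalizing s with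
  | _ n ih =>
    intro hsum
    obtain ⟨α, hα⟩ := Multiset.exists_mem_of_ne_zero hs0
    obtain ⟨s', rfl⟩ := Multiset.exists_cons_of_mem hα
    rw [Multiset.sum_cons] at hsum
    have hαpos := hs α hα
    obtain ⟨e, he, he0⟩ := (Submodule.ne_bot_iff _).mp hαpos.2.1
    obtain ⟨f, t, T⟩ := exists_isRootTriple hh hαpos.1 he he0
    by_cases hex : ∃ β ∈ s', ∃ v ∈ weightSpace h g β, ⁅e, v⁆ ≠ 0
    · obtain ⟨β, hβ, v, hv, hev⟩ := hex
      have hβpos := hs β (Multiset.mem_cons_of_mem hβ)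
      obtain ⟨s'', rfl⟩ := Multiset.exists_cons_of_mem hβ
      have hne : α + β ≠ 0 := fun h0 =>
        neg_notMem_posRoots hh hb hαpos (by rwa [neg_eq_of_add_eq_zero_right h0])
      have hpos : α + β ∈ posRoots h b :=
        mem_posRoots_of_mem hh hne (lie_mem_weightSpace_add he hv) hev
          (b.lie_mem (hαpos.2.2 he) (hβpos.2.2 hv))
      refine ih (s''.card + 1) (by simp at hn; omega) ((α + β) ::ₘ s'') ?_ (by simp) (by simp) ?_
      · intro γ hγ
        rcases Multiset.mem_cons.mp hγ with rfl | hγ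
        · exact hpos
        · exact hs γ (by simp [hγ])
      · rw [Multiset.sum_cons] at hsum ⊢
        rw [add_assoc]; exact hsum
    · push Not at hex
      have hnat : ∀ s'' ≤ s', ∃ n : ℕ, s''.sum t = n := by
        intro s''
        induction s'' using Multiset.induction_on with
        | empty => exact fun _ => ⟨0, by simp⟩
        | cons β s'' ih' =>
          intro hle
          obtain ⟨n, hn⟩ := ih' ((Multiset.le_cons_self _ _).trans hle)
          have hβ : β ∈ s' := Multiset.mem_of_le hle (Multiset.mem_cons_self _ _)
          obtain ⟨v, hv, hv0⟩ :=
            (Submodule.ne_bot_iff _).mp (hs β (Multiset.mem_cons_of_mem hβ)).2.1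
          obtain ⟨m, hm⟩ := T.exists_nat hh hv hv0 (hex β hβ v hv)
          exact ⟨m + n, by rw [Multiset.sum_cons, LinearMap.add_apply, hm, hn]; push_cast; rfl⟩
      obtain ⟨n, hn⟩ := hnat s' le_rfl
      have h1 := LinearMap.congr_fun hsum t
      rw [LinearMap.add_apply, T.apply_eq, hn, LinearMap.zero_apply] at h1
      have : ((2 + n : ℕ) : K) = 0 := by push_cast; exact h1
      rw [Nat.cast_eq_zero] at this
      omega

theorem isPointed_posCone (hh : IsSplittingMaximalToral h) (hb : IsLocallySolvable b) :
    IsPointed (posCone h b) := by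
  intro p hp hp'
  obtain ⟨s, hs, rfl⟩ := AddSubmonoid.exists_multiset_of_mem_closure hp
  obtain ⟨s', hs', hsum⟩ := AddSubmonoid.exists_multiset_of_mem_closure hp'
  by_contra hne
  refine sum_posRoots_ne_zero hh hb (s + s') ?_ ?_ ?_
  · intro β hβ
    rcases Multiset.mem_add.mp hβ with hβ | hβ
    · exact hs β hβ
    · exact hs' β hβ
  · intro h0
    rw [add_eq_zero] at h0
    exact hne (by rw [h0.1, Multiset.sum_zero])
  · rw [Multiset.sum_add, hsum, add_neg_cancel]

/-- The left side is a locally solvable subalgebra containing `b`, so maximality of `b` applies. -/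
theorem weightSubalgebra_le (hh : IsSplittingMaximalToral h) (hb : Maximal IsLocallySolvable b)
    (hhb : h ≤ b) {P : AddSubmonoid (Dual K h)} (hP : IsPointed P) (hle : posCone h b ≤ P) :
    weightSum h g (P : Set (Dual K h)) ≤ b.toSubmodule :=
  hb.2 (isLocallySolvable_weightSubalgebra hh hP)
    ((le_weightSum_posCone hh hhb).trans (weightSum_mono hle))

theorem toSubmodule_eq_weightSum (hh : IsSplittingMaximalToral h)
    (hb : Maximal IsLocallySolvable b) (hhb : h ≤ b) :
    b.toSubmodule = weightSum h g (posCone h b : Set (Dual K h)) :=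
  le_antisymm (le_weightSum_posCone hh hhb)
    (weightSubalgebra_le hh hb hhb (isPointed_posCone hh hb.1) le_rfl)

/-- Every root is positive or negative. -/
theorem mem_posRoots_or_neg_mem (hh : IsSplittingMaximalToral h)
    (hb : Maximal IsLocallySolvable b) (hhb : h ≤ b) {α : Dual K h} (hα : α ≠ 0)
    (hα' : weightSpace h g α ≠ ⊥) : α ∈ posRoots h b ∨ -α ∈ posRoots h b := by
  have hP := isPointed_posCone hh hb.1
  -- If no negative multiple of `β` lies in the cone, adjoining `β` keeps it pointed, and maximality
  -- of `b` absorbs the root space of `β`.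
  have key : ∀ {β : Dual K h}, β ≠ 0 → weightSpace h g β ≠ ⊥ →
      (∀ n : ℕ, n ≠ 0 → -(n • β) ∉ posCone h b) → β ∈ posRoots h b := by
    intro β hβ hβ' hn
    refine ⟨hβ, hβ', ?_⟩
    refine le_trans (weightSpace_le_weightSum ?_)
      (weightSubalgebra_le hh hb hhb (hP.sup_closure_singleton hn) le_sup_left)
    exact (le_sup_right : _ ≤ posCone h b ⊔ AddSubmonoid.closure {β})
      (AddSubmonoid.subset_closure rfl)
  -- If `k α` and `-n α` were both in the cone with `k, n ≥ 1`, pointedness would give `n k α = 0`.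
  -- So `key` applies to `α` in the first case and to `-α` in the second.
  by_cases hk : ∃ k : ℕ, k ≠ 0 ∧ k • α ∈ posCone h b
  · left
    obtain ⟨k, hk0, hk⟩ := hk
    refine key hα hα' fun n hn hmem => ?_
    have h1 : n • k • α = 0 := by
      refine hP _ (AddSubmonoid.nsmul_mem _ hk n) ?_
      rw [smul_comm, ← neg_nsmul]
      exact AddSubmonoid.nsmul_mem _ hmem k
    obtain ⟨x, hx⟩ := DFunLike.ne_iff.mp hα
    have h2 := LinearMap.congr_fun h1 x
    simp only [LinearMap.smul_apply, nsmul_eq_mul, LinearMap.zero_apply, mul_eq_zero,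
      Nat.cast_eq_zero] at h2
    simp only [LinearMap.zero_apply] at hx
    tauto
  · right
    push Not at hk
    obtain ⟨e, he, he0⟩ := (Submodule.ne_bot_iff _).mp hα'
    obtain ⟨f, t, T⟩ := exists_isRootTriple hh hα he he0
    refine key (neg_ne_zero.mpr hα)
      ((Submodule.ne_bot_iff _).mpr ⟨f, T.f_mem, T.isSl2Triple.f_ne_zero⟩) fun n hn => ?_
    rw [smul_neg, neg_neg]
    exact hk n hn

/-- This is `g = n⁻ ⊕ b`: pointedness makes the sum direct, and the sign dichotomy for roots makes
it everything. -/
theorem isCompl_weightSum_negCone (hh : IsSplittingMaximalToral h)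
    (hb : Maximal IsLocallySolvable b) (hhb : h ≤ b) :
    IsCompl (weightSum h g (negCone h b)) b.toSubmodule := by
  have hP := isPointed_posCone hh hb.1
  rw [toSubmodule_eq_weightSum hh hb hhb]
  constructor
  · rw [Submodule.disjoint_def]
    intro x hx hx'
    have h1 := mem_weightSum_inter hx hx'
    have h2 : negCone h b ∩ (posCone h b : Set (Dual K h)) = ∅ := by
      rw [Set.eq_empty_iff_forall_notMem]
      rintro χ ⟨h3, h4⟩
      exact h3.2 (hP χ h4 h3.1)
    rw [h2] at h1
    simpa [weightSum] using h1
  · rw [codisjoint_iff, eq_top_iff, ← hh.2.1]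
    refine iSup_le fun χ => ?_
    by_cases hχ : weightSpace h g χ = ⊥
    · rw [hχ]; exact bot_le
    by_cases hχ0 : χ = 0
    · refine le_trans ?_ le_sup_right
      exact weightSpace_le_weightSum (by rw [hχ0]; exact (posCone h b).zero_mem)
    rcases mem_posRoots_or_neg_mem hh hb hhb hχ0 hχ with hpos | hneg
    · exact le_trans (weightSpace_le_weightSum (AddSubmonoid.subset_closure hpos)) le_sup_right
    · exact le_trans (weightSpace_le_weightSum
        (show χ ∈ negCone h b from ⟨AddSubmonoid.subset_closure hneg, hχ0⟩)) le_sup_left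

theorem nilrad_le_weightSum (hh : IsSplittingMaximalToral h) (hb : IsLocallySolvable b)
    (hhb : h ≤ b) : nilrad b ≤ weightSum h g {χ | χ ∈ posCone h b ∧ χ ≠ 0} := by
  refine Submodule.span_le.mpr ?_
  rintro _ ⟨x, hx, y, hy, rfl⟩
  exact lie_mem_weightSum_ne_zero hh (isPointed_posCone hh hb) (le_weightSum_posCone hh hhb hx)
    (le_weightSum_posCone hh hhb hy)

end Borel

/-! ### Traces of squares of rational diagonalizable operators. -/

section TraceSquare

variable {K : Type*} [Field K] [CharZero K]

/-- The trace of the square of a diagonalizable endomorphism with rational eigenvalues is a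
nonnegative rational number, which is nonzero unless the endomorphism is zero. -/
theorem exists_trace_mul_self_eq {V : Type*} [AddCommGroup V] [Module K V] [FiniteDimensional K V]
    (T : Module.End K V) (hT : ⨆ c : K, T.eigenspace c = ⊤)
    (hq : ∀ c, T.HasEigenvalue c → ∃ q : ℚ, c = q) :
    ∃ r : ℚ, 0 ≤ r ∧ LinearMap.trace K V (T * T) = r ∧ (r = 0 → T = 0) := by
  classical
  let eigenDecomp := DirectSum.isInternal_submodule_of_iSupIndep_of_iSup_eq_top
    T.eigenspaces_iSupIndep hT
  let I := (ν : K) × Fin (finrank K (T.eigenspace ν))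
  let v : Basis I K V := eigenDecomp.collectedBasis fun μ ↦ finBasis K (T.eigenspace μ)
  have : Fintype I := FiniteDimensional.fintypeBasisIndex v
  have hv (i : I) : T (v i) = i.1 • v i :=
    Module.End.mem_eigenspace_iff.mp (eigenDecomp.collectedBasis_mem _ i)
  have hq' : ∀ i : I, ∃ q : ℚ, i.1 = q := fun i =>
    hq i.1 (Module.End.hasEigenvalue_of_hasEigenvector
      (Module.End.hasEigenvector_iff.mpr ⟨Module.End.mem_eigenspace_iff.mpr (hv i), v.ne_zero i⟩))
  choose q hq using hq'
  refine ⟨∑ i, q i ^ 2, Finset.sum_nonneg fun i _ => sq_nonneg _, ?_, fun h0 => ?_⟩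
  · rw [LinearMap.trace_eq_matrix_trace K v, Matrix.trace]
    push_cast
    refine Finset.sum_congr rfl fun i _ => ?_
    rw [Matrix.diag_apply, LinearMap.toMatrix_apply, Module.End.mul_apply, hv, map_smul, hv,
      ← hq i]
    simp [sq]
  · rw [Finset.sum_eq_zero_iff_of_nonneg fun i _ => sq_nonneg _] at h0
    refine v.ext fun i => ?_
    have h1 : q i = 0 := by simpa using h0 i (Finset.mem_univ i)
    rw [hv, hq i, h1]
    simp

end TraceSquare

/-! ### Simple roots and finiteness of intervals. -/

section Dynkin

variable {K : Type*} [Field K] {g : Type*} [LieRing g] [LieAlgebra K g] {h b : LieSubalgebra K g}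

/-- The generators of `b` lie in the subalgebra spanned by weight spaces with weights in the monoid
of simple roots, so all of `b` does. -/
theorem posCone_eq_closure_simpleRoots (hh : IsSplittingMaximalToral h) (hD : IsDynkin h b) :
    posCone h b = AddSubmonoid.closure (simpleRoots h b) := by
  refine le_antisymm ?_ (AddSubmonoid.closure_mono fun α hα => hα.1)
  set Q := AddSubmonoid.closure (simpleRoots h b) with hQ
  have hle : b ≤ weightSubalgebra h (Q : Set (Dual K h)) fun _ h1 _ h2 => Q.add_mem h1 h2 := by
    have hspan : LieSubalgebra.lieSpan K g
        ((h : Set g) ∪ ⋃ α ∈ simpleRoots h b, (weightSpace h g α : Set g)) = b := hD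
    refine hspan.symm.le.trans (LieSubalgebra.lieSpan_le.mpr (Set.union_subset ?_ ?_))
    · intro x hx
      exact weightSpace_le_weightSum (show (0 : Dual K h) ∈ (Q : Set (Dual K h)) from Q.zero_mem)
        (hh.mem_iff.mpr hx)
    · refine Set.iUnion₂_subset fun α hα x hx => ?_
      exact weightSpace_le_weightSum
        (show α ∈ (Q : Set (Dual K h)) from AddSubmonoid.subset_closure hα) hx
  refine AddSubmonoid.closure_le.mpr fun α hα => ?_
  obtain ⟨e, he, he0⟩ := (Submodule.ne_bot_iff _).mp hα.2.1
  by_contra hαQ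
  exact he0 (eq_zero_of_mem_weightSum hαQ he (hle (hα.2.2 he)))

variable [CharZero K]

/-- `A` need not be `h`-stable, but it is stable under `ad T` and hence contains the
`T`-eigencomponents of its elements. The eigenvalues are values of weights at `T`, hence rational,
and the trace of the square is a sum of rational squares. -/
theorem exists_killingForm_self_eq (hh : IsSplittingMaximalToral h) (A : LieSubalgebra K g)
    [FiniteDimensional K A] (T : A) (hTh : (T : g) ∈ h)
    (hT : ∀ χ : Dual K h, weightSpace h g χ ≠ ⊥ → ∃ q : ℚ, χ ⟨T, hTh⟩ = q) :
    ∃ r : ℚ, 0 ≤ r ∧ killingForm K A T T = r ∧ (r = 0 → LieAlgebra.ad K A T = 0) := by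
  have hdec : ∀ v : A, ∃ (S : Finset K) (w : K → A), (∀ c, ⁅T, w c⁆ = c • w c) ∧
      ∑ c ∈ S, w c = v := by
    intro v
    have htop : (v : g) ∈ ⨆ c : K, (LieAlgebra.ad K g T).eigenspace c := by
      have : (⊤ : Submodule K g) ≤ ⨆ c : K, (LieAlgebra.ad K g T).eigenspace c := by
        rw [← hh.2.1]
        refine iSup_le fun χ => le_iSup_of_le (χ ⟨T, hTh⟩) fun x hx => ?_
        exact Module.End.mem_eigenspace_iff.mpr (hx ⟨T, hTh⟩)
      exact this trivial
    rw [Submodule.mem_iSup_iff_exists_finsupp] at htop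
    obtain ⟨w, hw, hsum⟩ := htop
    have hwA : ∀ c ∈ w.support, w c ∈ A.toSubmodule := by
      refine mem_of_sum_eigenvectors_mem (fun _ : Unit => LieAlgebra.ad K g T) A.toSubmodule
        (fun _ x hx => A.lie_mem T.2 hx) (fun c _ => c) w.support
        (fun a _ c _ hac => congrFun hac ()) w
        (fun c _ _ => Module.End.mem_eigenspace_iff.mp (hw c)) ?_
      rw [show ∑ s ∈ w.support, w s = v from hsum]
      exact v.2
    have hwA' : ∀ c, w c ∈ A := fun c => by
      by_cases hc : c ∈ w.support
      · exact hwA c hc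
      · rw [Finsupp.notMem_support_iff.mp hc]; exact A.zero_mem
    refine ⟨w.support, fun c => ⟨w c, hwA' c⟩, fun c => Subtype.ext ?_, Subtype.ext ?_⟩
    · exact Module.End.mem_eigenspace_iff.mp (hw c)
    · rw [AddSubmonoidClass.coe_finsetSum]; exact hsum
  refine exists_trace_mul_self_eq (LieAlgebra.ad K A T) ?_ ?_
  · rw [eq_top_iff]
    rintro v -
    obtain ⟨S, w, hw, rfl⟩ := hdec v
    exact Submodule.sum_mem _ fun c _ => Submodule.mem_iSup_of_mem c
      (Module.End.mem_eigenspace_iff.mpr (hw c))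
  · intro c hc
    obtain ⟨v, hv, hv0⟩ := (Submodule.ne_bot_iff _).mp hc
    have hTv : ⁅(T : g), (v : g)⁆ = c • (v : g) :=
      congrArg Subtype.val (Module.End.mem_eigenspace_iff.mp hv)
    obtain ⟨S, w, hw, -, hw0, hsum⟩ := exists_sum_of_mem hh.2.1 ⊤ (by simp)
      (Submodule.mem_top (x := (v : g)))
    have h1 : ∑ χ ∈ S, (χ ⟨T, hTh⟩ - c) • w χ = 0 := by
      simp only [sub_smul, Finset.sum_sub_distrib, ← Finset.smul_sum]
      rw [hsum, ← hTv, ← hsum, lie_sum, sub_eq_zero]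
      exact Finset.sum_congr rfl fun χ _ => (hw χ ⟨T, hTh⟩).symm
    have h2 := eq_zero_of_sum_eq_zero (h := h) S _ (fun χ _ => Submodule.smul_mem _ _ (hw χ)) h1
    obtain ⟨χ, hχ, hwχ⟩ : ∃ χ ∈ S, w χ ≠ 0 := by
      by_contra! hz
      exact hv0 (Subtype.ext (by rw [← hsum, Finset.sum_eq_zero hz]; rfl))
    obtain ⟨q, hq⟩ := hT χ ((Submodule.ne_bot_iff _).mpr ⟨_, hw χ, hwχ⟩)
    refine ⟨q, ?_⟩
    rw [← hq]
    exact (sub_eq_zero.mp ((smul_eq_zero.mp (h2 χ hχ)).resolve_right hwχ)).symm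

variable [IsAlgClosed K]

/-- A root `α - β` would make `α = β + (α - β)` or `β = α + (β - α)` a sum of two positive roots. -/
theorem lie_eq_zero_of_simpleRoots (hh : IsSplittingMaximalToral h)
    (hb : Maximal IsLocallySolvable b) (hhb : h ≤ b) {α β : Dual K h} (hα : α ∈ simpleRoots h b)
    (hβ : β ∈ simpleRoots h b) (hne : α ≠ β) {e f : g} (he : e ∈ weightSpace h g α)
    (hf : f ∈ weightSpace h g (-β)) : ⁅e, f⁆ = 0 := by
  by_contra h0
  have hmem := lie_mem_weightSpace_add he hf
  rcases mem_posRoots_or_neg_mem hh hb hhb (α := α + -β)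
    (by rw [← sub_eq_add_neg]; exact sub_ne_zero.mpr hne)
    ((Submodule.ne_bot_iff _).mpr ⟨_, hmem, h0⟩) with hp | hp
  · refine hα.2 ⟨{β, α + -β}, by simp, ?_, by simp⟩
    intro γ hγ
    rcases Multiset.mem_cons.mp hγ with rfl | hγ
    · exact hβ.1
    · rw [Multiset.mem_singleton.mp hγ]; exact hp
  · refine hβ.2 ⟨{α, -(α + -β)}, by simp, ?_, by simp⟩
    intro γ hγ
    rcases Multiset.mem_cons.mp hγ with rfl | hγ
    · exact hα.1
    · rw [Multiset.mem_singleton.mp hγ]; exact hp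

/-- The classical obtuse-angle argument. The sum `x`, written over `s`, is represented in the
Killing form of `A` by a nonnegative combination `Y` of coroots; written over `s'`, it is
nonpositive on these coroots. So `κ(Y, Y) = x(Y) ≤ 0`, whereas `κ(Y, Y)` is a sum of squares. Hence
`ad Y = 0` on `A`, and `x(y) = κ(Y, y) = 0`. -/
theorem sum_eq_zero_of_disjoint (hh : IsSplittingMaximalToral h)
    (hb : Maximal IsLocallySolvable b) (hhb : h ≤ b) {s s' : Multiset (Dual K h)}
    (hs : ∀ α ∈ s, α ∈ simpleRoots h b) (hs' : ∀ α ∈ s', α ∈ simpleRoots h b)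
    (hdisj : ∀ α ∈ s, α ∉ s') (hsum : s.sum = s'.sum) : s.sum = 0 := by
  classical
  refine LinearMap.ext fun y => ?_
  have htriple : ∀ α : Dual K h, ∃ (e f : g) (t : h), α ∈ simpleRoots h b →
      IsRootTriple h α e f t := by
    intro α
    by_cases hα : α ∈ simpleRoots h b
    · obtain ⟨e, he, he0⟩ := (Submodule.ne_bot_iff _).mp hα.1.2.1
      obtain ⟨f, t, T⟩ := exists_isRootTriple hh hα.1.1 he he0
      exact ⟨e, f, t, fun _ => T⟩
    · exact ⟨0, 0, 0, fun hh => absurd hh hα⟩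
  choose e f t T using htriple
  set F := s.toFinset with hF
  have hFs : ∀ α ∈ F, α ∈ simpleRoots h b := fun α hα => hs α (Multiset.mem_toFinset.mp hα)
  have hxsum : s.sum = ∑ α ∈ F, s.count α • α := Finset.sum_multiset_count s
  obtain ⟨A, hfd, hA⟩ := hh.exists_finiteDimensional
    ({(y : g)} ∪ (e '' F ∪ f '' F)) (by
      exact (Set.finite_singleton _).union
        ((F.finite_toSet.image e).union (F.finite_toSet.image f)))
  have hyA : (y : g) ∈ A := hA (Or.inl rfl)
  have heA : ∀ α ∈ F, e α ∈ A := fun α hα => hA (Or.inr (Or.inl ⟨α, hα, rfl⟩))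
  have hfA : ∀ α ∈ F, f α ∈ A := fun α hα => hA (Or.inr (Or.inr ⟨α, hα, rfl⟩))
  have htA : ∀ α ∈ F, (t α : g) ∈ A := fun α hα => by
    rw [← (T α (hFs α hα)).lie_e_f]; exact A.lie_mem (heA α hα) (hfA α hα)
  have hint : ∀ α ∈ F, ∀ χ : Dual K h, weightSpace h g χ ≠ ⊥ → ∃ n : ℤ, χ (t α) = n := by
    intro α hα χ hχ
    obtain ⟨v, hv, hv0⟩ := (Submodule.ne_bot_iff _).mp hχ
    exact (T α (hFs α hα)).exists_int hh hv hv0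
  -- the Killing form of `A` on the coroots
  have hκ : ∀ α ∈ F, ∃ q : ℚ, 0 < q ∧ ∀ (u : A) (hu : (u : g) ∈ h) (hα : (t α : g) ∈ A),
      killingForm K A ⟨t α, hα⟩ u = q * α ⟨u, hu⟩ := by
    intro α hα
    have Tα := T α (hFs α hα)
    set c := killingForm K A ⟨e α, heA α hα⟩ ⟨f α, hfA α hα⟩ with hc
    have hcu : ∀ (u : A) (hu : (u : g) ∈ h),
        killingForm K A ⟨t α, htA α hα⟩ u = c * α ⟨u, hu⟩ := by
      intro u hu
      have h1 : (⟨t α, htA α hα⟩ : A) = ⁅(⟨e α, heA α hα⟩ : A), (⟨f α, hfA α hα⟩ : A)⁆ :=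
        Subtype.ext Tα.lie_e_f.symm
      have h2 : ⁅(⟨f α, hfA α hα⟩ : A), u⁆ = α ⟨u, hu⟩ • (⟨f α, hfA α hα⟩ : A) := by
        rw [← lie_skew]
        apply Subtype.ext
        have := Tα.f_mem ⟨u, hu⟩
        change -⁅(u : g), f α⁆ = α ⟨u, hu⟩ • f α
        rw [show ⁅(u : g), f α⁆ = _ from this, LinearMap.neg_apply, neg_smul, neg_neg]
      rw [h1]
      refine (LieModule.traceForm_apply_lie_apply K A A _ _ u).trans ?_
      rw [h2, map_smul, smul_eq_mul, mul_comm]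
    obtain ⟨r, hr0, hr, hr'⟩ := exists_killingForm_self_eq hh A ⟨t α, htA α hα⟩ (t α).2
      fun χ hχ => by
        obtain ⟨n, hn⟩ := hint α hα χ hχ
        exact ⟨n, by rw [Rat.cast_intCast]; exact hn⟩
    have h2c : (r : K) = c * 2 := by
      rw [← hr, hcu _ (t α).2, ← Tα.apply_eq]
    have hrne : r ≠ 0 := by
      intro h0
      have h1 := LinearMap.congr_fun (hr' h0) ⟨e α, heA α hα⟩
      have h2 : ⁅(t α : g), e α⁆ = 0 := congrArg Subtype.val h1
      rw [Tα.e_mem (t α), Tα.apply_eq] at h2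
      exact (smul_eq_zero.mp h2).elim two_ne_zero Tα.isSl2Triple.e_ne_zero
    -- Since `α(t α) = 2`, the constant `c = κ(e, f)` is half of `κ(t α, t α) = r`.
    refine ⟨r / 2, by have := lt_of_le_of_ne hr0 hrne.symm; positivity, fun u hu _ => ?_⟩
    rw [hcu u hu]
    congr 1
    push_cast
    rw [h2c]
    field_simp
  choose! q hqpos hq using hκ
  -- the coroots take nonpositive values on the sum
  have hneg : ∀ α ∈ F, ∃ n : ℕ, s.sum (t α) = -n := by
    intro α hα
    rw [hsum]
    have : ∀ r ≤ s', ∃ n : ℕ, r.sum (t α) = -n := by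
      intro r
      induction r using Multiset.induction_on with
      | empty => exact fun _ => ⟨0, by simp⟩
      | cons β r ih =>
        intro hle
        obtain ⟨n, hn⟩ := ih ((Multiset.le_cons_self _ _).trans hle)
        have hβ : β ∈ s' := Multiset.mem_of_le hle (Multiset.mem_cons_self _ _)
        have hβs := hs' β hβ
        have hne : α ≠ β := by
          rintro rfl
          exact hdisj α (Multiset.mem_toFinset.mp hα) hβ
        have Tβ := T β hβs
        have Tα := T α (hFs α hα)
        -- The vector `f β` is primitive of weight `-β` for the triple of `α`, so `-β(t α)` is a
        -- natural number.
        obtain ⟨m, hm⟩ := Tα.exists_nat hh Tβ.f_mem Tβ.isSl2Triple.f_ne_zero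
          (lie_eq_zero_of_simpleRoots hh hb hhb (hFs α hα) hβs hne Tα.e_mem Tβ.f_mem)
        rw [LinearMap.neg_apply] at hm
        refine ⟨m + n, ?_⟩
        rw [Multiset.sum_cons, LinearMap.add_apply, hn, ← neg_neg (β (t α)), hm]
        push_cast
        ring
    exact this s' le_rfl
  choose! n hn using hneg
  -- Dividing by `q α` compensates `κ(t α, u) = q α · α(u)`, so that `κ(Y, ·)` is `s.sum` on `h`
  -- within `A`.
  set Y : h := ∑ α ∈ F, (((s.count α : ℚ) / q α : ℚ) : K) • t α with hY
  have hYg : (Y : g) = ∑ α ∈ F, (((s.count α : ℚ) / q α : ℚ) : K) • (t α : g) := by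
    rw [hY, AddSubmonoidClass.coe_finsetSum]
    rfl
  have hYA : (Y : g) ∈ A := by
    rw [hYg]
    exact sum_mem fun α hα => A.smul_mem _ (htA α hα)
  have hκY : ∀ (u : A) (hu : (u : g) ∈ h), killingForm K A ⟨Y, hYA⟩ u = s.sum ⟨u, hu⟩ := by
    intro u hu
    have h1 : (⟨Y, hYA⟩ : A) = ∑ α ∈ F.attach, (((s.count (α : Dual K h) : ℚ) / q α : ℚ) : K) •
        (⟨t α, htA α α.2⟩ : A) := by
      apply Subtype.ext
      refine hYg.trans ?_
      rw [AddSubmonoidClass.coe_finsetSum]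
      exact (Finset.sum_attach F fun α => (((s.count α : ℚ) / q α : ℚ) : K) • (t α : g)).symm
    rw [h1, map_sum, LinearMap.sum_apply, hxsum, LinearMap.sum_apply,
      ← Finset.sum_attach F]
    refine Finset.sum_congr rfl fun α _ => ?_
    rw [map_smul, LinearMap.smul_apply, hq α α.2 u hu, LinearMap.smul_apply, smul_eq_mul,
      nsmul_eq_mul]
    have := (hqpos α α.2).ne'
    have : (q (α : Dual K h) : K) ≠ 0 := by exact_mod_cast this
    push_cast
    field_simp
  obtain ⟨r, hr0, hr, hr'⟩ := exists_killingForm_self_eq hh A ⟨Y, hYA⟩ Y.2 fun χ hχ => by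
    change ∃ q : ℚ, χ Y = q
    choose! m hm using fun α hα => hint α hα χ hχ
    refine ⟨∑ α ∈ F, (s.count α : ℚ) / q α * m α, ?_⟩
    rw [hY, map_sum]
    push_cast
    refine Finset.sum_congr rfl fun α hα => ?_
    rw [map_smul, hm α hα, smul_eq_mul]
  have hxY : s.sum Y = ((-∑ α ∈ F, (s.count α : ℚ) / q α * n α : ℚ) : K) := by
    conv_lhs => rw [hY, map_sum]
    push_cast
    rw [← Finset.sum_neg_distrib]
    refine Finset.sum_congr rfl fun α hα => ?_
    rw [map_smul, hn α hα, smul_eq_mul]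
    ring
  have hrY : (r : K) = ((-∑ α ∈ F, (s.count α : ℚ) / q α * n α : ℚ) : K) := by
    rw [← hr, hκY _ Y.2, ← hxY]
  have hr1 : r = -∑ α ∈ F, (s.count α : ℚ) / q α * n α := by exact_mod_cast hrY
  have hr2 : 0 ≤ ∑ α ∈ F, (s.count α : ℚ) / q α * n α :=
    Finset.sum_nonneg fun α hα => by have := hqpos α hα; positivity
  have hr3 : r = 0 := by linarith
  have had := hr' hr3
  have h1 := hκY ⟨y, hyA⟩ y.2
  rw [killingForm_apply_apply, had, LinearMap.zero_comp, map_zero] at h1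
  exact h1.symm

/-- Decompositions into simple roots are unique. -/
theorem eq_of_sum_simpleRoots_eq (hh : IsSplittingMaximalToral h)
    (hb : Maximal IsLocallySolvable b) (hhb : h ≤ b) {s s' : Multiset (Dual K h)}
    (hs : ∀ α ∈ s, α ∈ simpleRoots h b) (hs' : ∀ α ∈ s', α ∈ simpleRoots h b)
    (hsum : s.sum = s'.sum) : s = s' := by
  classical
  have hsub : ∀ u u' : Multiset (Dual K h), (∀ α ∈ u, α ∈ simpleRoots h b) →
      (∀ α ∈ u', α ∈ simpleRoots h b) → u.sum = u'.sum → u ≤ u' := by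
    intro u u' hu hu' huu
    rw [← tsub_eq_zero_iff_le]
    by_contra hne
    have hu1 : ∀ α ∈ u - u', α ∈ simpleRoots h b := fun α hα =>
      hu α (Multiset.mem_of_le (Multiset.sub_le_self _ _) hα)
    refine sum_posRoots_ne_zero hh hb.1 (u - u') (fun α hα => (hu1 α hα).1) hne ?_
    -- Removing the common part `u ∩ u'` leaves disjoint multisets with equal sums. The common value
    -- is zero, which no nonempty multiset of positive roots allows.
    refine sum_eq_zero_of_disjoint hh hb hhb (s' := u' - u) hu1
      (fun α hα => hu' α (Multiset.mem_of_le (Multiset.sub_le_self _ _) hα)) ?_ ?_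
    · intro α hα hα'
      rw [← Multiset.count_pos, Multiset.count_sub] at hα hα'
      omega
    · have h1 : (u - u').sum + (u ∩ u').sum = u.sum := by
        rw [← Multiset.sum_add, Multiset.sub_add_inter]
      have h2 : (u' - u).sum + (u ∩ u').sum = u'.sum := by
        rw [← Multiset.sum_add, Multiset.inter_comm, Multiset.sub_add_inter]
      rw [← h1, ← h2] at huu
      exact add_right_cancel huu
  exact le_antisymm (hsub s s' hs hs' hsum) (hsub s' s hs' hs hsum.symm)

/-- Intervals for `Prec` are finite. -/
theorem finite_setOf_prec (hh : IsSplittingMaximalToral h) (hb : Maximal IsLocallySolvable b)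
    (hhb : h ≤ b) (hD : IsDynkin h b) (χ ψ : Dual K h) :
    {μ | Prec h b χ μ ∧ Prec h b μ ψ}.Finite := by
  classical
  have hcl := posCone_eq_closure_simpleRoots hh hD
  by_cases hχψ : Prec h b χ ψ
  · have h1 : ψ - χ ∈ AddSubmonoid.closure (simpleRoots h b) := hcl ▸ hχψ
    obtain ⟨s, hs, hsum⟩ := AddSubmonoid.exists_multiset_of_mem_closure h1
    -- By unique decomposition, a point of the interval splits the multiset `s` of `ψ - χ` into two
    -- parts, and there are finitely many submultisets.
    refine (s.powerset.toFinset.image fun p => χ + p.sum).finite_toSet.subset ?_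
    rintro μ ⟨hμ, hμ'⟩
    have h2 : μ - χ ∈ AddSubmonoid.closure (simpleRoots h b) := hcl ▸ hμ
    have h3 : ψ - μ ∈ AddSubmonoid.closure (simpleRoots h b) := hcl ▸ hμ'
    obtain ⟨p, hp, hpsum⟩ := AddSubmonoid.exists_multiset_of_mem_closure h2
    obtain ⟨p', hp', hpsum'⟩ := AddSubmonoid.exists_multiset_of_mem_closure h3
    have : s = p + p' := by
      refine eq_of_sum_simpleRoots_eq hh hb hhb hs (fun α hα => ?_) ?_
      · rcases Multiset.mem_add.mp hα with hα | hα
        · exact hp α hα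
        · exact hp' α hα
      · rw [Multiset.sum_add, hpsum, hpsum', hsum]
        abel
    refine Finset.mem_coe.mpr (Finset.mem_image.mpr ⟨p, ?_, ?_⟩)
    · rw [Multiset.mem_toFinset, Multiset.mem_powerset, this]
      exact Multiset.le_add_right _ _
    · rw [hpsum, add_sub_cancel]
  · convert Set.finite_empty
    rw [Set.eq_empty_iff_forall_notMem]
    rintro μ ⟨h1, h2⟩
    refine hχψ ?_
    have h3 : ψ - χ = (μ - χ) + (ψ - μ) := by abel
    change ψ - χ ∈ posCone h b
    rw [h3]
    exact add_mem h1 h2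

end Dynkin

/-! ### Enveloping algebras. -/

section Enveloping

attribute [local instance 100] LieRing.ofAssociativeRing

variable {K : Type*} [Field K] {L : Type*} [LieRing L] [LieAlgebra K L]

/-- The universal property gives a map from `U(L)` to the subalgebra generated by `L`; followed by
the inclusion it is the identity. -/
theorem adjoin_range_ι :
    Algebra.adjoin K (Set.range (UniversalEnvelopingAlgebra.ι K (L := L))) = ⊤ := by
  set S := Algebra.adjoin K (Set.range (UniversalEnvelopingAlgebra.ι K (L := L))) with hS
  have hmem : ∀ x : L, UniversalEnvelopingAlgebra.ι K x ∈ S := fun x =>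
    Algebra.subset_adjoin ⟨x, rfl⟩
  let F : L →ₗ⁅K⁆ S :=
    { toFun := fun x => ⟨UniversalEnvelopingAlgebra.ι K x, hmem x⟩
      map_add' := fun x y => Subtype.ext (map_add _ x y)
      map_smul' := fun c x => Subtype.ext (map_smul _ c x)
      map_lie' := fun {x y} => Subtype.ext (LieHom.map_lie _ x y) }
  have hid : S.val.comp (UniversalEnvelopingAlgebra.lift K F) = AlgHom.id K _ := by
    refine UniversalEnvelopingAlgebra.hom_ext K (LieHom.ext fun x => ?_)
    change ((UniversalEnvelopingAlgebra.lift K F) (UniversalEnvelopingAlgebra.ι K x) : _) =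
      UniversalEnvelopingAlgebra.ι K x
    rw [UniversalEnvelopingAlgebra.lift_ι_apply]
    rfl
  rw [eq_top_iff]
  rintro u -
  have := congrArg (fun f => f u) hid
  simp only [AlgHom.comp_apply, AlgHom.id_apply] at this
  rw [← this]
  exact (UniversalEnvelopingAlgebra.lift K F u).2

/-- A subspace of `U(L)` that contains `1` and is stable under left multiplication by `L` is the
whole of `U(L)`; more generally for orbits in modules over `U(L)`. -/
theorem smul_mem_of_forall_ι {N : Type*} [AddCommGroup N] [Module K N]
    [Module (UniversalEnvelopingAlgebra K L) N] [IsScalarTower K (UniversalEnvelopingAlgebra K L) N]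
    (W : Submodule K N) (hW : ∀ x : L, ∀ w ∈ W, UniversalEnvelopingAlgebra.ι K x • w ∈ W)
    (u : UniversalEnvelopingAlgebra K L) {w : N} (hw : w ∈ W) : u • w ∈ W := by
  have hu : u ∈ Algebra.adjoin K (Set.range (UniversalEnvelopingAlgebra.ι K (L := L))) := by
    rw [adjoin_range_ι]; trivial
  induction hu using Algebra.adjoin_induction generalizing w with
  | mem u hu => obtain ⟨x, rfl⟩ := hu; exact hW x w hw
  | algebraMap c => rw [algebraMap_smul]; exact W.smul_mem c hw
  | add a c _ _ ha hc => rw [add_smul]; exact W.add_mem (ha hw) (hc hw)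
  | mul a c _ _ ha hc => rw [mul_smul]; exact ha (hc hw)

theorem env_mem_of_forall_ι (W : Submodule K (UniversalEnvelopingAlgebra K L)) (h1 : 1 ∈ W)
    (hW : ∀ x : L, ∀ w ∈ W, UniversalEnvelopingAlgebra.ι K x * w ∈ W)
    (u : UniversalEnvelopingAlgebra K L) : u ∈ W := by
  have := smul_mem_of_forall_ι (L := L) W hW u h1
  simpa using this

instance : Nontrivial (UniversalEnvelopingAlgebra K L) := by
  refine ⟨⟨1, 0, fun h0 => ?_⟩⟩
  have := congrArg (UniversalEnvelopingAlgebra.lift K (0 : L →ₗ⁅K⁆ K)) h0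
  rw [map_one, map_zero] at this
  exact one_ne_zero this

/-! ### Inducing a character of `b` to an action on `U(m)`. -/

section Induced

variable {m b : LieSubalgebra K L} (pm : L →ₗ[K] m) (pb : L →ₗ[K] b)

local notation "U" => UniversalEnvelopingAlgebra K m

/-- The operator by which `y ∈ m` acts on `U(m) × Hom(b, U(m))`. -/
noncomputable def inducedOp (y : m) : Module.End K (U × (b →ₗ[K] U)) where
  -- The map `p.2` plays the role of `x ↦ x · p.1` for `x ∈ b`. Its new value is forced by `x y = y
  -- x + [x, y]`, with `[x, y]` split into its parts in `m` and `b`.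
  toFun p := (UniversalEnvelopingAlgebra.ι K y * p.1,
    { toFun := fun x => UniversalEnvelopingAlgebra.ι K y * p.2 x +
        UniversalEnvelopingAlgebra.ι K (pm ⁅(x : L), (y : L)⁆) * p.1 + p.2 (pb ⁅(x : L), (y : L)⁆)
      map_add' := fun a c => by
        simp only [AddMemClass.coe_add, add_lie, map_add, mul_add, add_mul]; abel
      map_smul' := fun r a => by
        simp only [SetLike.val_smul, smul_lie, map_smul, mul_smul_comm, smul_mul_assoc,
          smul_add, RingHom.id_apply] })
  map_add' p q := by
    refine Prod.ext (mul_add _ _ _) (LinearMap.ext fun x => ?_)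
    simp only [Prod.fst_add, Prod.snd_add, LinearMap.add_apply, mul_add, LinearMap.coe_mk,
      AddHom.coe_mk]
    abel
  map_smul' r p := by
    refine Prod.ext (mul_smul_comm _ _ _) (LinearMap.ext fun x => ?_)
    simp only [Prod.smul_fst, Prod.smul_snd, LinearMap.smul_apply, mul_smul_comm, LinearMap.coe_mk,
      AddHom.coe_mk, smul_add, RingHom.id_apply]

theorem inducedOp_fst (y : m) (p : U × (b →ₗ[K] U)) :
    (inducedOp pm pb y p).1 = UniversalEnvelopingAlgebra.ι K y * p.1 := rfl

theorem inducedOp_snd (y : m) (p : U × (b →ₗ[K] U)) (x : b) :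
    (inducedOp pm pb y p).2 x = UniversalEnvelopingAlgebra.ι K y * p.2 x +
        UniversalEnvelopingAlgebra.ι K (pm ⁅(x : L), (y : L)⁆) * p.1 +
        p.2 (pb ⁅(x : L), (y : L)⁆) := rfl

variable (hsum : ∀ x, (pm x : L) + pb x = x) (hpm : ∀ y : m, pm y = y) (hpb : ∀ y : m, pb y = 0)

/-- `U(m) × Hom(b, U(m))` as an `m`-module. -/
noncomputable def inducedHom : m →ₗ⁅K⁆ Module.End K (U × (b →ₗ[K] U)) where
  toFun := inducedOp pm pb
  map_add' y z := by
    refine LinearMap.ext fun p => Prod.ext ?_ (LinearMap.ext fun x => ?_)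
    · simp only [inducedOp_fst, LinearMap.add_apply, Prod.fst_add, map_add, add_mul]
    · simp only [inducedOp_snd, LinearMap.add_apply, Prod.snd_add, map_add, add_mul,
        AddMemClass.coe_add, lie_add]
      abel
  map_smul' r y := by
    refine LinearMap.ext fun p => Prod.ext ?_ (LinearMap.ext fun x => ?_)
    · simp only [inducedOp_fst, LinearMap.smul_apply, Prod.smul_fst, map_smul, smul_mul_assoc,
        RingHom.id_apply]
    · simp only [inducedOp_snd, LinearMap.smul_apply, Prod.smul_snd, map_smul, smul_mul_assoc,
        SetLike.val_smul, lie_smul, smul_add, RingHom.id_apply]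
  map_lie' {y z} := by
    -- Since `m` is a subalgebra, the `m`-part of `x` contributes only to the `m`-part of `[x, z]`.
    have hdec : ∀ (x : L) (z : m), pm ⁅x, (z : L)⁆ = ⁅pm x, z⁆ + pm ⁅(pb x : L), (z : L)⁆ ∧
        pb ⁅x, (z : L)⁆ = pb ⁅(pb x : L), (z : L)⁆ := by
      intro x z
      have h1 : ⁅x, (z : L)⁆ = ((⁅pm x, z⁆ : m) : L) + ⁅(pb x : L), (z : L)⁆ := by
        conv_lhs => rw [← hsum x, add_lie]
        rfl
      rw [h1, map_add, map_add, hpm, hpb, zero_add]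
      exact ⟨rfl, rfl⟩
    refine LinearMap.ext fun p => Prod.ext ?_ (LinearMap.ext fun x => ?_)
    · simp only [inducedOp_fst, LieHom.map_lie, LieRing.of_associative_ring_bracket,
        LinearMap.sub_apply, Prod.fst_sub, Module.End.mul_apply, sub_mul, mul_assoc]
    · have hjac : ⁅(x : L), ((⁅y, z⁆ : m) : L)⁆ = ⁅⁅(x : L), (y : L)⁆, (z : L)⁆ -
          ⁅⁅(x : L), (z : L)⁆, (y : L)⁆ := by
        rw [LieSubalgebra.coe_bracket, leibniz_lie, ← lie_skew ⁅(x : L), (z : L)⁆, sub_neg_eq_add]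
      simp only [inducedOp_snd, inducedOp_fst, LieHom.map_lie, LieRing.of_associative_ring_bracket,
        LinearMap.sub_apply, Prod.snd_sub, Module.End.mul_apply, hjac, map_sub,
        (hdec ⁅(x : L), (y : L)⁆ z).1, (hdec ⁅(x : L), (y : L)⁆ z).2,
        (hdec ⁅(x : L), (z : L)⁆ y).1, (hdec ⁅(x : L), (z : L)⁆ y).2, map_add]
      noncomm_ring

variable (Ξ : Dual K L)

/-- The orbit map `u ↦ u · (1, Ξ)`. -/
noncomputable def inducedOrbit : U →ₗ[K] U × (b →ₗ[K] U) where
  toFun u := UniversalEnvelopingAlgebra.lift K (inducedHom pm pb hsum hpm hpb) u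
    (1, (Algebra.linearMap K U ∘ₗ Ξ) ∘ₗ b.toSubmodule.subtype)
  map_add' u v := by rw [map_add, LinearMap.add_apply]
  map_smul' r u := by rw [map_smul, LinearMap.smul_apply]; rfl

theorem inducedOrbit_one : inducedOrbit pm pb hsum hpm hpb Ξ 1 =
    (1, (Algebra.linearMap K U ∘ₗ Ξ) ∘ₗ b.toSubmodule.subtype) := by
  change (UniversalEnvelopingAlgebra.lift K (inducedHom pm pb hsum hpm hpb) 1 :
    Module.End K (U × (b →ₗ[K] U))) _ = _
  rw [map_one, Module.End.one_apply]

theorem inducedOrbit_ι_mul (y : m) (u : U) :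
    inducedOrbit pm pb hsum hpm hpb Ξ (UniversalEnvelopingAlgebra.ι K y * u) =
      inducedOp pm pb y (inducedOrbit pm pb hsum hpm hpb Ξ u) := by
  change (UniversalEnvelopingAlgebra.lift K (inducedHom pm pb hsum hpm hpb) _ :
    Module.End K (U × (b →ₗ[K] U))) _ = _
  rw [map_mul, Module.End.mul_apply, UniversalEnvelopingAlgebra.lift_ι_apply]
  rfl

theorem inducedOrbit_fst (u : U) : (inducedOrbit pm pb hsum hpm hpb Ξ u).1 = u := by
  have : u ∈ LinearMap.eqLocus (LinearMap.fst K U (b →ₗ[K] U) ∘ₗ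
      inducedOrbit pm pb hsum hpm hpb Ξ) LinearMap.id := by
    refine env_mem_of_forall_ι _ ?_ (fun y w hw => ?_) u
    · rw [LinearMap.mem_eqLocus, LinearMap.comp_apply, inducedOrbit_one]; rfl
    · rw [LinearMap.mem_eqLocus] at hw ⊢
      rw [LinearMap.comp_apply, inducedOrbit_ι_mul]
      exact congrArg (fun z => UniversalEnvelopingAlgebra.ι K y * z) hw
  exact this

/-- The action of `L` on `U(m)`. -/
noncomputable def inducedAct : L →ₗ[K] Module.End K U where
  toFun x :=
    { toFun := fun u => UniversalEnvelopingAlgebra.ι K (pm x) * u +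
        (inducedOrbit pm pb hsum hpm hpb Ξ u).2 (pb x)
      map_add' := fun u v => by
        rw [map_add, mul_add, Prod.snd_add, LinearMap.add_apply]; abel
      map_smul' := fun r u => by
        rw [map_smul, mul_smul_comm, Prod.smul_snd, LinearMap.smul_apply, ← smul_add]; rfl }
  map_add' x y := by
    refine LinearMap.ext fun u => ?_
    simp only [map_add, add_mul, LinearMap.coe_mk, AddHom.coe_mk, LinearMap.add_apply]
    abel
  map_smul' r x := by
    refine LinearMap.ext fun u => ?_
    simp only [map_smul, smul_mul_assoc, LinearMap.coe_mk, AddHom.coe_mk, LinearMap.smul_apply,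
      RingHom.id_apply, smul_add]

theorem inducedAct_apply (x : L) (u : U) : inducedAct pm pb hsum hpm hpb Ξ x u =
    UniversalEnvelopingAlgebra.ι K (pm x) * u +
      (inducedOrbit pm pb hsum hpm hpb Ξ u).2 (pb x) := rfl

theorem inducedAct_coe (y : m) (u : U) : inducedAct pm pb hsum hpm hpb Ξ y u =
    UniversalEnvelopingAlgebra.ι K y * u := by
  rw [inducedAct_apply, hpm, hpb, map_zero, add_zero]

/-- The relation `x y = y x + [x, y]` is the recursion that determines the action from its values at
`1`; the second component of the orbit map was built to satisfy it. -/
theorem inducedAct_ι_mul (x : L) (y : m) (u : U) :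
    inducedAct pm pb hsum hpm hpb Ξ x (UniversalEnvelopingAlgebra.ι K y * u) =
      UniversalEnvelopingAlgebra.ι K y * inducedAct pm pb hsum hpm hpb Ξ x u +
        inducedAct pm pb hsum hpm hpb Ξ ⁅x, (y : L)⁆ u := by
  have h1 : ⁅x, (y : L)⁆ = ((⁅pm x, y⁆ : m) : L) + ⁅(pb x : L), (y : L)⁆ := by
    conv_lhs => rw [← hsum x, add_lie]
    rfl
  rw [h1, map_add, LinearMap.add_apply, inducedAct_coe, LieHom.map_lie,
    LieRing.of_associative_ring_bracket]
  simp only [inducedAct_apply, inducedOrbit_ι_mul, inducedOp_snd, inducedOrbit_fst]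
  noncomm_ring

theorem inducedAct_one {x : L} (hpm' : pm x = 0) :
    inducedAct pm pb hsum hpm hpb Ξ x 1 = Ξ x • 1 := by
  have h1 : (pb x : L) = x := by
    have := hsum x
    rwa [hpm', ZeroMemClass.coe_zero, zero_add] at this
  rw [inducedAct_apply, hpm', map_zero, zero_mul, zero_add, inducedOrbit_one]
  change algebraMap K U (Ξ (pb x : L)) = _
  rw [h1, Algebra.algebraMap_eq_smul_one]

/-- The defect `D x x'` vanishes at `1`: by the recursion if one argument is in `m`, and because `b`
acts on `1` through the character `Ξ` if both are in `b`. The recursion and the Jacobi identity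
carry the vanishing from `w` to `y w`. -/
theorem inducedAct_lie (hpb' : ∀ x ∈ b, pm x = 0) (hΞ : ∀ x ∈ b, ∀ y ∈ b, Ξ ⁅x, y⁆ = 0) (x x' : L)
    (u : U) : inducedAct pm pb hsum hpm hpb Ξ ⁅x, x'⁆ u =
      inducedAct pm pb hsum hpm hpb Ξ x (inducedAct pm pb hsum hpm hpb Ξ x' u) -
      inducedAct pm pb hsum hpm hpb Ξ x' (inducedAct pm pb hsum hpm hpb Ξ x u) := by
  set ρ := inducedAct pm pb hsum hpm hpb Ξ with hρ
  let D : L → L → (U →ₗ[K] U) := fun x x' => ρ ⁅x, x'⁆ - (ρ x * ρ x' - ρ x' * ρ x)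
  have hm : ∀ (x : L) (y : m) (u : U), ρ ⁅x, (y : L)⁆ u = ρ x (ρ y u) - ρ y (ρ x u) := by
    intro x y u
    rw [hρ, inducedAct_coe, inducedAct_coe, inducedAct_ι_mul, add_sub_cancel_left]
  have hb1 : ∀ x x' : b, ρ ⁅(x : L), (x' : L)⁆ 1 = ρ x (ρ x' 1) - ρ x' (ρ x 1) := by
    intro x x'
    have hmem := b.lie_mem x.2 x'.2
    rw [hρ, inducedAct_one _ _ _ _ _ _ (hpb' _ hmem), hΞ _ x.2 _ x'.2,
      inducedAct_one _ _ _ _ _ _ (hpb' _ x.2), inducedAct_one _ _ _ _ _ _ (hpb' _ x'.2),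
      map_smul, map_smul,
      inducedAct_one _ _ _ _ _ _ (hpb' _ x.2), inducedAct_one _ _ _ _ _ _ (hpb' _ x'.2),
      smul_smul, smul_smul, mul_comm, sub_self, zero_smul]
  have h1 : ∀ x x' : L, ρ ⁅x, x'⁆ 1 = ρ x (ρ x' 1) - ρ x' (ρ x 1) := by
    have hbm : ∀ (x : b) (x' : L), ρ ⁅(x : L), x'⁆ 1 = ρ x (ρ x' 1) - ρ x' (ρ x 1) := by
      intro x x'
      rw [← hsum x']
      simp only [lie_add, map_add, LinearMap.add_apply, hm, hb1]
      abel
    intro x x'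
    rw [← hsum x]
    simp only [add_lie, map_add, LinearMap.add_apply, hbm]
    rw [← lie_skew, map_neg, LinearMap.neg_apply, hm]
    abel
  have hall : u ∈ ⨅ x : L, ⨅ x' : L, LinearMap.ker (D x x') := by
    refine env_mem_of_forall_ι _ ?_ (fun y w hw => ?_) u
    · simp only [Submodule.mem_iInf, LinearMap.mem_ker]
      intro x x'
      simp only [D, LinearMap.sub_apply, Module.End.mul_apply, h1, sub_self]
    · simp only [Submodule.mem_iInf, LinearMap.mem_ker] at hw ⊢
      intro x x'
      have hw' : ∀ x x' : L, ρ ⁅x, x'⁆ w = ρ x (ρ x' w) - ρ x' (ρ x w) := fun x x' =>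
        sub_eq_zero.mp (hw x x')
      simp only [D, LinearMap.sub_apply, Module.End.mul_apply]
      rw [hρ]
      simp only [inducedAct_ι_mul, map_add]
      rw [← hρ, lie_lie x x' (y : L), map_sub, LinearMap.sub_apply, hw' x x', hw' x ⁅x', (y : L)⁆,
        hw' x' ⁅x, (y : L)⁆, mul_sub]
      abel
  simp only [Submodule.mem_iInf, LinearMap.mem_ker] at hall
  exact sub_eq_zero.mp (hall x x')

end Induced

/-- A one-dimensional module of a subalgebra with a complementary subalgebra can be induced: there
is a module with a vector on which the subalgebra acts by the given character. -/
theorem exists_induced_module {m b : LieSubalgebra K L} (hc : IsCompl m.toSubmodule b.toSubmodule)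
    (Ξ : Dual K L) (hΞ : ∀ x ∈ b, ∀ y ∈ b, Ξ ⁅x, y⁆ = 0) :
    ∃ ρ : L →ₗ⁅K⁆ Module.End K (UniversalEnvelopingAlgebra K m),
      ∀ x ∈ b, ρ x 1 = Ξ x • (1 : UniversalEnvelopingAlgebra K m) := by
  set pm : L →ₗ[K] m := m.toSubmodule.projectionOnto _ hc with hpm_def
  set pb : L →ₗ[K] b := b.toSubmodule.projectionOnto _ hc.symm with hpb_def
  have hpm : ∀ y : m, pm y = y := fun y => Submodule.projectionOnto_apply_left hc y
  have hpb : ∀ y : m, pb y = 0 := fun y =>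
    (Submodule.projectionOnto_apply_eq_zero_iff hc.symm).mpr y.2
  have hpb' : ∀ x ∈ b, pm x = 0 := fun x hx =>
    (Submodule.projectionOnto_apply_eq_zero_iff hc).mpr hx
  have hsum : ∀ x, (pm x : L) + pb x = x := by
    intro x
    obtain ⟨a, ha, c, hc', rfl⟩ := Submodule.mem_sup.mp
      (hc.sup_eq_top.symm ▸ Submodule.mem_top : x ∈ m.toSubmodule ⊔ b.toSubmodule)
    have h1 : pb c = ⟨c, hc'⟩ := Submodule.projectionOnto_apply_left hc.symm ⟨c, hc'⟩
    rw [map_add, map_add, hpb' c hc', hpm ⟨a, ha⟩, hpb ⟨a, ha⟩, h1, add_zero, zero_add]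
  refine ⟨{ inducedAct pm pb hsum hpm hpb Ξ with map_lie' := fun {x y} => ?_ }, fun x hx => ?_⟩
  · refine LinearMap.ext fun u => ?_
    rw [LieRing.of_associative_ring_bracket]
    exact inducedAct_lie pm pb hsum hpm hpb Ξ hpb' hΞ x y u
  · exact inducedAct_one pm pb hsum hpm hpb Ξ (hpb' x hx)

end Enveloping

/-! ### Isomorphisms of Lie modules. -/

section LieModules

variable {K : Type*} [Field K] {g : Type*} [LieRing g]

/-- Two quotients of a module with the same kernel are isomorphic. -/
theorem nonempty_equiv_of_ker_eq {A B C : Type*} [AddCommGroup A] [Module K A] [LieRingModule g A]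
    [AddCommGroup B] [Module K B] [LieRingModule g B]
    [AddCommGroup C] [Module K C] [LieRingModule g C]
    (f : A →ₗ⁅K,g⁆ B) (f' : A →ₗ⁅K,g⁆ C) (hf : Function.Surjective f)
    (hf' : Function.Surjective f') (hker : ∀ a, f a = 0 ↔ f' a = 0) : Nonempty (B ≃ₗ⁅K,g⁆ C) := by
  have hk : LinearMap.ker (f : A →ₗ[K] B) = LinearMap.ker (f' : A →ₗ[K] C) := by
    ext a; exact hker a
  let e₁ := LinearMap.quotKerEquivOfSurjective (f : A →ₗ[K] B) hf
  let e₂ := LinearMap.quotKerEquivOfSurjective (f' : A →ₗ[K] C) hf'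
  let e : B ≃ₗ[K] C := e₁.symm ≪≫ₗ Submodule.quotEquivOfEq _ _ hk ≪≫ₗ e₂
  have he : ∀ a, e (f a) = f' a := by
    intro a
    have h1 : e₁.symm (f a) = Submodule.Quotient.mk a := by
      rw [LinearEquiv.symm_apply_eq]; rfl
    change e₂ (Submodule.quotEquivOfEq _ _ hk (e₁.symm (f a))) = f' a
    rw [h1]; rfl
  refine ⟨{ e with map_lie' := fun {x y} => ?_ }⟩
  obtain ⟨a, rfl⟩ := hf y
  change e ⁅x, f a⁆ = ⁅x, e (f a)⁆
  rw [← LieModuleHom.map_lie, he, he, LieModuleHom.map_lie]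

theorem isIrreducible_of_equiv {A B : Type*} [AddCommGroup A] [Module K A] [LieRingModule g A]
    [AddCommGroup B] [Module K B] [LieRingModule g B]
    (e : A ≃ₗ⁅K,g⁆ B) (hB : LieModule.IsIrreducible K g B) : LieModule.IsIrreducible K g A := by
  have hnt : Nontrivial A := by
    obtain ⟨N, N', hne⟩ := hB.toNontrivial
    by_contra hA
    rw [not_nontrivial_iff_subsingleton] at hA
    have : Subsingleton B := e.symm.toEquiv.injective.subsingleton
    exact hne (Subsingleton.elim _ _)
  refine LieModule.IsIrreducible.mk fun N hN => ?_
  rcases hB.eq_bot_or_eq_top (N.map (e : A →ₗ⁅K,g⁆ B)) with h0 | h1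
  · refine absurd ?_ hN
    rw [LieSubmodule.eq_bot_iff] at h0 ⊢
    intro a ha
    have := h0 (e a) (LieSubmodule.mem_map_of_mem ha)
    exact e.toEquiv.injective (this.trans (map_zero (e : A →ₗ⁅K,g⁆ B)).symm)
  · rw [eq_top_iff]
    intro a _
    have : e a ∈ N.map (e : A →ₗ⁅K,g⁆ B) := by rw [h1]; trivial
    obtain ⟨a', ha', hea⟩ := (LieSubmodule.mem_map _).mp this
    rwa [← e.toEquiv.injective hea]

variable [LieAlgebra K g] {h b : LieSubalgebra K g} {M : Type*} [AddCommGroup M] [Module K M]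
  [LieRingModule g M] [LieModule K g M]

theorem mem_weightSpace_of_equiv {N : Type*} [AddCommGroup N] [Module K N]
    [LieRingModule g N] [LieModule K g N] (e : M ≃ₗ⁅K,g⁆ N) {χ : Dual K h} {v : M}
    (hv : v ∈ weightSpace h M χ) : e v ∈ weightSpace h N χ := by
  intro x
  have h1 : ⁅(x : g), (e : M →ₗ⁅K,g⁆ N) v⁆ = _ := (LieModuleHom.map_lie (e : M →ₗ⁅K,g⁆ N) x v).symm
  rw [hv x, map_smul] at h1
  exact h1

end LieModules

/-! ### Modules generated by a highest weight vector. -/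

section HighestWeight

variable {K : Type*} [Field K] {g : Type*} [LieRing g] [LieAlgebra K g] {h b : LieSubalgebra K g}
  {M : Type*} [AddCommGroup M] [Module K M] [LieRingModule g M] [LieModule K g M]

variable [CharZero K] [IsAlgClosed K]

/-- A module generated by a highest weight vector `w` is the sum of `K w` and of weight spaces for
smaller weights. -/
theorem mem_of_generated (hh : IsSplittingMaximalToral h) (hb : Maximal IsLocallySolvable b)
    (hhb : h ≤ b) {χ : Dual K h} {w : M} (hw : w ∈ weightSpace h M χ)
    (hn : ∀ x ∈ nilrad b, ⁅x, w⁆ = 0) (hgen : ∀ N : LieSubmodule K g M, w ∈ N → N = ⊤) (v : M) :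
    v ∈ Submodule.span K {w} ⊔ weightSum h M {η | Prec h b η χ ∧ η ≠ χ} := by
  have hP := isPointed_posCone hh hb.1
  have hbs := toSubmodule_eq_weightSum hh hb hhb
  -- `b` acts on `w` by scalars
  have hbw : ∀ x ∈ b, ⁅x, w⁆ ∈ Submodule.span K {w} := by
    intro x hx
    have hx' : x ∈ weightSum h g (posCone h b : Set (Dual K h)) := hbs ▸ hx
    obtain ⟨S, u, hS, hu, -, rfl⟩ := exists_sum_of_mem_weightSum hx'
    rw [sum_lie]
    refine Submodule.sum_mem _ fun p hp => ?_
    by_cases hp0 : p = 0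
    · have h1 : u p ∈ h := hh.mem_iff.mp (hp0 ▸ hu p)
      rw [hw ⟨u p, h1⟩]
      exact Submodule.smul_mem _ _ (Submodule.mem_span_singleton_self w)
    · rw [hn _ (weightSpace_le_nilrad hhb hp0
        (hbs ▸ weightSpace_le_weightSum (hS p hp)) (hu p))]
      exact Submodule.zero_mem _
  -- the `n⁻`-submodule generated by `w`
  set 𝒯 : Set (Submodule K M) := {N | w ∈ N ∧ ∀ y ∈ weightSum h g (negCone h b), ∀ v ∈ N, ⁅y, v⁆ ∈ N}
    with h𝒯
  set T := sInf 𝒯 with hT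
  have hwT : w ∈ T := Submodule.mem_sInf.mpr fun N hN => hN.1
  have hTn : ∀ y ∈ weightSum h g (negCone h b), ∀ v ∈ T, ⁅y, v⁆ ∈ T := fun y hy v hv =>
    Submodule.mem_sInf.mpr fun N hN => hN.2 y hy v (Submodule.mem_sInf.mp hv N hN)
  have hc := isCompl_weightSum_negCone hh hb hhb
  have hTb : ∀ v ∈ T, v ∈ T ∧ ∀ x ∈ b, ⁅x, v⁆ ∈ T := by
    -- The vectors of `T` that `b` maps into `T` form an `n⁻`-stable subspace: in `x y v = [x, y] v
    -- + y x v`, the bracket splits along `n⁻ ⊕ b`. It contains `w`, so it is all of `T`.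
    let Good : Submodule K M :=
      { carrier := {v | v ∈ T ∧ ∀ x ∈ b, ⁅x, v⁆ ∈ T}
        add_mem' := fun {u v} hu hv => ⟨T.add_mem hu.1 hv.1, fun x hx => by
          rw [lie_add]; exact T.add_mem (hu.2 x hx) (hv.2 x hx)⟩
        zero_mem' := ⟨T.zero_mem, fun x _ => by rw [lie_zero]; exact T.zero_mem⟩
        smul_mem' := fun c v hv => ⟨T.smul_mem c hv.1, fun x hx => by
          rw [lie_smul]; exact T.smul_mem c (hv.2 x hx)⟩ }
    have hle : T ≤ Good := by
      refine sInf_le ⟨⟨hwT, fun x hx => ?_⟩, fun y hy v hv => ⟨hTn y hy v hv.1, fun x hx => ?_⟩⟩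
      · exact (Submodule.span_le.mpr (Set.singleton_subset_iff.mpr hwT)) (hbw x hx)
      · rw [leibniz_lie]
        refine T.add_mem ?_ (hTn y hy _ (hv.2 x hx))
        obtain ⟨a, ha, c, hc', hac⟩ := Submodule.mem_sup.mp
          (hc.sup_eq_top.symm ▸ Submodule.mem_top :
            ⁅x, y⁆ ∈ weightSum h g (negCone h b) ⊔ b.toSubmodule)
        rw [← hac, add_lie]
        exact T.add_mem (hTn a ha v hv.1) (hv.2 c hc')
    exact fun v hv => hle hv
  have hTtop : ∀ v : M, v ∈ T := by
    let N : LieSubmodule K g M :=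
      { T with
        lie_mem := fun {x v} hv => by
          obtain ⟨a, ha, c, hc', hac⟩ := Submodule.mem_sup.mp
            (hc.sup_eq_top.symm ▸ Submodule.mem_top :
              x ∈ weightSum h g (negCone h b) ⊔ b.toSubmodule)
          rw [← hac, add_lie]
          exact T.add_mem (hTn a ha v hv) ((hTb v hv).2 c hc') }
    intro v
    have : v ∈ N := by rw [hgen N hwT]; trivial
    exact this
  have hmem : Submodule.span K {w} ⊔ weightSum h M {η | Prec h b η χ ∧ η ≠ χ} ∈ 𝒯 := by
    refine ⟨Submodule.mem_sup_left (Submodule.mem_span_singleton_self w), fun y hy v hv => ?_⟩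
    refine Submodule.mem_sup_right ?_
    have hv' : v ∈ weightSum h M {η | Prec h b η χ} := by
      refine (sup_le ?_ (weightSum_mono fun η hη => hη.1) :
        Submodule.span K {w} ⊔ weightSum h M {η | Prec h b η χ ∧ η ≠ χ} ≤ _) hv
      rw [Submodule.span_le, Set.singleton_subset_iff]
      refine weightSpace_le_weightSum (A := {η | Prec h b η χ}) ?_ hw
      change χ - χ ∈ posCone h b
      rw [sub_self]
      exact zero_mem _
    refine lie_mem_weightSum_of_forall (fun γ hγ η hη y hy v hv => ?_) hy hv'
    refine weightSpace_le_weightSum (A := {η | Prec h b η χ ∧ η ≠ χ}) ⟨?_, fun h0 => ?_⟩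
      (lie_mem_weightSpace_add hy hv)
    · change χ - (γ + η) ∈ posCone h b
      have : χ - (γ + η) = -γ + (χ - η) := by abel
      rw [this]
      exact add_mem hγ.1 hη
    · have h1 : -γ + (χ - η) = 0 := by rw [← h0]; abel
      exact hγ.2 (neg_eq_zero.mp (hP.eq_zero_of_add_eq_zero hγ.1 hη h1))
  exact (sInf_le hmem : T ≤ _) (hTtop v)

variable (hh : IsSplittingMaximalToral h) (hb : Maximal IsLocallySolvable b) (hhb : h ≤ b)
  {χ : Dual K h} {w : M} (hw : w ∈ weightSpace h M χ)
  (hn : ∀ x ∈ nilrad b, ⁅x, w⁆ = 0) (hgen : ∀ N : LieSubmodule K g M, w ∈ N → N = ⊤)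

include hh hb hhb hw hn hgen

theorem mem_weightSum_of_generated (v : M) : v ∈ weightSum h M {η | Prec h b η χ} := by
  refine (sup_le ?_ (weightSum_mono fun η hη => hη.1) :
    Submodule.span K {w} ⊔ weightSum h M {η | Prec h b η χ ∧ η ≠ χ} ≤ _)
    (mem_of_generated hh hb hhb hw hn hgen v)
  rw [Submodule.span_le, Set.singleton_subset_iff]
  refine weightSpace_le_weightSum (A := {η | Prec h b η χ}) ?_ hw
  change χ - χ ∈ posCone h b
  rw [sub_self]
  exact zero_mem _

theorem iSup_weightSpace_of_generated : ⨆ η : Dual K h, weightSpace h M η = ⊤ := by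
  rw [eq_top_iff, ← weightSum_univ]
  exact fun v _ => weightSum_mono (Set.subset_univ _)
    (mem_weightSum_of_generated hh hb hhb hw hn hgen v)

theorem prec_of_generated {η : Dual K h} {v : M} (hv : v ∈ weightSpace h M η) (hv0 : v ≠ 0) :
    Prec h b η χ := by
  by_contra hη
  exact hv0 (eq_zero_of_mem_weightSum (A := {η | Prec h b η χ}) hη hv
    (mem_weightSum_of_generated hh hb hhb hw hn hgen v))

theorem exists_smul_of_generated {v : M} (hv : v ∈ weightSpace h M χ) : ∃ c : K, v = c • w := by
  obtain ⟨a, ha, z, hz, rfl⟩ := Submodule.mem_sup.mp (mem_of_generated hh hb hhb hw hn hgen v)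
  obtain ⟨c, rfl⟩ := Submodule.mem_span_singleton.mp ha
  refine ⟨c, ?_⟩
  have h1 : z ∈ weightSpace h M χ :=
    (Submodule.add_mem_iff_right _ (Submodule.smul_mem _ c hw)).mp hv
  rw [eq_zero_of_mem_weightSum (by simp) h1 hz, add_zero]

/-- The `χ`-weight space is the line of `w`, and `w` generates, so a proper submodule has no
component of weight `χ`. This property passes to sums. -/
theorem notMem_sSup_of_generated (hw0 : w ≠ 0) :
    w ∉ sSup {N : LieSubmodule K g M | N ≠ ⊤} := by
  have hle : ∀ N : LieSubmodule K g M, N ≠ ⊤ →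
      N.toSubmodule ≤ weightSum h M {η | η ≠ χ} := by
    intro N hN v hv
    obtain ⟨S, u, hu, huN, -, rfl⟩ := exists_sum_of_mem
      (iSup_weightSpace_of_generated hh hb hhb hw hn hgen) N.toSubmodule
      (fun x _ v hv => N.lie_mem hv) hv
    refine Submodule.sum_mem _ fun η _ => ?_
    by_cases hη : η = χ
    · subst hη
      obtain ⟨c, hc⟩ := exists_smul_of_generated hh hb hhb hw hn hgen (hu η)
      by_cases hc0 : c = 0
      · rw [hc, hc0, zero_smul]; exact Submodule.zero_mem _
      · refine absurd (hgen N ?_) hN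
        have := huN η
        rw [hc] at this
        exact (N.toSubmodule.smul_mem_iff hc0).mp this
    · exact weightSpace_le_weightSum (show η ∈ {η | η ≠ χ} from hη) (hu η)
  intro hmem
  rw [← LieSubmodule.mem_toSubmodule, LieSubmodule.sSup_toSubmodule] at hmem
  refine hw0 (eq_zero_of_mem_weightSum (A := {η | η ≠ χ}) (by simp) hw (?_ : w ∈ _))
  refine (sSup_le ?_ : sSup {(s : Submodule K M) | s ∈ {N : LieSubmodule K g M | N ≠ ⊤}} ≤ _) hmem
  rintro _ ⟨N, hN, rfl⟩
  exact hle N hN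

end HighestWeight

/-! ### Verma modules and their simple quotients. -/

section Verma

variable {K : Type*} [Field K] {g : Type*} [LieRing g] [LieAlgebra K g] {h b : LieSubalgebra K g}

/-- The highest weight vector of a Verma module. -/
noncomputable def vermaGen (h b : LieSubalgebra K g) (χ : Dual K h) : Verma h b χ :=
  (Submodule.Quotient.mk 1 : UniversalEnvelopingAlgebra K g ⧸ vermaIdeal h b χ)

theorem verma_lie_def {χ : Dual K h} (x : g) (v : Verma h b χ) :
    ⁅x, v⁆ = UniversalEnvelopingAlgebra.ι K x • v := rfl

theorem smul_vermaGen {χ : Dual K h} (u : UniversalEnvelopingAlgebra K g) :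
    u • vermaGen h b χ =
      (Submodule.Quotient.mk u : UniversalEnvelopingAlgebra K g ⧸ vermaIdeal h b χ) := by
  have : u • vermaGen h b χ =
    (Submodule.Quotient.mk (u • 1) : UniversalEnvelopingAlgebra K g ⧸ vermaIdeal h b χ) := rfl
  rw [this, smul_eq_mul, mul_one]

theorem smul_vermaGen_eq_zero {χ : Dual K h} {u : UniversalEnvelopingAlgebra K g}
    (hu : u ∈ vermaIdeal h b χ) : u • vermaGen h b χ = 0 := by
  rw [smul_vermaGen]
  exact (Submodule.Quotient.mk_eq_zero _).mpr hu

theorem nilrad_lie_vermaGen {χ : Dual K h} {x : g} (hx : x ∈ nilrad b) :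
    ⁅x, vermaGen h b χ⁆ = 0 :=
  smul_vermaGen_eq_zero (Ideal.subset_span (Or.inl ⟨x, hx, rfl⟩))

theorem vermaGen_mem (χ : Dual K h) : vermaGen h b χ ∈ weightSpace h (Verma h b χ) χ := by
  intro x
  have h1 : (UniversalEnvelopingAlgebra.ι K (x : g) -
      algebraMap K (UniversalEnvelopingAlgebra K g) (χ x)) • vermaGen h b χ = 0 :=
    smul_vermaGen_eq_zero (Ideal.subset_span (Or.inr ⟨x, rfl⟩))
  rw [sub_smul, algebraMap_smul, sub_eq_zero] at h1
  exact h1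

theorem eq_top_of_vermaGen_mem {χ : Dual K h} (N : LieSubmodule K g (Verma h b χ))
    (hN : vermaGen h b χ ∈ N) : N = ⊤ := by
  rw [eq_top_iff]
  intro v _
  obtain ⟨u, rfl⟩ := Submodule.Quotient.mk_surjective (vermaIdeal h b χ) v
  rw [← smul_vermaGen]
  exact smul_mem_of_forall_ι N.toSubmodule (fun x w hw => N.lie_mem (x := x) hw) u hN

/-- The universal property of Verma modules. -/
theorem exists_verma_hom {M : Type*} [AddCommGroup M] [Module K M]
    [LieRingModule g M] [LieModule K g M] {χ : Dual K h} {w : M} (hw : w ∈ weightSpace h M χ)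
    (hn : ∀ x ∈ nilrad b, ⁅x, w⁆ = 0) :
    ∃ f : Verma h b χ →ₗ⁅K,g⁆ M, f (vermaGen h b χ) = w := by
  let : LieRing (Module.End K M) := LieRing.ofAssociativeRing
  let F := UniversalEnvelopingAlgebra.lift K (LieModule.toEnd K g M)
  let I : Ideal (UniversalEnvelopingAlgebra K g) :=
    { carrier := {u | F u w = 0}
      add_mem' := fun {a c} ha hc => by
        change F (a + c) w = 0
        rw [map_add, LinearMap.add_apply, ha, hc, add_zero]
      zero_mem' := by
        change F 0 w = 0
        rw [map_zero, LinearMap.zero_apply]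
      smul_mem' := fun a c hc => by
        change F (a * c) w = 0
        rw [map_mul, Module.End.mul_apply, hc, map_zero] }
  have hF : ∀ x : g, F (UniversalEnvelopingAlgebra.ι K x) = LieModule.toEnd K g M x := fun x =>
    UniversalEnvelopingAlgebra.lift_ι_apply K _ x
  have hI : vermaIdeal h b χ ≤ I := by
    refine Ideal.span_le.mpr (Set.union_subset ?_ ?_)
    · rintro _ ⟨x, hx, rfl⟩
      change F (UniversalEnvelopingAlgebra.ι K x) w = 0
      rw [hF]
      exact hn x hx
    · rintro _ ⟨x, rfl⟩
      change F (UniversalEnvelopingAlgebra.ι K (x : g) - algebraMap K _ (χ x)) w = 0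
      rw [map_sub, hF, AlgHom.commutes, LinearMap.sub_apply, Module.algebraMap_end_apply,
        sub_eq_zero]
      exact hw x
  let φ : UniversalEnvelopingAlgebra K g →ₗ[K] M := (LinearMap.applyₗ w) ∘ₗ F.toLinearMap
  have hφ : (vermaIdeal h b χ).restrictScalars K ≤ LinearMap.ker φ := fun u hu => hI hu
  let f : Verma h b χ →ₗ[K] M := ((vermaIdeal h b χ).restrictScalars K).liftQ φ hφ
  have hf : ∀ u : UniversalEnvelopingAlgebra K g, f (u • vermaGen h b χ) = F u w := by
    intro u
    rw [smul_vermaGen]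
    rfl
  refine ⟨{ f with map_lie' := fun {x v} => ?_ }, ?_⟩
  · change f ⁅x, v⁆ = ⁅x, f v⁆
    obtain ⟨u, rfl⟩ := Submodule.Quotient.mk_surjective (vermaIdeal h b χ) v
    rw [← smul_vermaGen, verma_lie_def, smul_smul, hf, hf, map_mul, Module.End.mul_apply, hF]
    rfl
  · have := hf 1
    rw [one_smul, map_one] at this
    exact this

variable [CharZero K] [IsAlgClosed K] (hh : IsSplittingMaximalToral h)
  (hb : Maximal IsLocallySolvable b) (hhb : h ≤ b)

include hh hb hhb

/-- The defining left ideal annihilates the vector `1` of the module `U(n⁻)` induced from the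
character of `b` extending `χ`; the unit of `U(g)` does not. -/
theorem vermaGen_ne_zero (χ : Dual K h) : vermaGen h b χ ≠ 0 := by
  let : LieRing (Module.End K (UniversalEnvelopingAlgebra K (weightSubalgebra h (negCone h b)
    fun _ h1 _ h2 => add_mem_negCone (isPointed_posCone hh hb.1) h1 h2))) :=
    LieRing.ofAssociativeRing
  obtain ⟨Ξ, hΞ, hΞ'⟩ := exists_extension hh χ
  have hΞ'' : ∀ x ∈ nilrad b, Ξ x = 0 := fun x hx =>
    hΞ' x (weightSum_mono (fun η hη => hη.2) (nilrad_le_weightSum hh hb.1 hhb hx))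
  obtain ⟨ρ, hρ⟩ := exists_induced_module (m := weightSubalgebra h (negCone h b)
    fun _ h1 _ h2 => add_mem_negCone (isPointed_posCone hh hb.1) h1 h2) (b := b)
    (isCompl_weightSum_negCone hh hb hhb) Ξ
    (fun x hx y hy => hΞ'' _ (Submodule.subset_span ⟨x, hx, y, hy, rfl⟩))
  let F := UniversalEnvelopingAlgebra.lift K ρ
  let I : Ideal (UniversalEnvelopingAlgebra K g) :=
    { carrier := {u | F u 1 = 0}
      add_mem' := fun {a c} ha hc => by
        change F (a + c) 1 = 0
        rw [map_add, LinearMap.add_apply, ha, hc, add_zero]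
      zero_mem' := by
        change F 0 1 = 0
        rw [map_zero, LinearMap.zero_apply]
      smul_mem' := fun a c hc => by
        change F (a * c) 1 = 0
        rw [map_mul, Module.End.mul_apply, hc, map_zero] }
  have hF : ∀ x : g, F (UniversalEnvelopingAlgebra.ι K x) = ρ x := fun x =>
    UniversalEnvelopingAlgebra.lift_ι_apply K _ x
  have hnb : nilrad b ≤ b.toSubmodule := by
    refine Submodule.span_le.mpr ?_
    rintro _ ⟨x, hx, y, hy, rfl⟩
    exact b.lie_mem hx hy
  have hI : vermaIdeal h b χ ≤ I := by
    refine Ideal.span_le.mpr (Set.union_subset ?_ ?_)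
    · rintro _ ⟨x, hx, rfl⟩
      change F (UniversalEnvelopingAlgebra.ι K x) 1 = 0
      rw [hF, hρ x (hnb hx), hΞ'' x hx, zero_smul]
    · rintro _ ⟨x, rfl⟩
      change F (UniversalEnvelopingAlgebra.ι K (x : g) - algebraMap K _ (χ x)) 1 = 0
      rw [map_sub, hF, AlgHom.commutes, LinearMap.sub_apply, Module.algebraMap_end_apply,
        hρ x (hhb x.2), hΞ, sub_self]
  intro h0
  have h1 : (1 : UniversalEnvelopingAlgebra K g) ∈ vermaIdeal h b χ :=
    (Submodule.Quotient.mk_eq_zero _).mp h0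
  have h2 : F 1 1 = 0 := hI h1
  have h3 : F 1 = 1 := map_one F
  rw [h3] at h2
  exact one_ne_zero h2

theorem iSup_weightSpace_verma (χ : Dual K h) :
    ⨆ η : Dual K h, weightSpace h (Verma h b χ) η = ⊤ :=
  iSup_weightSpace_of_generated hh hb hhb (vermaGen_mem χ) (fun _ hx => nilrad_lie_vermaGen hx)
    eq_top_of_vermaGen_mem

theorem vermaGen_notMem (χ : Dual K h) :
    vermaGen h b χ ∉ sSup {N : LieSubmodule K g (Verma h b χ) | N ≠ ⊤} :=
  notMem_sSup_of_generated hh hb hhb (vermaGen_mem χ) (fun _ hx => nilrad_lie_vermaGen hx)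
    eq_top_of_vermaGen_mem (vermaGen_ne_zero hh hb hhb χ)

/-- The image of the highest weight vector in `L(χ)`. -/
theorem exists_weight_simpleHW (χ : Dual K h) :
    ∃ v : SimpleHW h b χ, v ∈ weightSpace h (SimpleHW h b χ) χ ∧ v ≠ 0 := by
  refine ⟨LieSubmodule.Quotient.mk' _ (vermaGen h b χ), fun x => ?_, fun h0 => ?_⟩
  · rw [← LieModuleHom.map_lie, vermaGen_mem χ x, map_smul]
  · exact vermaGen_notMem hh hb hhb χ ((LieSubmodule.Quotient.mk_eq_zero _).mp h0)

theorem isIrreducible_simpleHW (χ : Dual K h) : LieModule.IsIrreducible K g (SimpleHW h b χ) := by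
  obtain ⟨v, -, hv0⟩ := exists_weight_simpleHW hh hb hhb χ
  have : Nontrivial (SimpleHW h b χ) := ⟨v, 0, hv0⟩
  refine LieModule.IsIrreducible.mk fun N hN => ?_
  set π := LieSubmodule.Quotient.mk' (sSup {N : LieSubmodule K g (Verma h b χ) | N ≠ ⊤}) with hπ
  have hsurj : Function.Surjective π := LieSubmodule.Quotient.surjective_mk' _
  by_cases htop : N.comap π = ⊤
  · rw [eq_top_iff]
    intro u _
    obtain ⟨a, rfl⟩ := hsurj u
    have : a ∈ N.comap π := by rw [htop]; trivial
    exact this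
  · refine absurd ((LieSubmodule.eq_bot_iff N).mpr fun u hu => ?_) hN
    obtain ⟨a, rfl⟩ := hsurj u
    have h1 : N.comap π ≤ sSup {N : LieSubmodule K g (Verma h b χ) | N ≠ ⊤} := le_sSup htop
    exact (LieSubmodule.Quotient.mk_eq_zero _).mpr (h1 hu)

theorem prec_of_weight_simpleHW {χ η : Dual K h} {v : SimpleHW h b χ}
    (hv : v ∈ weightSpace h (SimpleHW h b χ) η) (hv0 : v ≠ 0) : Prec h b η χ := by
  set π := LieSubmodule.Quotient.mk' (sSup {N : LieSubmodule K g (Verma h b χ) | N ≠ ⊤}) with hπ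
  obtain ⟨a, ha⟩ := LieSubmodule.Quotient.surjective_mk' _ v
  obtain ⟨w, hw, hwv⟩ := exists_lift_weight (iSup_weightSpace_verma hh hb hhb χ) π hv ha
  refine prec_of_generated hh hb hhb (vermaGen_mem χ) (fun _ hx => nilrad_lie_vermaGen hx)
    eq_top_of_vermaGen_mem hw ?_
  rintro rfl
  exact hv0 (by rw [← hwv, map_zero])

/-- Each highest weight is a weight of the other module, so the two are comparable both ways, and
the cone is pointed. -/
theorem eq_of_simpleHW_equiv {χ η : Dual K h} (e : SimpleHW h b χ ≃ₗ⁅K,g⁆ SimpleHW h b η) :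
    χ = η := by
  have key : ∀ {χ η : Dual K h}, (SimpleHW h b χ ≃ₗ⁅K,g⁆ SimpleHW h b η) → Prec h b χ η := by
    intro χ η e
    obtain ⟨v, hv, hv0⟩ := exists_weight_simpleHW hh hb hhb χ
    refine prec_of_weight_simpleHW hh hb hhb (mem_weightSpace_of_equiv e hv) fun h0 => hv0 ?_
    exact e.toEquiv.injective (h0.trans (map_zero
      (e : SimpleHW h b χ →ₗ⁅K,g⁆ SimpleHW h b η)).symm)
  have h1 := isPointed_posCone hh hb.1 _ (key e) (by rw [neg_sub]; exact key e.symm)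
  exact (sub_eq_zero.mp h1).symm

/-- An irreducible module with a highest weight vector of weight `χ` is isomorphic to `L(χ)`. -/
theorem nonempty_equiv_simpleHW {X : Type*} [AddCommGroup X] [Module K X] [LieRingModule g X]
    [LieModule K g X] (hX : LieModule.IsIrreducible K g X) {χ : Dual K h} {w : X}
    (hw : w ∈ weightSpace h X χ) (hw0 : w ≠ 0) (hn : ∀ x ∈ nilrad b, ⁅x, w⁆ = 0) :
    Nonempty (X ≃ₗ⁅K,g⁆ SimpleHW h b χ) := by
  obtain ⟨f, hf⟩ := exists_verma_hom hw hn
  set Nmax := sSup {N : LieSubmodule K g (Verma h b χ) | N ≠ ⊤} with hNmax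
  have hgen := vermaGen_notMem hh hb hhb χ
  have hsurj : Function.Surjective f := by
    rw [← LieModuleHom.range_eq_top]
    refine (hX.eq_bot_or_eq_top f.range).resolve_left fun h0 => hw0 ?_
    rw [LieSubmodule.eq_bot_iff] at h0
    exact h0 w ⟨_, hf⟩
  have hker : f.ker ≤ Nmax := by
    refine le_sSup fun htop => hw0 ?_
    rw [← hf, ← LieModuleHom.mem_ker, htop]
    trivial
  refine nonempty_equiv_of_ker_eq f (LieSubmodule.Quotient.mk' Nmax) hsurj
    (LieSubmodule.Quotient.surjective_mk' _) fun a => ?_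
  rw [LieSubmodule.Quotient.mk_eq_zero]
  refine ⟨fun ha => hker ha, fun ha => ?_⟩
  -- If the largest proper submodule mapped onto `X`, then, as it contains the kernel of `f`, it
  -- would contain the generator.
  rcases hX.eq_bot_or_eq_top (Nmax.map f) with h0 | h1
  · rw [LieSubmodule.eq_bot_iff] at h0
    exact h0 _ (LieSubmodule.mem_map_of_mem ha)
  · exfalso
    have : f (vermaGen h b χ) ∈ Nmax.map f := by rw [h1]; trivial
    obtain ⟨a', ha', hfa⟩ := (LieSubmodule.mem_map _).mp this
    apply hgen
    have h2 : vermaGen h b χ - a' ∈ f.ker := by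
      rw [LieModuleHom.mem_ker, map_sub, hfa, sub_self]
    have h3 := Nmax.add_mem (hker h2) ha'
    rwa [sub_add_cancel] at h3

end Verma

/-! ### Layerings and the first jump. -/

section LayerOrder

variable {K : Type*} [Field K] {g : Type*} [LieRing g]
  {M : Type*} [AddCommGroup M] [Module K M] [LieRingModule g M]

/-- The intervals `[lo i, hi i]` form a totally ordered family of layers that catches every nonzero
vector. -/
structure IsLayering {I : Type*} [LinearOrder I] (lo hi : I → LieSubmodule K g M) : Prop where
  le : ∀ i, lo i ≤ hi i
  le_of_lt : ∀ i j, i < j → hi i ≤ lo j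
  exhaust : ∀ v : M, v ≠ 0 → ∃ i, v ∈ hi i ∧ v ∉ lo i

/-- `[B', A']` is the first interval in which `A` exceeds `B`. -/
def Meets (B A B' A' : LieSubmodule K g M) : Prop :=
  ¬ A ⊓ A' ≤ B ∧ A ⊓ B' ≤ B

variable {I : Type*} [LinearOrder I] {lo hi : I → LieSubmodule K g M}

theorem IsLayering.lo_mono (hL : IsLayering lo hi) : Monotone lo :=
  monotone_iff_forall_lt.mpr fun i j hij => (hL.le i).trans (hL.le_of_lt i j hij)

/-- The trace on `A / B` is nonzero at the top of the first met layer but zero at the bottom of the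
second, so neither layer can precede the other. -/
theorem IsLayering.eq_of_meets (hL : IsLayering lo hi) {B A : LieSubmodule K g M} {i j : I}
    (h₁ : Meets B A (lo i) (hi i)) (h₂ : Meets B A (lo j) (hi j)) : i = j := by
  rcases lt_trichotomy i j with hij | hij | hij
  · exact absurd ((inf_le_inf_left A (hL.le_of_lt i j hij)).trans h₂.2) h₁.1
  · exact hij
  · exact absurd ((inf_le_inf_left A (hL.le_of_lt j i hij)).trans h₁.2) h₂.1

end LayerOrder

/-! ### The Jordan–Hölder argument. -/

section Layers

variable {K : Type*} [Field K] {g : Type*} [LieRing g] [LieAlgebra K g] {h : LieSubalgebra K g}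
  {M : Type*} [AddCommGroup M] [Module K M] [LieRingModule g M] [LieModule K g M]

theorem subquot_mk_eq_zero {A B : LieSubmodule K g M} {a : A} :
    LieSubmodule.Quotient.mk' (B.comap A.incl) a = 0 ↔ (a : M) ∈ B :=
  LieSubmodule.Quotient.mk_eq_zero _

theorem le_sup_of_isIrreducible_subquot {A B : LieSubmodule K g M}
    (hirr : LieModule.IsIrreducible K g (Subquot A B)) {N : LieSubmodule K g M}
    (hN : N ≤ A) (hNB : ¬ N ≤ B) : A ≤ N ⊔ B := by
  set π := LieSubmodule.Quotient.mk' (B.comap A.incl) with hπ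
  intro a ha
  rcases hirr.eq_bot_or_eq_top ((N.comap A.incl).map π) with h0 | h1
  · refine absurd (fun n hn => ?_) hNB
    rw [LieSubmodule.eq_bot_iff] at h0
    have h2 := h0 (π ⟨n, hN hn⟩) (LieSubmodule.mem_map_of_mem (show _ ∈ N.comap A.incl from hn))
    exact subquot_mk_eq_zero.mp h2
  · have h2 : π ⟨a, ha⟩ ∈ (N.comap A.incl).map π := by rw [h1]; trivial
    obtain ⟨n, hn, hna⟩ := (LieSubmodule.mem_map _).mp h2
    have h3 : π (⟨a, ha⟩ - n) = 0 := by rw [map_sub, hna, sub_self]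
    have h4 : a - n ∈ B := subquot_mk_eq_zero.mp h3
    rw [LieSubmodule.mem_sup]
    exact ⟨n, hn, a - n, h4, by abel⟩

theorem exists_mem_notMem_of_isIrreducible {A B : LieSubmodule K g M}
    (hirr : LieModule.IsIrreducible K g (Subquot A B)) : ∃ v ∈ A, v ∉ B := by
  by_contra! hc
  obtain ⟨N, N', hne⟩ := hirr.toNontrivial
  have h0 : ∀ v : Subquot A B, v = 0 := by
    intro v
    obtain ⟨a, rfl⟩ := LieSubmodule.Quotient.surjective_mk' _ v
    exact subquot_mk_eq_zero.mpr (hc a a.2)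
  have h1 : ∀ N : LieSubmodule K g (Subquot A B), N = ⊥ := fun N =>
    (LieSubmodule.eq_bot_iff N).mpr fun m _ => h0 m
  exact hne ((h1 N).trans (h1 N').symm)

/-- A nonzero weight space of `A / B` comes from a weight vector in `A ∖ B`. -/
theorem exists_weight_of_subquot (hM : ⨆ χ : Dual K h, weightSpace h M χ = ⊤)
    {A B : LieSubmodule K g M} {μ : Dual K h} (hμ : weightSpace h (Subquot A B) μ ≠ ⊥) :
    ∃ w ∈ weightSpace h M μ, w ∈ A ∧ w ∉ B := by
  obtain ⟨u, hu, hu0⟩ := Submodule.exists_mem_ne_zero_of_ne_bot hμ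
  obtain ⟨a, ha⟩ := LieSubmodule.Quotient.surjective_mk' _ u
  obtain ⟨w, hw, hwu⟩ := exists_lift_weight (iSup_weightSpace_lieSubmodule hM A)
    (LieSubmodule.Quotient.mk' (B.comap A.incl)) hu ha
  refine ⟨w, fun x => congrArg Subtype.val (hw x), w.2, fun hB => hu0 ?_⟩
  rw [← hwu]
  exact subquot_mk_eq_zero.mpr hB

theorem weightSpace_subquot_ne_bot {A B : LieSubmodule K g M} {μ : Dual K h} {w : M}
    (hw : w ∈ weightSpace h M μ) (hA : w ∈ A) (hB : w ∉ B) :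
    weightSpace h (Subquot A B) μ ≠ ⊥ := by
  rw [Submodule.ne_bot_iff]
  refine ⟨LieSubmodule.Quotient.mk' (B.comap A.incl) ⟨w, hA⟩, fun x => ?_, fun h0 => ?_⟩
  · rw [← LieModuleHom.map_lie, ← map_smul]
    congr 1
    exact Subtype.ext (hw x)
  · exact hB (subquot_mk_eq_zero.mp h0)

/-- If `w + B ∈ (N + B) / B` with `w` a weight vector, then `w` is congruent modulo `B` to a weight
vector of the same weight in `N`. -/
theorem exists_weight_of_mem_sup (hM : ⨆ χ : Dual K h, weightSpace h M χ = ⊤)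
    {N B : LieSubmodule K g M} {μ : Dual K h} {w : M} (hw : w ∈ weightSpace h M μ)
    (hNB : w ∈ N ⊔ B) : ∃ a ∈ weightSpace h M μ, a ∈ N ∧ w - a ∈ B := by
  obtain ⟨n, hn, c, hc, rfl⟩ := (LieSubmodule.mem_sup _ _ _).mp hNB
  set π := LieSubmodule.Quotient.mk' B
  have hu : π (n + c) ∈ weightSpace h (M ⧸ B) μ := fun x => by
    rw [← LieModuleHom.map_lie, hw x, map_smul]
  obtain ⟨a, ha, hau⟩ := exists_lift_weight (iSup_weightSpace_lieSubmodule hM N)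
    (π.comp N.incl) hu (v := ⟨n, hn⟩) (by
      have : π c = 0 := (LieSubmodule.Quotient.mk_eq_zero _).mpr hc
      rw [map_add, this, add_zero]; rfl)
  refine ⟨a, fun x => congrArg Subtype.val (ha x), a.2, ?_⟩
  have h1 : π (n + c - a) = 0 := by rw [map_sub, ← hau]; exact sub_self _
  exact (LieSubmodule.Quotient.mk_eq_zero _).mp h1

/-- `A ⊓ A'` maps onto `A / B`, and the part of it in `B'` lies in `B`; so `A / B` is a subquotient
of `A' / B'`, which need not be irreducible here. -/
theorem Meets.weightSpace_ne_bot (hM : ⨆ χ : Dual K h, weightSpace h M χ = ⊤)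
    {B A B' A' : LieSubmodule K g M} (hR : Meets B A B' A')
    (hirr : LieModule.IsIrreducible K g (Subquot A B)) {μ : Dual K h}
    (hμ : weightSpace h (Subquot A B) μ ≠ ⊥) : weightSpace h (Subquot A' B') μ ≠ ⊥ := by
  obtain ⟨w, hw, hwA, hwB⟩ := exists_weight_of_subquot hM hμ
  obtain ⟨a, ha, haA, haB⟩ := exists_weight_of_mem_sup hM hw
    (le_sup_of_isIrreducible_subquot hirr inf_le_left hR.1 hwA)
  refine weightSpace_subquot_ne_bot ha haA.2 fun haB' => hwB ?_
  have := B.add_mem haB (hR.2 ⟨haA.1, haB'⟩)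
  rwa [sub_add_cancel] at this

/-- Take `w ∈ A ⊓ A'` outside `B`. If `A' ⊓ B` were not in `B'`, irreducibility of `A' / B'` would
give `w = a + c` with `a ∈ B` and `c ∈ A ⊓ B' ≤ B`. -/
theorem Meets.symm {B A B' A' : LieSubmodule K g M} (hR : Meets B A B' A') (hle : B ≤ A)
    (hirr : LieModule.IsIrreducible K g (Subquot A' B')) : Meets B' A' B A := by
  obtain ⟨w, ⟨hwA, hwA'⟩, hwB⟩ := SetLike.not_le_iff_exists.mp hR.1
  refine ⟨fun hc => hwB (hR.2 ⟨hwA, hc ⟨hwA', hwA⟩⟩), ?_⟩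
  by_contra hc
  obtain ⟨a, ha, c, hc', rfl⟩ := (LieSubmodule.mem_sup _ _ _).mp
    (le_sup_of_isIrreducible_subquot hirr inf_le_left hc hwA')
  refine hwB (B.add_mem ha.2 (hR.2 ⟨?_, hc'⟩))
  rw [← add_sub_cancel_left a c]
  exact A.sub_mem hwA (hle ha.2)

/-- Both factors are quotients of `A ⊓ A'`, and by symmetry of `Meets` the kernels agree. -/
theorem Meets.nonempty_equiv {B A B' A' : LieSubmodule K g M} (hR : Meets B A B' A') (hle : B ≤ A)
    (hirr : LieModule.IsIrreducible K g (Subquot A B))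
    (hirr' : LieModule.IsIrreducible K g (Subquot A' B')) :
    Nonempty (Subquot A B ≃ₗ⁅K,g⁆ Subquot A' B') := by
  have hR' := hR.symm hle hirr'
  have hsurj : ∀ {B A B' A' : LieSubmodule K g M} (_ : Meets B A B' A')
    (_ : LieModule.IsIrreducible K g (Subquot A B)) (X : LieSubmodule K g M) (hX : X ≤ A)
    (_ : A ⊓ A' ≤ X), Function.Surjective ((LieSubmodule.Quotient.mk' (B.comap A.incl)).comp
      (LieSubmodule.inclusion hX)) := by
    intro B A B' A' hR hirr X hX hX' u
    obtain ⟨a, rfl⟩ := LieSubmodule.Quotient.surjective_mk' _ u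
    obtain ⟨n, hn, c, hc, hnc⟩ := (LieSubmodule.mem_sup _ _ _).mp
      (le_sup_of_isIrreducible_subquot hirr inf_le_left hR.1 a.2)
    refine ⟨⟨n, hX' hn⟩, ?_⟩
    rw [LieModuleHom.comp_apply, ← sub_eq_zero, ← map_sub]
    refine (LieSubmodule.Quotient.mk_eq_zero _).mpr ?_
    change n - a ∈ B
    rw [← hnc, sub_add_cancel_left]
    exact B.neg_mem hc
  refine nonempty_equiv_of_ker_eq _ _ (hsurj hR hirr (A ⊓ A') inf_le_left le_rfl)
    (hsurj hR' hirr' (A ⊓ A') inf_le_right (inf_comm A' A).le) fun a => ?_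
  rw [LieModuleHom.comp_apply, LieModuleHom.comp_apply, subquot_mk_eq_zero, subquot_mk_eq_zero]
  exact ⟨fun ha => hR'.2 ⟨a.2.2, ha⟩, fun ha => hR.2 ⟨a.2.1, ha⟩⟩

variable {I I' : Type*} [LinearOrder I] [LinearOrder I'] {lo hi : I → LieSubmodule K g M}
  {lo' hi' : I' → LieSubmodule K g M}

/-- An infinite order may have no first layer, so layers catching a vector of `A ∖ B` of a fixed
weight `μ` are compared by the natural number `dim (M^μ ⊓ hi' i)`, and one with least value is
taken. -/
theorem IsLayering.exists_meets (hL : IsLayering lo' hi')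
    (hM : ⨆ χ : Dual K h, weightSpace h M χ = ⊤)
    (hfd : ∀ χ : Dual K h, FiniteDimensional K (weightSpace h M χ)) {B A : LieSubmodule K g M}
    (hirr : LieModule.IsIrreducible K g (Subquot A B)) :
    ∃ i, Meets B A (lo' i) (hi' i) := by
  obtain ⟨v, hvA, hvB⟩ := exists_mem_notMem_of_isIrreducible hirr
  obtain ⟨S, u, hu, huA, -, hsum⟩ := exists_sum_of_mem hM A.toSubmodule
    (fun x _ v hv => A.lie_mem hv) hvA
  obtain ⟨μ, hμ⟩ : ∃ μ, u μ ∉ B := by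
    by_contra! hc
    exact hvB (hsum ▸ B.toSubmodule.sum_mem fun χ _ => hc χ)
  have hfdμ := hfd μ
  -- choose a weight vector in the lowest possible layer
  let d : I' → ℕ := fun i => finrank K (weightSpace h M μ ⊓ (hi' i).toSubmodule : Submodule K M)
  let T : Set ℕ := {n | ∃ i, ∃ w ∈ weightSpace h M μ, w ∈ A ∧ w ∉ B ∧ w ∈ hi' i ∧ w ∉ lo' i ∧ d i = n}
  have hex : ∀ w ∈ weightSpace h M μ, w ∈ A → w ∉ B → ∃ i, w ∈ hi' i ∧ w ∉ lo' i ∧ d i ∈ T := by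
    intro w hw hwA hwB
    obtain ⟨i, hi1, hi2⟩ := hL.exhaust w (by rintro rfl; exact hwB B.zero_mem)
    exact ⟨i, hi1, hi2, i, w, hw, hwA, hwB, hi1, hi2, rfl⟩
  have hT : T.Nonempty := by
    obtain ⟨i, -, -, hi⟩ := hex (u μ) (hu μ) (huA μ) hμ
    exact ⟨_, hi⟩
  obtain ⟨i, w, hw, hwA, hwB, hwi, hwi', hdi⟩ := Nat.sInf_mem hT
  refine ⟨i, fun hc => hwB (hc ⟨hwA, hwi⟩), ?_⟩
  by_contra hc
  -- If `A ⊓ lo' i` already exceeded `B`, then `w` could be replaced modulo `B` by a weight vector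
  -- of `lo' i`, caught by a strictly lower layer with smaller dimension.
  obtain ⟨a, ha, haA, haB⟩ := exists_weight_of_mem_sup hM hw
    (le_sup_of_isIrreducible_subquot hirr inf_le_left hc hwA)
  have haB' : a ∉ B := fun h1 => hwB (by
    have := B.add_mem haB h1
    rwa [sub_add_cancel] at this)
  obtain ⟨j, hj1, hj2, hjT⟩ := hex a ha haA.1 haB'
  have hji : j < i := by
    by_contra hij
    exact hj2 (hL.lo_mono (not_lt.mp hij) haA.2)
  have hle : hi' j ≤ lo' i := hL.le_of_lt j i hji
  have hlt : (weightSpace h M μ ⊓ (hi' j).toSubmodule : Submodule K M) <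
      weightSpace h M μ ⊓ (hi' i).toSubmodule := by
    refine lt_of_le_of_ne (inf_le_inf_left _ (hle.trans (hL.le i))) fun heq => hwi' (hle ?_)
    have : w ∈ (weightSpace h M μ ⊓ (hi' j).toSubmodule : Submodule K M) := heq ▸ ⟨hw, hwi⟩
    exact this.2
  have : FiniteDimensional K (weightSpace h M μ ⊓ (hi' i).toSubmodule : Submodule K M) :=
    Submodule.finiteDimensional_inf_left _ _
  have h1 : d j < d i := Submodule.finrank_lt_finrank_of_lt hlt
  rw [hdi] at h1
  exact absurd (Nat.sInf_le hjT) (not_le.mpr h1)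

/-- A Jordan–Hölder theorem: if two layerings have distinguished irreducible layers, and if
distinguished layers only meet distinguished layers, then these layers correspond to each other. -/
theorem IsLayering.exists_equiv (hL : IsLayering lo hi) (hL' : IsLayering lo' hi')
    (hM : ⨆ χ : Dual K h, weightSpace h M χ = ⊤)
    (hfd : ∀ χ : Dual K h, FiniteDimensional K (weightSpace h M χ)) (p : I → Prop) (q : I' → Prop)
    (hp : ∀ i, p i → LieModule.IsIrreducible K g (Subquot (hi i) (lo i)))
    (hq : ∀ i, q i → LieModule.IsIrreducible K g (Subquot (hi' i) (lo' i)))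
    (hpq : ∀ i j, p i → Meets (lo i) (hi i) (lo' j) (hi' j) → q j)
    (hqp : ∀ i j, q j → Meets (lo' j) (hi' j) (lo i) (hi i) → p i) :
    ∃ f : {i // p i} ≃ {j // q j}, ∀ i : {i // p i},
      Nonempty (Subquot (hi i) (lo i) ≃ₗ⁅K,g⁆ Subquot (hi' (f i)) (lo' (f i))) := by
  have h1 : ∀ i : {i // p i}, ∃ j, Meets (lo i) (hi i) (lo' j) (hi' j) := fun i =>
    hL'.exists_meets hM hfd (hp i i.2)
  have h2 : ∀ j : {j // q j}, ∃ i, Meets (lo' j) (hi' j) (lo i) (hi i) := fun j =>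
    hL.exists_meets hM hfd (hq j j.2)
  choose F hF using h1
  choose G hG using h2
  have hFq : ∀ i, q (F i) := fun i => hpq i _ i.2 (hF i)
  have hGp : ∀ j, p (G j) := fun j => hqp _ j j.2 (hG j)
  refine ⟨⟨fun i => ⟨F i, hFq i⟩, fun j => ⟨G j, hGp j⟩, fun i => ?_, fun j => ?_⟩, fun i => ?_⟩
  · exact Subtype.ext (hL.eq_of_meets (hG ⟨F i, hFq i⟩) ((hF i).symm (hL.le i) (hq _ (hFq i))))
  · exact Subtype.ext (hL'.eq_of_meets (hF ⟨G j, hGp j⟩) ((hG j).symm (hL'.le j) (hp _ (hGp j))))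
  · exact (hF i).nonempty_equiv (hL.le i) (hp i i.2) (hq _ (hFq i))

theorem GenCompSeries.isLayering {J : Type*} [LinearOrder J] (S : GenCompSeries K g M J) :
    IsLayering (below S.sub) S.sub where
  le _ := iSup₂_le fun _ hk => (S.strictMono hk).le
  le_of_lt i _ hij := le_iSup₂ (f := fun k _ => S.sub k) i hij
  exhaust := S.exhaust

theorem BddCompSeries.isLayering {b : LieSubalgebra K g} {χ ψ : Dual K h}
    (S : BddCompSeries M h b χ ψ) :
    IsLayering (fun j : Fin S.length => S.sub j.castSucc)
      (fun j : Fin S.length => S.sub j.succ) where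
  le j := S.mono (Fin.castSucc_le_succ j)
  le_of_lt i j hij := S.mono (Fin.succ_le_castSucc_iff.mpr hij)
  exhaust v hv := by
    by_contra! hc
    have : ∀ j, v ∉ S.sub j := by
      intro j
      induction j using Fin.induction with
      | zero => rw [S.bot]; simpa using hv
      | succ j ih => exact fun h1 => ih (hc j h1)
    refine this (Fin.last _) ?_
    rw [S.top]
    trivial

theorem GenCompSeries.equivalent (hM : ⨆ χ : Dual K h, weightSpace h M χ = ⊤)
    (hfd : ∀ χ : Dual K h, FiniteDimensional K (weightSpace h M χ)) {J J' : Type*}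
    [LinearOrder J] [LinearOrder J'] (S : GenCompSeries K g M J) (S' : GenCompSeries K g M J') :
    S.Equivalent S' := by
  obtain ⟨f, hf⟩ := S.isLayering.exists_equiv S'.isLayering hM hfd (fun _ => True) (fun _ => True)
    (fun i _ => S.simple i) (fun i _ => S'.simple i) (fun _ _ _ _ => trivial)
    (fun _ _ _ _ => trivial)
  refine ⟨(Equiv.subtypeUnivEquiv fun _ => trivial).symm.trans
    (f.trans (Equiv.subtypeUnivEquiv fun _ => trivial)), fun j => hf ⟨j, ?_⟩⟩
  trivial

end Layers

/-! ### Uniqueness for bounded composition series. -/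

section Uniqueness

variable {K : Type*} [Field K] [CharZero K] [IsAlgClosed K] {g : Type*} [LieRing g]
  [LieAlgebra K g] {h b : LieSubalgebra K g}
  {M : Type*} [AddCommGroup M] [Module K M] [LieRingModule g M] [LieModule K g M]

variable (hh : IsSplittingMaximalToral h) (hb : Maximal IsLocallySolvable b) (hhb : h ≤ b)
  (hM : ⨆ χ : Dual K h, weightSpace h M χ = ⊤)
  (hfd : ∀ χ : Dual K h, FiniteDimensional K (weightSpace h M χ))

include hh hb hhb

theorem weightSpace_ne_bot_of_equiv {X : Type*} [AddCommGroup X] [Module K X] [LieRingModule g X]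
    [LieModule K g X] {μ : Dual K h} (e : X ≃ₗ⁅K,g⁆ SimpleHW h b μ) : weightSpace h X μ ≠ ⊥ := by
  obtain ⟨v, hv, hv0⟩ := exists_weight_simpleHW hh hb hhb μ
  refine (Submodule.ne_bot_iff _).mpr ⟨e.symm v, mem_weightSpace_of_equiv e.symm hv, fun h0 => ?_⟩
  exact hv0 (e.symm.toEquiv.injective (h0.trans (map_zero
    (e.symm : SimpleHW h b μ →ₗ⁅K,g⁆ X)).symm))

include hM in
/-- A factor of a bounded composition series that meets a layer isomorphic to `L(μ)`, with `μ`
between the bounds, is relevant and isomorphic to `L(μ)`. -/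
theorem BddCompSeries.mem_rel_of_meets {χ ψ μ : Dual K h} (S : BddCompSeries M h b χ ψ)
    (hχ : Prec h b χ μ) (hψ : Prec h b μ ψ) {B A : LieSubmodule K g M}
    (hBA : B ≤ A) (e : Nonempty (Subquot A B ≃ₗ⁅K,g⁆ SimpleHW h b μ)) (j : Fin S.length)
    (hR : Meets B A (S.sub j.castSucc) (S.sub j.succ)) :
    j ∈ S.rel ∧ Nonempty (S.Factor j ≃ₗ⁅K,g⁆ SimpleHW h b μ) := by
  obtain ⟨e⟩ := e
  have hirr := isIrreducible_of_equiv e (isIrreducible_simpleHW hh hb hhb μ)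
  have key : ∀ ξ : Dual K h, Nonempty (S.Factor j ≃ₗ⁅K,g⁆ SimpleHW h b ξ) → ξ = μ := by
    rintro ξ ⟨e'⟩
    obtain ⟨e''⟩ := hR.nonempty_equiv hBA hirr
      (isIrreducible_of_equiv e' (isIrreducible_simpleHW hh hb hhb ξ))
    exact eq_of_simpleHW_equiv hh hb hhb ((e'.symm.trans e''.symm).trans e)
  by_cases hj : j ∈ S.rel
  · obtain ⟨ξ, -, -, e'⟩ := S.of_rel j hj
    exact ⟨hj, key ξ e' ▸ e'⟩
  · exfalso
    rcases S.of_not_rel j hj with h0 | ⟨ξ, -, -, hξ, e'⟩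
    · exact hR.weightSpace_ne_bot hM hirr (weightSpace_ne_bot_of_equiv hh hb hhb e) (h0 μ hχ hψ)
    · exact hξ (key ξ e' ▸ hψ)

include hM hfd

theorem BddCompSeries.equivalent {χ ψ : Dual K h} (S S' : BddCompSeries M h b χ ψ) :
    S.Equivalent S' := by
  have hirr : ∀ (S : BddCompSeries M h b χ ψ), ∀ j ∈ S.rel,
      LieModule.IsIrreducible K g (S.Factor j) := by
    intro S j hj
    obtain ⟨ξ, -, -, ⟨e⟩⟩ := S.of_rel j hj
    exact isIrreducible_of_equiv e (isIrreducible_simpleHW hh hb hhb ξ)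
  have hmeet : ∀ (S S' : BddCompSeries M h b χ ψ), ∀ i j, i ∈ S.rel →
      Meets (S.sub i.castSucc) (S.sub i.succ) (S'.sub j.castSucc) (S'.sub j.succ) →
        j ∈ S'.rel := by
    intro S S' i j hi hR
    obtain ⟨ξ, hχ, hψ, e⟩ := S.of_rel i hi
    exact (S'.mem_rel_of_meets hh hb hhb hM hχ hψ (S.isLayering.le i) e j hR).1
  exact S.isLayering.exists_equiv S'.isLayering hM hfd (· ∈ S.rel) (· ∈ S'.rel)
    (hirr S) (hirr S') (hmeet S S') (fun i j => hmeet S' S j i)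

/-- The bounds of the two series may differ: a copy of `L(μ)` in one meets only copies of `L(μ)` in
the other as long as `μ` lies within both pairs of bounds. -/
theorem BddCompSeries.mult_eq {χ ψ χ' ψ' μ : Dual K h} (S : BddCompSeries M h b χ ψ)
    (S' : BddCompSeries M h b χ' ψ') (hχ : Prec h b χ μ) (hψ : Prec h b μ ψ)
    (hχ' : Prec h b χ' μ) (hψ' : Prec h b μ ψ') : S.mult μ = S'.mult μ := by
  have hirr : ∀ {X : Type _} [AddCommGroup X] [Module K X] [LieRingModule g X]
      [LieModule K g X], Nonempty (X ≃ₗ⁅K,g⁆ SimpleHW h b μ) → LieModule.IsIrreducible K g X := by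
    rintro X _ _ _ _ ⟨e⟩
    exact isIrreducible_of_equiv e (isIrreducible_simpleHW hh hb hhb μ)
  obtain ⟨f, -⟩ := S.isLayering.exists_equiv S'.isLayering hM hfd
    (fun j => Nonempty (S.Factor j ≃ₗ⁅K,g⁆ SimpleHW h b μ))
    (fun j => Nonempty (S'.Factor j ≃ₗ⁅K,g⁆ SimpleHW h b μ))
    (fun _ => hirr) (fun _ => hirr)
    (fun i j e hR => (S'.mem_rel_of_meets hh hb hhb hM hχ' hψ' (S.isLayering.le i) e j hR).2)
    (fun i j e hR => (S.mem_rel_of_meets hh hb hhb hM hχ hψ (S'.isLayering.le j) e i hR).2)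
  exact Nat.card_congr f

end Uniqueness

theorem exists_seq_of_reflTransGen {α : Type*} {r : α → α → Prop} {a c : α}
    (hr : Relation.ReflTransGen r a c) :
    ∃ (k : ℕ) (f : ℕ → α), f 0 = a ∧ f k = c ∧ ∀ i < k, r (f i) (f (i + 1)) := by
  induction hr using Relation.ReflTransGen.head_induction_on with
  | refl => exact ⟨0, fun _ => c, rfl, rfl, fun i hi => absurd hi i.not_lt_zero⟩
  | @head a x hax _ ih =>
    obtain ⟨k, f, h0, hk, hf⟩ := ih
    refine ⟨k + 1, fun n => n.casesOn a f, rfl, hk, fun i hi => ?_⟩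
    cases i with
    | zero => change r a (f 0); rwa [h0]
    | succ i => exact hf i (by omega)

/-! ### Existence of bounded composition series. -/

section Existence

variable {K : Type*} [Field K] {g : Type*} [LieRing g] [LieAlgebra K g] {h b : LieSubalgebra K g}
  {M : Type*} [AddCommGroup M] [Module K M] [LieRingModule g M] [LieModule K g M]

theorem isIrreducible_subquot {A B : LieSubmodule K g M} (hBA : B ≤ A) {w : M} (hA : w ∈ A)
    (hB : w ∉ B) (hmax : ∀ N : LieSubmodule K g M, B ≤ N → N ≤ A → N ≠ B → A ≤ N) :
    LieModule.IsIrreducible K g (Subquot A B) := by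
  set π := LieSubmodule.Quotient.mk' (B.comap A.incl) with hπ
  have hsurj : Function.Surjective π := LieSubmodule.Quotient.surjective_mk' _
  have : Nontrivial (Subquot A B) := ⟨π ⟨w, hA⟩, 0, fun h0 => hB (subquot_mk_eq_zero.mp h0)⟩
  refine LieModule.IsIrreducible.mk fun N hN => ?_
  have hmem : ∀ a : A, (a : M) ∈ (N.comap π).map A.incl ↔ π a ∈ N := fun a => by
    rw [LieSubmodule.mem_map]
    exact ⟨fun ⟨a', ha', h⟩ => Subtype.ext h ▸ ha', fun ha => ⟨a, ha, rfl⟩⟩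
  have hle : A ≤ (N.comap π).map A.incl := by
    refine hmax _ (fun v hv => ?_) (fun v hv => ?_) fun h0 => hN ?_
    · rw [hmem ⟨v, hBA hv⟩, hπ, subquot_mk_eq_zero.mpr hv]
      exact N.zero_mem
    · obtain ⟨a, -, rfl⟩ := (LieSubmodule.mem_map _).mp hv
      exact a.2
    · rw [LieSubmodule.eq_bot_iff]
      intro u hu
      obtain ⟨a, rfl⟩ := hsurj u
      exact subquot_mk_eq_zero.mpr (h0 ▸ (hmem a).mpr hu)
  rw [eq_top_iff]
  intro u _
  obtain ⟨a, rfl⟩ := hsurj u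
  exact (hmem a).mp (hle a.2)

/-- A submodule `C` generated by `w` modulo `A` contains a maximal submodule over `A`. -/
theorem exists_maximal_notMem {A C : LieSubmodule K g M} {w : M} (hAC : A ≤ C) (hwC : w ∈ C)
    (hwA : w ∉ A) (hgen : ∀ N : LieSubmodule K g M, A ≤ N → w ∈ N → C ≤ N) :
    ∃ D, A ≤ D ∧ D ≤ C ∧ w ∉ D ∧ LieModule.IsIrreducible K g (Subquot C D) := by
  obtain ⟨D, hAD, hD⟩ := zorn_le_nonempty₀ {D : LieSubmodule K g M | A ≤ D ∧ D ≤ C ∧ w ∉ D}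
    (fun c hc hchain N hN => by
      refine ⟨sSup c, ⟨(hc hN).1.trans (le_sSup hN), sSup_le fun D hD => (hc hD).2.1, fun hw => ?_⟩,
        fun D hD => le_sSup hD⟩
      rw [← LieSubmodule.mem_toSubmodule, LieSubmodule.sSup_toSubmodule,
        Submodule.mem_sSup_of_directed] at hw
      · obtain ⟨_, ⟨D, hD, rfl⟩, hwD⟩ := hw
        exact (hc hD).2.2 hwD
      · exact ⟨_, N, hN, rfl⟩
      · rintro _ ⟨D, hD, rfl⟩ _ ⟨D', hD', rfl⟩
        obtain ⟨E, hE, h1, h2⟩ := hchain.directedOn D hD D' hD'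
        exact ⟨_, ⟨E, hE, rfl⟩, h1, h2⟩) A ⟨le_rfl, hAC, hwA⟩
  refine ⟨D, hAD, hD.prop.2.1, hD.prop.2.2, isIrreducible_subquot hD.prop.2.1 hwC hD.prop.2.2
    fun N hDN hNC hne => hgen N (hAD.trans hDN) ?_⟩
  by_contra hw
  exact hne (le_antisymm (hD.le_of_ge ⟨hAD.trans hDN, hNC, hw⟩ hDN) hDN)

theorem IsExtO.exists_finiteDimensional_stable (hM : IsExtO h b M) (W : Submodule K M)
    [FiniteDimensional K W] : ∃ F : Submodule K M, W ≤ F ∧ FiniteDimensional K F ∧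
      ∀ x ∈ nilrad b, ∀ v ∈ F, ⁅x, v⁆ ∈ F := by
  obtain ⟨s, rfl⟩ := (Module.Finite.iff_fg.mp ‹_› : W.FG)
  choose F hF hfd hst using hM.locFin
  have := hfd
  refine ⟨s.sup F, Submodule.span_le.mpr fun v hv => (Finset.le_sup (f := F) hv) (hF v),
    inferInstance, fun x hx v hv => ?_⟩
  have hle : s.sup F ≤ (s.sup F).comap (LieModule.toEnd K g M x) :=
    Finset.sup_le fun u hu v hv => (Finset.le_sup (f := F) hu) (hst u x hx v hv)
  exact hle hv

variable [CharZero K] [IsAlgClosed K] (hh : IsSplittingMaximalToral h)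
  (hb : Maximal IsLocallySolvable b) (hhb : h ≤ b)

include hh hb hhb

/-- If `A ⊆ B` and some weight vector in `F ∩ B` with weight `⪰ χ` is not in `A`, then there is a
factor `D ⊆ C` between `A` and `B` that is isomorphic to some `L(ξ)`, `ξ ⪰ χ`. -/
theorem exists_simpleHW_between {F : Submodule K M} [FiniteDimensional K F]
    (hF : ∀ x ∈ nilrad b, ∀ v ∈ F, ⁅x, v⁆ ∈ F) {χ η : Dual K h} {A B : LieSubmodule K g M}
    (hAB : A ≤ B) (hη : Prec h b χ η)
    (hex : ∃ w ∈ weightSpace h M η, w ∈ F ∧ w ∈ B ∧ w ∉ A) :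
    ∃ (D C : LieSubmodule K g M) (ξ : Dual K h), A ≤ D ∧ D ≤ C ∧ C ≤ B ∧ (∃ w ∈ F, w ∈ C ∧ w ∉ D) ∧
      Prec h b χ ξ ∧ Nonempty (Subquot C D ≃ₗ⁅K,g⁆ SimpleHW h b ξ) := by
  have hP := isPointed_posCone hh hb.1
  have hbs := toSubmodule_eq_weightSum hh hb hhb
  set T : Set (Dual K h) := {ξ | Prec h b χ ξ ∧ ∃ w ∈ weightSpace h M ξ, w ∈ F ∧ w ∈ B ∧ w ∉ A}
    with hT
  have hTfin : T.Finite := (finite_setOf_inf_weightSpace_ne_bot F).subset fun ξ hξ => by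
    obtain ⟨-, w, hw, hwF, -, hwA⟩ := hξ
    exact (Submodule.ne_bot_iff _).mpr ⟨w, ⟨hwF, hw⟩, by rintro rfl; exact hwA A.zero_mem⟩
  let _ := hP.partialOrder
  -- Maximality makes `w` a highest weight vector modulo `A`: a positive root vector sends it to a
  -- vector of `F ⊓ B` of larger weight, which must lie in `A`.
  obtain ⟨ξ, hξ⟩ := hTfin.exists_maximal ⟨η, hη, hex⟩
  obtain ⟨hχξ, w, hw, hwF, hwB, hwA⟩ := hξ.prop
  have hnw : ∀ x ∈ nilrad b, ⁅x, w⁆ ∈ A := by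
    intro x hx
    obtain ⟨S, u, hS, hu, -, rfl⟩ :=
      exists_sum_of_mem_weightSum (nilrad_le_weightSum hh hb.1 hhb hx)
    rw [sum_lie]
    refine A.toSubmodule.sum_mem fun p hp => ?_
    obtain ⟨hpP, hp0⟩ := hS p hp
    by_contra hc
    have hup : u p ∈ nilrad b :=
      weightSpace_le_nilrad hhb hp0 (hbs ▸ weightSpace_le_weightSum hpP) (hu p)
    have hpT : p + ξ ∈ T := by
      refine ⟨?_, _, lie_mem_weightSpace_add (hu p) hw, hF _ hup w hwF, B.lie_mem hwB, hc⟩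
      change p + ξ - χ ∈ posCone h b
      rw [add_sub_assoc]
      exact add_mem hpP hχξ
    have hle : ξ ≤ p + ξ := by
      change p + ξ - ξ ∈ posCone h b
      rwa [add_sub_cancel_right]
    have heq := le_antisymm (hξ.le_of_ge hpT hle) hle
    exact hp0 (by simpa using heq)
  set C := A ⊔ LieSubmodule.lieSpan K g {w} with hC
  have hwC : w ∈ C := (le_sup_right : _ ≤ C) (LieSubmodule.subset_lieSpan (Set.mem_singleton w))
  obtain ⟨D, hAD, hDC, hwD, hirr⟩ := exists_maximal_notMem (le_sup_left : A ≤ C) hwC hwA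
    fun N hAN hwN => sup_le hAN (LieSubmodule.lieSpan_le.mpr (Set.singleton_subset_iff.mpr hwN))
  refine ⟨D, C, ξ, hAD, hDC, sup_le hAB
    (LieSubmodule.lieSpan_le.mpr (Set.singleton_subset_iff.mpr hwB)), ⟨w, hwF, hwC, hwD⟩, hχξ, ?_⟩
  refine nonempty_equiv_simpleHW hh hb hhb hirr
    (w := LieSubmodule.Quotient.mk' (D.comap C.incl) ⟨w, hwC⟩) (fun x => ?_)
    (fun h0 => hwD (subquot_mk_eq_zero.mp h0)) fun x hx => ?_
  · rw [← LieModuleHom.map_lie, ← map_smul]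
    congr 1
    exact Subtype.ext (hw x)
  · rw [← LieModuleHom.map_lie, subquot_mk_eq_zero]
    exact hAD (hnw x hx)

/-- Induction on a bound `n` for the growth of `dim (F ⊓ ·)` from `A` to `B`. A factor `L(ξ)` found
between them contains a class from `F`, so the pieces below and above it grow by less. When none is
available, `B / A` has no weight between the bounds. -/
theorem exists_reflTransGen {F : Submodule K M} [FiniteDimensional K F]
    (hM : ⨆ χ : Dual K h, weightSpace h M χ = ⊤)
    (hF : ∀ x ∈ nilrad b, ∀ v ∈ F, ⁅x, v⁆ ∈ F) {χ ψ : Dual K h}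
    (hW : ∀ μ, Prec h b χ μ → Prec h b μ ψ → weightSpace h M μ ≤ F) (n : ℕ) :
    ∀ A B : LieSubmodule K g M, A ≤ B →
      finrank K (F ⊓ B.toSubmodule : Submodule K M) ≤
        finrank K (F ⊓ A.toSubmodule : Submodule K M) + n →
      Relation.ReflTransGen (fun A B : LieSubmodule K g M => A ≤ B ∧
        ((∀ μ, Prec h b χ μ → Prec h b μ ψ → weightSpace h (Subquot B A) μ = ⊥) ∨
        ∃ ξ, Prec h b χ ξ ∧ Nonempty (Subquot B A ≃ₗ⁅K,g⁆ SimpleHW h b ξ))) A B := by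
  have hmono : ∀ A B : LieSubmodule K g M, A ≤ B →
      finrank K (F ⊓ A.toSubmodule : Submodule K M) ≤
        finrank K (F ⊓ B.toSubmodule : Submodule K M) := fun A B hAB =>
    have : FiniteDimensional K (F ⊓ B.toSubmodule : Submodule K M) :=
      Submodule.finiteDimensional_inf_left _ _
    Submodule.finrank_mono (inf_le_inf_left F hAB)
  have hlt : ∀ D C : LieSubmodule K g M, D ≤ C → (∃ w ∈ F, w ∈ C ∧ w ∉ D) →
      finrank K (F ⊓ D.toSubmodule : Submodule K M) <
        finrank K (F ⊓ C.toSubmodule : Submodule K M) := by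
    rintro D C hDC ⟨w, hwF, hwC, hwD⟩
    have : FiniteDimensional K (F ⊓ C.toSubmodule : Submodule K M) :=
      Submodule.finiteDimensional_inf_left _ _
    refine Submodule.finrank_lt_finrank_of_lt
      (lt_of_le_of_ne (inf_le_inf_left F hDC) fun heq => hwD ?_)
    have : w ∈ (F ⊓ D.toSubmodule : Submodule K M) := heq ▸ ⟨hwF, hwC⟩
    exact this.2
  induction n using Nat.strong_induction_on with
  | _ n ih =>
    intro A B hAB hn
    by_cases hex : ∃ η, Prec h b χ η ∧ Prec h b η ψ ∧ ∃ w ∈ weightSpace h M η, w ∈ B ∧ w ∉ A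
    · obtain ⟨η, hχη, hηψ, w, hw, hwB, hwA⟩ := hex
      obtain ⟨D, C, ξ, hAD, hDC, hCB, hw, hξ, e⟩ := exists_simpleHW_between hh hb hhb hF hAB hχη
        ⟨w, hw, hW η hχη hηψ hw, hwB, hwA⟩
      have h1 := hmono _ _ hAD
      have h2 := hlt _ _ hDC hw
      have h3 := hmono _ _ hCB
      refine ((ih (n - 1) (by omega) A D hAD (by omega)).tail
        ⟨hDC, Or.inr ⟨ξ, hξ, e⟩⟩).trans (ih (n - 1) (by omega) C B hCB (by omega))
    · refine .single ⟨hAB, Or.inl fun μ hχμ hμψ => ?_⟩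
      by_contra hμ
      exact hex ⟨μ, hχμ, hμψ, exists_weight_of_subquot hM hμ⟩

/-- Bounded composition series exist. -/
theorem IsExtO.nonempty_bddCompSeries (hM : IsExtO h b M) (hD : IsDynkin h b) {χ ψ : Dual K h}
    (hχψ : Prec h b χ ψ) : Nonempty (BddCompSeries M h b χ ψ) := by
  have hfin := (finite_setOf_prec hh hb hhb hD χ ψ).to_subtype
  have hfd := hM.finDim
  -- The interval is finite, so its weight spaces together span a finite-dimensional subspace, which
  -- local `n`-finiteness enlarges to a stable one.
  obtain ⟨F, hWF, hFfd, hF⟩ := hM.exists_finiteDimensional_stable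
    (⨆ μ : {μ | Prec h b χ μ ∧ Prec h b μ ψ}, weightSpace h M (μ : Dual K h))
  have hchain := exists_reflTransGen hh hb hhb hM.weight hF
    (fun μ h1 h2 => (le_iSup (fun μ : {μ | Prec h b χ μ ∧ Prec h b μ ψ} =>
      weightSpace h M (μ : Dual K h)) ⟨μ, h1, h2⟩).trans hWF) _ ⊥ ⊤ bot_le (Nat.le_add_left _ _)
  obtain ⟨k, f, h0, hk, hf⟩ := exists_seq_of_reflTransGen hchain
  refine ⟨⟨k, fun i => f i, Fin.monotone_iff_le_succ.mpr fun i => (hf i i.2).1, h0, ?_,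
    {j | ∃ ξ, Prec h b χ ξ ∧ Prec h b ξ ψ ∧
      Nonempty (Subquot (f (j + 1)) (f j) ≃ₗ⁅K,g⁆ SimpleHW h b ξ)}, fun j hj => hj,
    fun j hj => (hf j j.2).2.imp_right ?_⟩⟩
  · rw [Fin.val_last, hk]
  · rintro ⟨ξ, hξ, e⟩
    have hξψ : ¬ Prec h b ξ ψ := fun hc => hj ⟨ξ, hξ, hc, e⟩
    -- A factor `L(ξ)` outside the relevant set has `ξ ⋠ ψ`; then `ξ ≠ χ`, because `χ ⪯ ψ`.
    exact ⟨ξ, hξ, fun h1 => hξψ (h1 ▸ hχψ), hξψ, e⟩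

end Existence

end ExtO

theorem mainTheorem9 {K : Type*} [Field K] [IsAlgClosed K] [CharZero K]
    {g : Type*} [LieRing g] [LieAlgebra K g] (hg : ExtO.IsRootReductive K g)
    (h b : LieSubalgebra K g) (hh : ExtO.IsSplittingMaximalToral h)
    (hb : ExtO.IsSplittingBorel b) (hhb : h ≤ b) (hD : ExtO.IsDynkin h b)
    {M : Type*} [AddCommGroup M] [Module K M] [LieRingModule g M] [LieModule K g M]
    (hM : ExtO.IsExtO h b M) :
    (∀ (J J' : Type*) [LinearOrder J] [LinearOrder J']
      (S : ExtO.GenCompSeries K g M J) (S' : ExtO.GenCompSeries K g M J'), S.Equivalent S') ∧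
    (∀ χ ψ : Module.Dual K h, ExtO.Prec h b χ ψ →
      ∀ S S' : ExtO.BddCompSeries M h b χ ψ, S.Equivalent S') ∧
    (∀ μ : Module.Dual K h, ∃! m : ℕ, ∀ χ ψ : Module.Dual K h,
      ExtO.Prec h b χ μ → ExtO.Prec h b μ ψ →
        Nonempty (ExtO.BddCompSeries M h b χ ψ) ∧
        ∀ S : ExtO.BddCompSeries M h b χ ψ, S.mult μ = m) := by
  refine ⟨fun J J' _ _ S S' => S.equivalent hM.weight hM.finDim S', fun χ ψ _ S S' =>
    S.equivalent hh hb.1 hhb hM.weight hM.finDim S', fun μ => ?_⟩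
  have hμ : ExtO.Prec h b μ μ := by
    change μ - μ ∈ AddSubmonoid.closure _
    rw [sub_self]
    exact zero_mem _
  -- The multiplicity is read off from a series with both bounds equal to `μ`; every other
  -- admissible pair of bounds is compared with this one.
  obtain ⟨S₀⟩ := hM.nonempty_bddCompSeries hh hb.1 hhb hD hμ
  refine ⟨S₀.mult μ, fun χ ψ hχ hψ => ⟨hM.nonempty_bddCompSeries hh hb.1 hhb hD ?_, fun S =>
    S.mult_eq hh hb.1 hhb hM.weight hM.finDim S₀ hχ hψ hμ hμ⟩, fun m hm => ?_⟩
  · change ψ - χ ∈ AddSubmonoid.closure _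
    rw [← sub_add_sub_cancel ψ μ χ]
    exact add_mem hψ hχ
  · exact ((hm μ μ hμ hμ).2 S₀).symm
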